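/- Let $n\ge 1$ be an integer, let $s>0$ with $s\neq 1$, and put $$m_s=\begin{cases}-\dfrac{ns}{2}-ns(1-s), & 0<s<1,\\[1ex] -\dfrac{ns}{2}, & 1<s\le 2,\\[1ex] -n(s-1), & s>2.\end{cases}$$ For $m\in\mathbb R$, let $S^m_{1,0}(\mathbb R^{2n})$ be the set of all complex-valued $\sigma\in C^\infty(\mathbb R^{2n})$ such that for every multi-index $\alpha$ there is a constant $C_\alpha$ with $|\partial^\alpha\sigma(\zeta)|\le C_\alpha(1+|\zeta|)^{m-|\alpha|}$ for all $\zeta\in\mathbb R^{2n}$. For a measurable function $\tau$ on $\mathbb R^n\times\mathbb R^n$ of at most polynomial growth, that is, $|\tau(\xi,\eta)|\le c(1+|\xi|+|\eta|)^L$ for some $c>0$, $L\in\mathbb R$, and for Schwartz functions $f,g\in\mathcal S(\mathbb R^n)$, define $$T_\tau(f,g)(x)=\frac1{(2\pi)^{2n}}\iint_{\mathbb R^n\times\mathbb R^n}e^{ix\cdot(\xi+\eta)}\,\tau(\xi,\eta)\,\widehat f(\xi)\,\widehat g(\eta)\,d\xi\,d\eta,\qquad \widehat f(\xi)=\int_{\mathbb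 R^n}e^{-i\xi\cdot x}f(x)\,dx.$$ For $p,q,r\in[1,\infty]$, such a $\tau$ is called a bilinear Fourier multiplier for $L^p\times L^q\to L^r$ if there is a constant $A>0$ such that $\|T_\tau(f,g)\|_{L^r}\le A\|f\|_{L^p}\|g\|_{L^q}$ for all $f,g\in\mathcal S(\mathbb R^n)$. **Theorem.** If $m<m_s$, then for every $\sigma\in S^m_{1,0}(\mathbb R^{2n})$ the function $$e^{i(|\xi|^s+|\eta|^s+|\xi+\eta|^s)}\,\sigma(\xi,\eta)$$ is a bilinear Fourier multiplier for $L^\infty\times L^\infty\to L^\infty$, for $L^1\times L^\infty\to L^1$, and for $L^\infty\times L^1\to L^1$. -/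

import Mathlib

open MeasureTheory SchwartzMap
open scoped ENNReal ContDiff

noncomputable section

/-- `ℝⁿ` with its Euclidean norm, inner product and Lebesgue measure. -/
abbrev Rn (n : ℕ) : Type := EuclideanSpace ℝ (Fin n)

/-- `ℝ²ⁿ = ℝⁿ × ℝⁿ` with the Euclidean norm `(|ξ|² + |η|²)^{1/2}`. -/
abbrev R2n (n : ℕ) : Type := WithLp 2 (Rn n × Rn n)

/-- The class `S^m_{1,0}` on a real normed space `V` (applied to `V = ℝ²ⁿ`): smooth complex-valued
functions whose derivatives of order `k` are `O((1 + |ζ|)^{m-k})` for every `k`.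
The bound on the operator norm of the `k`-th derivative is, for `V = ℝᵈ`, the same (up to the
value of the constant) as the bounds on all the partial derivatives `∂^α σ` with `|α| = k`. -/
def SymbolClass {V : Type*} [NormedAddCommGroup V] [NormedSpace ℝ V] (m : ℝ) (σ : V → ℂ) : Prop :=
  ContDiff ℝ ∞ σ ∧
    ∀ k : ℕ, ∃ C : ℝ, ∀ ζ : V, ‖iteratedFDeriv ℝ k σ ζ‖ ≤ C * (1 + ‖ζ‖) ^ (m - (k : ℝ))

/-- The Fourier transform `f̂(ξ) = ∫ e^{-i x·ξ} f(x) dx`. -/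
def fourierHat {n : ℕ} (f : Rn n → ℂ) (ξ : Rn n) : ℂ :=
  ∫ x : Rn n, Complex.exp (-Complex.I * (inner ℝ x ξ : ℝ)) * f x

/-- The bilinear Fourier multiplier operator
`T_τ(f, g)(x) = (2π)^{-2n} ∬ e^{i x·(ξ+η)} τ(ξ, η) f̂(ξ) ĝ(η) dξ dη`
on Schwartz functions. The integrand is absolutely integrable when `τ` is measurable
and of at most polynomial growth. -/
def bilinearOp {n : ℕ} (τ : Rn n → Rn n → ℂ) (f g : 𝓢(Rn n, ℂ)) (x : Rn n) : ℂ :=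
  (((2 * Real.pi) ^ (2 * n) : ℝ) : ℂ)⁻¹ *
    ∫ p : Rn n × Rn n, Complex.exp (Complex.I * (inner ℝ x (p.1 + p.2) : ℝ)) * τ p.1 p.2 *
      fourierHat f p.1 * fourierHat g p.2

/-- `τ` is a bilinear Fourier multiplier for `L^p × L^q → L^r`: it is measurable and of at most
polynomial growth (so that `T_τ` is defined on Schwartz functions), and
`‖T_τ(f, g)‖_{L^r} ≤ A ‖f‖_{L^p} ‖g‖_{L^q}` for all Schwartz functions `f`, `g`, with a finite
constant `A` independent of `f` and `g`. (Schwartz functions belong to every `L^p`.) -/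
structure IsBilinearMultiplier {n : ℕ} (p q r : ℝ≥0∞) (τ : Rn n → Rn n → ℂ) : Prop where
  measurable : Measurable (fun z : Rn n × Rn n => τ z.1 z.2)
  growth : ∃ c L : ℝ, ∀ ξ η : Rn n, ‖τ ξ η‖ ≤ c * (1 + ‖ξ‖ + ‖η‖) ^ L
  bound : ∃ A : ℝ, 0 < A ∧ ∀ f g : 𝓢(Rn n, ℂ),
    eLpNorm (bilinearOp τ f g) r volume ≤
      ENNReal.ofReal A * eLpNorm f p volume * eLpNorm g q volume

/-- The critical order `m_s` (used for `s > 0`, `s ≠ 1`). -/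
def criticalOrder (n : ℕ) (s : ℝ) : ℝ :=
  if s < 1 then -(n * s / 2) - n * s * (1 - s)
  else if s ≤ 2 then -(n * s / 2)
  else -(n * (s - 1))

/-- The function `e^{i(|ξ|^s + |η|^s + |ξ+η|^s)} σ(ξ, η)`. -/
def oscillatingSymbol {n : ℕ} (s : ℝ) (σ : R2n n → ℂ) (ξ η : Rn n) : ℂ :=
  Complex.exp (Complex.I * ((‖ξ‖ ^ s + ‖η‖ ^ s + ‖ξ + η‖ ^ s : ℝ) : ℂ)) *
    σ (WithLp.toLp 2 (ξ, η))

end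

/-! Split the exponentials in `ξ`, `η` and `ξ + η` into dyadic shells. For shell multipliers `m₁,
m₂, m₃` the form `∬ m₁(ξ) m₂(η) m₃(ξ+η) f̂(ξ) ĝ(η)` equals `∫ k₃ · m₁(D)f · m₂(D)g`, where `k₃` is
the Fourier transform of `m₃` (`integral_trilinear`). Two facts control it.

Kernel size. For a shell at frequency `2^k` the kernel is at most a constant times `2^{kn(1-s/2)}`
and decays to any polynomial order beyond `|x| ~ 2^{k(s-1)}` (`exists_fourier_dyadicPiece_bound`).
Stationary phase is replaced by a squaring argument: the autocorrelation of the integrand has phase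
`l(φ(ξ+h) - φ(ξ))`, whose gradient is at least a multiple of `l|h|` because `ξ ↦ ∇|ξ|^s` is
expanding on annuli for `s ≠ 1` (`dispersive_bound`).

Weighted `L²`. The derivatives of order `i` of the shell multiplier are `O(2^{ik(s-1)})`, so `m(D)`
is bounded on `L²` with a polynomial weight of any scale `R ≥ 2^{k(s-1)}`. A bounded `f` has
weighted norm at most `R^{n/2} ‖f‖_∞`, and hence, up to a constant, so does `m(D)f`
(`eLpNorm_weight_inv_fourierMultiplier`).

Cauchy-Schwarz gives the bound `2^{k₃n(1-s/2)} (R₁R₂)^{n/2}` (`formBound_of_weighted_kernel`),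
provided the scales `R₁, R₂` are at least the kernel scale. Choosing the scales, and for small `s`
removing one input exponential at the cost of the `L¹` norm of its kernel, every triple of shells up
to `2^j` costs at most a constant times `2^{-j m_s}` (`exists_formBound_phasePiece`).

A dyadic piece of `σ` at height `2^j` is `2^{jm}` times a superposition of characters of uniformly
bounded total mass. Characters only translate `f` and `g`, so the pieces cost `(j+3)^3 2^{j(m-m_s)}`
up to a constant; the sum over `j` converges because `m < m_s` strictly
(`exists_formBound_phaseSymbol`).

Translation invariance turns the estimate at the origin into an `L^∞` bound. For the two `L¹`
bounds, transposition permutes the frequencies `ξ, η, -(ξ+η)` and leaves the phase unchanged, so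
duality reduces them to the `L^∞` bound for a linearly transformed symbol
(`FormBound.eLpNorm_one_charForm_le`). -/

open scoped FourierTransform LineDeriv

noncomputable section

/-! ### Calculus of families with uniform derivative bounds. -/

section BddDerivs

variable {H V F G E : Type*} [NormedAddCommGroup V] [NormedSpace ℝ V]
  [NormedAddCommGroup F] [NormedSpace ℝ F] [NormedAddCommGroup G] [NormedSpace ℝ G]
  [NormedAddCommGroup E] [NormedSpace ℝ E]

/-- A family of smooth functions whose `k`-th derivatives on `K` are `O(w ^ k)`,
uniformly in the parameter. -/
def BddDerivs (K : Set V) (w : H → ℝ) (A : H → V → F) : Prop :=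
  (∀ h, ContDiff ℝ ∞ (A h)) ∧
    ∀ k : ℕ, ∃ C : ℝ, ∀ h, ∀ ξ ∈ K, ‖iteratedFDeriv ℝ k (A h) ξ‖ ≤ C * w h ^ k

theorem BddDerivs.exists_pos {K : Set V} {w : H → ℝ} {A : H → V → F} (hw : ∀ h, 0 ≤ w h)
    (hA : BddDerivs K w A) (k : ℕ) :
    ∃ C : ℝ, 1 ≤ C ∧ ∀ i ≤ k, ∀ h, ∀ ξ ∈ K, ‖iteratedFDeriv ℝ i (A h) ξ‖ ≤ C * w h ^ i := by
  choose C hC using hA.2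
  refine ⟨1 + ∑ i ∈ Finset.range (k + 1), |C i|, ?_, fun i hi h ξ hξ => ?_⟩
  · have : 0 ≤ ∑ i ∈ Finset.range (k + 1), |C i| := Finset.sum_nonneg fun i _ => abs_nonneg _
    linarith
  · refine (hC i h ξ hξ).trans ?_
    refine mul_le_mul_of_nonneg_right ?_ (pow_nonneg (hw h) _)
    have : |C i| ≤ ∑ i ∈ Finset.range (k + 1), |C i| :=
      Finset.single_le_sum (f := fun i => |C i|) (fun i _ => abs_nonneg _)
        (Finset.mem_range.2 (by omega))
    linarith [le_abs_self (C i)]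

theorem BddDerivs.exists_bound {K : Set V} {w : H → ℝ} {A : H → V → F}
    (hA : BddDerivs K w A) : ∃ C : ℝ, 1 ≤ C ∧ ∀ h, ∀ ξ ∈ K, ‖A h ξ‖ ≤ C := by
  obtain ⟨C, hC⟩ := hA.2 0
  refine ⟨max 1 C, le_max_left _ _, fun h ξ hξ => ?_⟩
  have := hC h ξ hξ
  simp only [norm_iteratedFDeriv_zero, pow_zero, mul_one] at this
  exact this.trans (le_max_right _ _)

theorem BddDerivs.reindex {H' : Type*} {K : Set V} {w : H → ℝ} {A : H → V → F}
    (hA : BddDerivs K w A) (r : H' → H) : BddDerivs K (fun h => w (r h)) (fun h => A (r h)) :=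
  ⟨fun _ => hA.1 _, fun k => (hA.2 k).imp fun _ hC _ ξ hξ => hC _ ξ hξ⟩

theorem BddDerivs.of_hasCompactSupport {K : Set V} {w : H → ℝ} (hw : ∀ h, 1 ≤ w h) {f : V → F}
    (hf : ContDiff ℝ ∞ f) (hs : HasCompactSupport f) : BddDerivs K w (fun _ => f) := by
  refine ⟨fun _ => hf, fun k => ?_⟩
  obtain ⟨C, hC⟩ := (hs.iteratedFDeriv (𝕜 := ℝ) k).exists_bound_of_continuous
    (hf.continuous_iteratedFDeriv (by exact_mod_cast le_top))
  refine ⟨max C 0, fun h ξ _ => ((hC ξ).trans (le_max_left C 0)).trans ?_⟩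
  exact le_mul_of_one_le_right (le_max_right _ _) (one_le_pow₀ (hw h))

/-- The Leibniz rule preserves the class because the weights of the two factors multiply: `w^i
w^{k-i} = w^k`. -/
theorem BddDerivs.bilin {K : Set V} {w : H → ℝ} (hw : ∀ h, 0 ≤ w h) {A : H → V → F} {B : H → V → G}
    (M : F →L[ℝ] G →L[ℝ] E) (hA : BddDerivs K w A) (hB : BddDerivs K w B) :
    BddDerivs K w (fun h ξ => M (A h ξ) (B h ξ)) := by
  refine ⟨fun h => M.isBoundedBilinearMap.contDiff.comp₂ (hA.1 h) (hB.1 h), fun k => ?_⟩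
  obtain ⟨C, hC1, hC⟩ := hA.exists_pos hw k
  obtain ⟨D, hD1, hD⟩ := hB.exists_pos hw k
  refine ⟨‖M‖ * ∑ i ∈ Finset.range (k + 1), (k.choose i : ℝ) * C * D, fun h ξ hξ => ?_⟩
  refine (M.norm_iteratedFDeriv_le_of_bilinear (hA.1 h) (hB.1 h) ξ
    (n := k) (by exact_mod_cast le_top)).trans ?_
  rw [mul_assoc, Finset.sum_mul]
  refine mul_le_mul_of_nonneg_left (Finset.sum_le_sum fun i hi => ?_) (norm_nonneg M)
  have hik : i ≤ k := by simpa [Nat.lt_succ_iff] using hi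
  have e : w h ^ k = w h ^ i * w h ^ (k - i) := by rw [← pow_add]; congr 1; omega
  calc (k.choose i : ℝ) * ‖iteratedFDeriv ℝ i (A h) ξ‖ * ‖iteratedFDeriv ℝ (k - i) (B h) ξ‖
      ≤ (k.choose i : ℝ) * (C * w h ^ i) * (D * w h ^ (k - i)) := by
        have := pow_nonneg (hw h) i
        gcongr
        · exact hC i hik h ξ hξ
        · exact hD _ (Nat.sub_le _ _) h ξ hξ
    _ = _ := by rw [e]; ring

theorem BddDerivs.mul {K : Set V} {w : H → ℝ} (hw : ∀ h, 0 ≤ w h) {A B : H → V → ℂ}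
    (hA : BddDerivs K w A) (hB : BddDerivs K w B) : BddDerivs K w (fun h ξ => A h ξ * B h ξ) :=
  hA.bilin hw (ContinuousLinearMap.mul ℝ ℂ) hB

theorem BddDerivs.smul {K : Set V} {w : H → ℝ} (hw : ∀ h, 0 ≤ w h) {A : H → V → ℝ} {B : H → V → F}
    (hA : BddDerivs K w A) (hB : BddDerivs K w B) : BddDerivs K w (fun h ξ => A h ξ • B h ξ) :=
  hA.bilin hw (ContinuousLinearMap.lsmul ℝ ℝ) hB

theorem BddDerivs.clm_comp {K : Set V} {w : H → ℝ} {A : H → V → F}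
    (L : F →L[ℝ] G) (hA : BddDerivs K w A) : BddDerivs K w (fun h ξ => L (A h ξ)) := by
  refine ⟨fun h => L.contDiff.comp (hA.1 h), fun k => ?_⟩
  obtain ⟨C, hC⟩ := hA.2 k
  refine ⟨‖L‖ * C, fun h ξ hξ => ?_⟩
  refine (L.norm_iteratedFDeriv_comp_left (hA.1 h).contDiffAt
    (by exact_mod_cast le_top)).trans ?_
  rw [mul_assoc]
  exact mul_le_mul_of_nonneg_left (hC h ξ hξ) (norm_nonneg _)

theorem BddDerivs.fderiv {K : Set V} {A : H → V → F} (hA : BddDerivs K (fun _ => 1) A) :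
    BddDerivs K (fun _ => 1) (fun h => _root_.fderiv ℝ (A h)) := by
  refine ⟨fun h => (hA.1 h).fderiv_right (by exact_mod_cast le_top), fun k => ?_⟩
  obtain ⟨C, hC⟩ := hA.2 (k + 1)
  exact ⟨C, fun h ξ hξ => by simpa [norm_iteratedFDeriv_fderiv] using hC h ξ hξ⟩

theorem BddDerivs.sum {ι : Type*} (s : Finset ι) {K : Set V} {w : H → ℝ} {A : ι → H → V → F}
    (hA : ∀ i ∈ s, BddDerivs K w (A i)) : BddDerivs K w (fun h ξ => ∑ i ∈ s, A i h ξ) := by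
  refine ⟨fun h => ContDiff.sum fun i hi => (hA i hi).1 h, fun k => ?_⟩
  choose! C hC using fun i (hi : i ∈ s) => (hA i hi).2 k
  refine ⟨∑ i ∈ s, C i, fun h ξ hξ => ?_⟩
  rw [iteratedFDeriv_sum fun i hi => ((hA i hi).1 h).of_le (by exact_mod_cast le_top),
    Finset.sum_apply, Finset.sum_mul]
  exact (norm_sum_le _ _).trans (Finset.sum_le_sum fun i hi => hC i hi h ξ hξ)

/-- Composition with a fixed function; only derivatives of positive order of the inner family
matter. -/
theorem BddDerivs.comp_left {K : Set V} {w : H → ℝ} (hw : ∀ h, 0 ≤ w h) {A : H → V → F} {g : F → G}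
    (hg : ContDiff ℝ ∞ g) (hgb : ∀ k : ℕ, ∃ C : ℝ, ∀ y, ‖iteratedFDeriv ℝ k g y‖ ≤ C)
    (hA : ∀ h, ContDiff ℝ ∞ (A h))
    (hAb : ∀ k : ℕ, 1 ≤ k → ∃ C : ℝ, ∀ h, ∀ ξ ∈ K, ‖iteratedFDeriv ℝ k (A h) ξ‖ ≤ C * w h ^ k) :
    BddDerivs K w (fun h ξ => g (A h ξ)) := by
  refine ⟨fun h => hg.comp (hA h), fun k => ?_⟩
  choose C hC using hgb
  choose! D hD using hAb
  set C' := ∑ i ∈ Finset.range (k + 1), |C i| with hC'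
  set D' := 1 + ∑ i ∈ Finset.range (k + 1), |D i| with hD'
  have hCi : ∀ i ≤ k, C i ≤ C' := fun i hi => (le_abs_self _).trans
    (Finset.single_le_sum (f := fun i => |C i|) (fun i _ => abs_nonneg _)
      (Finset.mem_range.2 (by omega)))
  have hDi : ∀ i ≤ k, D i ≤ D' := fun i hi => by
    have : |D i| ≤ ∑ i ∈ Finset.range (k + 1), |D i| :=
      Finset.single_le_sum (f := fun i => |D i|) (fun i _ => abs_nonneg _)
        (Finset.mem_range.2 (by omega))
    linarith [le_abs_self (D i)]
  have hD1 : 1 ≤ D' := by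
    have : 0 ≤ ∑ i ∈ Finset.range (k + 1), |D i| := Finset.sum_nonneg fun i _ => abs_nonneg _
    linarith
  refine ⟨k.factorial * C' * D' ^ k, fun h ξ hξ => ?_⟩
  have := norm_iteratedFDeriv_comp_le hg (hA h) (n := k) (by exact_mod_cast le_top) ξ
    (C := C') (D := D' * w h) (fun i hi => (hC i _).trans (hCi i hi)) (fun i hi hik => by
      refine (hD i hi h ξ hξ).trans ?_
      rw [mul_pow]
      refine mul_le_mul_of_nonneg_right ((hDi i hik).trans ?_) (pow_nonneg (hw h) _)
      exact le_self_pow₀ hD1 (by omega))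
  rw [mul_pow, ← mul_assoc] at this
  exact this

/-- This is the use of the set `K`: bounds may be proved only where the factors are under control,
and become global once a cutoff confines the support. -/
theorem BddDerivs.of_tsupport {K : Set V} {w : H → ℝ} (hw : ∀ h, 0 ≤ w h) {A : H → V → F}
    (hA : BddDerivs K w A) (hs : ∀ h, tsupport (A h) ⊆ K) : BddDerivs Set.univ w A := by
  refine ⟨hA.1, fun k => ?_⟩
  obtain ⟨C, hC1, hC⟩ := hA.exists_pos hw k
  refine ⟨C, fun h ξ _ => ?_⟩
  by_cases hξ : ξ ∈ K
  · exact hC k le_rfl h ξ hξ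
  · have : iteratedFDeriv ℝ k (A h) ξ = 0 := by
      by_contra hne
      exact hξ (hs h (support_iteratedFDeriv_subset k (Function.mem_support.2 hne)))
    rw [this, norm_zero]
    exact mul_nonneg (by linarith) (pow_nonneg (hw h) _)

theorem iteratedFDeriv_cexp_I_bound (k : ℕ) :
    ∃ C : ℝ, ∀ y : ℝ, ‖iteratedFDeriv ℝ k (fun t : ℝ => Complex.exp (Complex.I * t)) y‖ ≤ C := by
  have key : ∀ k : ℕ, iteratedDeriv k (fun t : ℝ => Complex.exp (Complex.I * t)) =
      fun t : ℝ => Complex.I ^ k * Complex.exp (Complex.I * t) := by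
    intro k
    induction k with
    | zero => simp
    | succ k ih =>
      rw [iteratedDeriv_succ, ih]
      funext t
      have h1 : HasDerivAt (fun t : ℝ => Complex.exp (Complex.I * t))
          (Complex.exp (Complex.I * t) * (Complex.I * 1)) t :=
        ((Complex.ofRealCLM.hasDerivAt (x := t)).const_mul Complex.I).cexp
      rw [(h1.const_mul (Complex.I ^ k)).deriv]
      ring
  refine ⟨1, fun y => ?_⟩
  rw [norm_iteratedFDeriv_eq_norm_iteratedDeriv, key]
  simp [Complex.norm_exp]

theorem contDiff_cexp_I : ContDiff ℝ ∞ (fun t : ℝ => Complex.exp (Complex.I * t)) :=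
  (contDiff_const.mul Complex.ofRealCLM.contDiff).cexp

/-- Oscillating exponentials `e^{i λ φ}`: each derivative costs a factor `λ`. -/
theorem BddDerivs.cexp_smul {K : Set V} {w : H → ℝ} (hw : ∀ h, 1 ≤ w h) {φ : V → ℝ}
    (hφ : ContDiff ℝ ∞ φ) (hs : HasCompactSupport φ) {l : H → ℝ} (hl : ∀ h, |l h| ≤ w h) :
    BddDerivs K w (fun h ξ => Complex.exp (Complex.I * ((l h * φ ξ : ℝ) : ℂ))) := by
  refine BddDerivs.comp_left (fun h => zero_le_one.trans (hw h)) (A := fun h ξ => l h * φ ξ)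
    contDiff_cexp_I
    iteratedFDeriv_cexp_I_bound (fun h => contDiff_const.mul hφ) fun k hk => ?_
  obtain ⟨C, hC⟩ := (hs.iteratedFDeriv (𝕜 := ℝ) k).exists_bound_of_continuous
    (hφ.continuous_iteratedFDeriv (by exact_mod_cast le_top))
  refine ⟨|C|, fun h ξ _ => ?_⟩
  have : (fun ξ => l h * φ ξ) = l h • φ := by ext; simp
  rw [this, iteratedFDeriv_const_smul_apply (hφ.of_le (by exact_mod_cast le_top)).contDiffAt,
    norm_smul, mul_comm]
  refine mul_le_mul ((hC ξ).trans (le_abs_self _)) ?_ (norm_nonneg _) (abs_nonneg _)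
  exact (hl h).trans (le_self_pow₀ (hw h) (by omega))

end BddDerivs

/-! ### Removing the singularity at the origin by annular cutoffs. -/

section Cutoff

variable {E F : Type*} [NormedAddCommGroup E] [InnerProductSpace ℝ E] [FiniteDimensional ℝ E]
  [NormedAddCommGroup F] [NormedSpace ℝ F]

/-- A smooth compactly supported function equal to one on a given annulus and vanishing near the
origin. -/
theorem exists_annulus_cutoff {a b : ℝ} (ha : 0 < a) (hb : 0 < b) :
    ∃ χ : E → ℝ, ContDiff ℝ ∞ χ ∧ HasCompactSupport χ ∧
      (∀ x, a ≤ ‖x‖ → ‖x‖ ≤ b → χ x = 1) ∧ (∀ x, ‖x‖ ≤ a / 2 → χ x = 0) := by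
  let B : ContDiffBump (0 : E) := ⟨b, b + 1, hb, by linarith⟩
  let S : ContDiffBump (0 : E) := ⟨a / 2, a, by linarith, by linarith⟩
  refine ⟨fun x => B x * (1 - S x), B.contDiff.mul (contDiff_const.sub S.contDiff),
    B.hasCompactSupport.mul_right, fun x h1 h2 => ?_, fun x h => ?_⟩
  · simp only
    rw [B.one_of_mem_closedBall (by simpa [B] using h2),
      S.zero_of_le_dist (by simpa [S] using h1)]
    simp
  · simp only
    rw [S.one_of_mem_closedBall (by simpa [S] using h)]
    simp

/-- A function smooth away from the origin agrees on an annulus with a smooth compactly supported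
function. -/
theorem exists_smooth_extension {a b : ℝ} (ha : 0 < a) (hb : 0 < b) {g : E → F}
    (hg : ∀ x, x ≠ 0 → ContDiffAt ℝ ∞ g x) :
    ∃ g' : E → F, ContDiff ℝ ∞ g' ∧ HasCompactSupport g' ∧
      ∀ x, a ≤ ‖x‖ → ‖x‖ ≤ b → g' x = g x := by
  obtain ⟨χ, h1, h2, h3, h4⟩ := exists_annulus_cutoff (E := E) ha hb
  refine ⟨fun x => χ x • g x, contDiff_iff_contDiffAt.2 fun x => ?_, h2.smul_right,
    fun x hx hx' => by simp [h3 x hx hx']⟩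
  by_cases hx : x = 0
  · have : (fun x => χ x • g x) =ᶠ[nhds x] fun _ => 0 := by
      filter_upwards [Metric.ball_mem_nhds x (half_pos ha)] with y hy
      rw [h4 y (by subst hx; exact (mem_ball_zero_iff.1 hy).le), zero_smul]
    exact contDiffAt_const.congr_of_eventuallyEq this
  · exact h1.contDiffAt.smul (hg x hx)

end Cutoff

/-! ### The gradient of a power of the norm. -/

section PowerPhase

variable {E : Type*} [NormedAddCommGroup E] [InnerProductSpace ℝ E]

theorem contDiffAt_norm_rpow (s : ℝ) {x : E} (hx : x ≠ 0) :
    ContDiffAt ℝ ∞ (fun x : E => ‖x‖ ^ s) x :=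
  (contDiffAt_norm ℝ hx).rpow_const_of_ne (norm_ne_zero_iff.2 hx)

theorem fderiv_norm_rpow_apply (s : ℝ) {x : E} (hx : x ≠ 0) (v : E) :
    fderiv ℝ (fun x : E => ‖x‖ ^ s) x v = s * ‖x‖ ^ (s - 2) * inner ℝ x v := by
  have hpos : 0 < ‖x‖ := norm_pos_iff.2 hx
  have h1 : HasFDerivAt (fun x : E => ‖x‖ ^ 2) (2 • (innerSL ℝ x)) x :=
    (hasStrictFDerivAt_norm_sq x).hasFDerivAt
  have h2 := h1.rpow_const (p := s / 2) (Or.inl (by positivity))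
  have h3 : (fun x : E => ‖x‖ ^ s) = fun x : E => (‖x‖ ^ 2) ^ (s / 2) := by
    funext y
    rw [← Real.rpow_natCast, ← Real.rpow_mul (norm_nonneg _)]
    congr 1
    push_cast
    ring
  rw [h3, h2.fderiv]
  have h4 : (‖x‖ ^ 2) ^ (s / 2 - 1) = ‖x‖ ^ (s - 2) := by
    rw [← Real.rpow_natCast, ← Real.rpow_mul (norm_nonneg _)]
    congr 1
    push_cast
    ring
  simp only [h4, _root_.smul_apply, innerSL_apply_apply, smul_eq_mul, nsmul_eq_mul]
  push_cast
  ring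

/-- Mean value theorem: the derivative `p x^{p-1}` is monotone in `x`, so its size on `[a, b]` is at
least the smaller endpoint value, which is nonzero when `p ≠ 0`. -/
theorem exists_rpow_sub_lower {a b p : ℝ} (ha : 0 < a) (hb : 0 < b) (hp : p ≠ 0) :
    ∃ κ : ℝ, 0 < κ ∧ ∀ r t : ℝ, a ≤ r → r ≤ b → a ≤ t → t ≤ b →
      κ * |r - t| ≤ |r ^ p - t ^ p| := by
  set m := min (a ^ (p - 1)) (b ^ (p - 1)) with hm
  have hmpos : 0 < m := lt_min (Real.rpow_pos_of_pos ha _) (Real.rpow_pos_of_pos hb _)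
  have hle : ∀ x, a ≤ x → x ≤ b → m ≤ x ^ (p - 1) := by
    intro x h1 h2
    rcases le_total 0 (p - 1) with h | h
    · exact (min_le_left _ _).trans (Real.rpow_le_rpow ha.le h1 h)
    · exact (min_le_right _ _).trans (Real.rpow_le_rpow_of_nonpos (ha.trans_le h1) h2 h)
  have key : ∀ r t : ℝ, a ≤ r → t ≤ b → r < t → |p| * m * (t - r) ≤ |t ^ p - r ^ p| := by
    intro r t hr ht hrt
    obtain ⟨c, hc, hc'⟩ := exists_deriv_eq_slope (fun x : ℝ => x ^ p) hrt
      (fun x hx => (Real.continuousAt_rpow_const _ _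
        (Or.inl (ha.trans_le (hr.trans hx.1)).ne')).continuousWithinAt)
      (fun x hx => (Real.differentiableAt_rpow_const_of_ne _
        (ha.trans_le (hr.trans hx.1.le)).ne').differentiableWithinAt)
    rw [Real.deriv_rpow_const, eq_div_iff (sub_pos.2 hrt).ne'] at hc'
    rw [← hc', abs_mul, abs_mul, abs_of_pos (sub_pos.2 hrt)]
    have h0 : m ≤ |c ^ (p - 1)| := (hle c (hr.trans hc.1.le) (hc.2.le.trans ht)).trans (le_abs_self _)
    have := sub_pos.2 hrt
    gcongr
  refine ⟨|p| * m, mul_pos (abs_pos.2 hp) hmpos, fun r t h1 h2 h3 h4 => ?_⟩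
  rcases lt_trichotomy r t with h | h | h
  · have := key r t h1 h4 h
    rwa [abs_sub_comm r t, abs_of_pos (sub_pos.2 h), abs_sub_comm]
  · simp [h]
  · have := key t r h3 h2 h
    rwa [abs_of_pos (sub_pos.2 h)]

/-- The gradient of a power of the norm is expanding on annuli, except for the first power. -/
theorem exists_gradient_lower {a b s : ℝ} (ha : 0 < a) (hb : 0 < b) (hs : s ≠ 1) :
    ∃ κ : ℝ, 0 < κ ∧ ∀ x y : E, a ≤ ‖x‖ → ‖x‖ ≤ b → a ≤ ‖y‖ → ‖y‖ ≤ b →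
      κ * ‖x - y‖ ≤ ‖‖x‖ ^ (s - 2) • x - ‖y‖ ^ (s - 2) • y‖ := by
  obtain ⟨κ, hκ, hlow⟩ := exists_rpow_sub_lower ha hb (sub_ne_zero.2 hs)
  set m := min (a ^ (s - 2)) (b ^ (s - 2)) with hm
  have hmpos : 0 < m := lt_min (Real.rpow_pos_of_pos ha _) (Real.rpow_pos_of_pos hb _)
  have hle : ∀ x, a ≤ x → x ≤ b → m ≤ x ^ (s - 2) := by
    intro x h1 h2
    rcases le_total 0 (s - 2) with h | h
    · exact (min_le_left _ _).trans (Real.rpow_le_rpow ha.le h1 h)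
    · exact (min_le_right _ _).trans (Real.rpow_le_rpow_of_nonpos (ha.trans_le h1) h2 h)
  refine ⟨min κ m, lt_min hκ hmpos, fun x y h1 h2 h3 h4 => ?_⟩
  have hκ0 : 0 ≤ min κ m := (lt_min hκ hmpos).le
  refine abs_le_of_sq_le_sq' ?_ (norm_nonneg _) |>.2
  have hx : 0 < ‖x‖ := ha.trans_le h1
  have hy : 0 < ‖y‖ := ha.trans_le h3
  have e1 : ‖x‖ ^ (s - 1) = ‖x‖ ^ (s - 2) * ‖x‖ := by
    rw [← Real.rpow_add_one hx.ne']; congr 1; ring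
  have e2 : ‖y‖ ^ (s - 1) = ‖y‖ ^ (s - 2) * ‖y‖ := by
    rw [← Real.rpow_add_one hy.ne']; congr 1; ring
  have hl := hlow ‖x‖ ‖y‖ h1 h2 h3 h4
  rw [e1, e2] at hl
  have hX := hle _ h1 h2
  have hY := hle _ h3 h4
  set X := ‖x‖ ^ (s - 2)
  set Y := ‖y‖ ^ (s - 2)
  have hin : inner ℝ x y ≤ ‖x‖ * ‖y‖ := real_inner_le_norm x y
  rw [mul_pow, norm_sub_sq_real, norm_sub_sq_real, norm_smul, norm_smul, inner_smul_left,
    inner_smul_right]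
  simp only [Real.norm_eq_abs, conj_trivial]
  rw [abs_of_pos (hmpos.trans_le hX), abs_of_pos (hmpos.trans_le hY)]
  have hl2 : κ ^ 2 * (‖x‖ - ‖y‖) ^ 2 ≤ (X * ‖x‖ - Y * ‖y‖) ^ 2 := by
    have := pow_le_pow_left₀ (by positivity) hl 2
    rwa [mul_pow, sq_abs, sq_abs] at this
  have hXY : m ^ 2 ≤ X * Y := by nlinarith
  have hk2 : min κ m ^ 2 ≤ κ ^ 2 := pow_le_pow_left₀ hκ0 (min_le_left _ _) 2
  have hm2 : min κ m ^ 2 ≤ X * Y := (pow_le_pow_left₀ hκ0 (min_le_right _ _) 2).trans hXY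
  -- Radial and angular parts separate: `|x-y|² = (|x|-|y|)² + 2(|x||y| - x·y)` and `|Xx-Yy|² =
  -- (X|x|-Y|y|)² + 2XY(|x||y| - x·y)`. The radial part uses `s - 1 ≠ 0`, the angular part only `XY
  -- ≥ m²`.
  nlinarith [mul_le_mul_of_nonneg_right hk2 (sq_nonneg (‖x‖ - ‖y‖)),
    mul_le_mul_of_nonneg_right hm2 (sub_nonneg.2 hin)]

theorem hasCompactSupport_of_tsupport_subset_ball [FiniteDimensional ℝ E] {F : Type*} [Zero F]
    {M : ℝ} {g : E → F}
    (hs : tsupport g ⊆ Metric.closedBall 0 M) : HasCompactSupport g :=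
  (isCompact_closedBall (0 : E) M).of_isClosed_subset (isClosed_tsupport g) hs

end PowerPhase

/-! ### Nonstationary phase by repeated integration by parts. -/

section NonStationary

variable {H E : Type*} [NormedAddCommGroup E] [InnerProductSpace ℝ E] [FiniteDimensional ℝ E]
  [MeasurableSpace E] [BorelSpace E]

theorem norm_integral_le_of_tsupport_subset_ball (M : ℝ) {C : ℝ} {g : E → ℂ}
    (hg : ∀ x, ‖g x‖ ≤ C) (hs : tsupport g ⊆ Metric.closedBall 0 M) :
    ‖∫ x, g x‖ ≤ C * (volume (Metric.closedBall (0 : E) M)).toReal := by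
  rw [← setIntegral_eq_integral_of_forall_compl_eq_zero (s := Metric.closedBall (0 : E) M)]
  · exact norm_setIntegral_le_of_norm_le_const
      (isCompact_closedBall _ _).measure_lt_top fun x _ => hg x
  · intro x hx
    exact image_eq_zero_of_notMem_tsupport fun h => hx (hs h)

/-- The principle of nonstationary phase for families of phases and amplitudes. -/
theorem nonstationary_phase {Ψ : H → E → ℝ} {w : H → E → E} {r : H → ℝ} {K : H → Set E} {κ M : ℝ}
    (hr : ∀ h, 0 < r h) (hκ : 0 < κ) (hΨ : ∀ h, ContDiff ℝ ∞ (Ψ h))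
    (hd : ∀ h ξ v, fderiv ℝ (Ψ h) ξ v = r h * inner ℝ (w h ξ) v)
    (hw : BddDerivs Set.univ (fun _ => 1) w) (hlow : ∀ h, ∀ ξ ∈ K h, κ ≤ ‖w h ξ‖)
    (hK : ∀ h, K h ⊆ Metric.closedBall 0 M) (N : ℕ) :
    ∀ A : H → E → ℂ, BddDerivs Set.univ (fun _ => 1) A → (∀ h, tsupport (A h) ⊆ K h) →
      ∃ C : ℝ, ∀ h, ‖∫ ξ, Complex.exp (Complex.I * (Ψ h ξ : ℝ)) * A h ξ‖ ≤ C * (r h)⁻¹ ^ N := by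
  have hexp : ∀ h ξ, ‖Complex.exp (Complex.I * (Ψ h ξ : ℝ))‖ = 1 := fun h ξ => by
    rw [mul_comm, Complex.norm_exp_ofReal_mul_I]
  have hexpd : ∀ h, ContDiff ℝ ∞ (fun ξ => Complex.exp (Complex.I * (Ψ h ξ : ℝ))) := fun h =>
    contDiff_cexp_I.comp (hΨ h)
  obtain ⟨W, hW1, hW⟩ := hw.exists_bound
  -- The field `u = w/|w|²` satisfies `⟨w, u⟩ = 1`. Replacing `x ↦ x/|x|²` by a compactly supported
  -- function that agrees with it for `κ ≤ |x| ≤ W` makes all derivatives of `u` bounded uniformly,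
  -- without changing `u` on the support of the amplitude.
  obtain ⟨ρ, hρ1, hρ2, hρ3⟩ := exists_smooth_extension (E := E) (F := E) (a := κ) (b := W) hκ
    (by linarith) (g := fun x => (‖x‖ ^ 2)⁻¹ • x) (fun x hx =>
      (((contDiff_norm_sq ℝ).contDiffAt).inv (by simpa using hx)).smul contDiffAt_id)
  have hu : BddDerivs Set.univ (fun _ => 1) (fun h ξ => ρ (w h ξ)) :=
    BddDerivs.comp_left (fun _ => zero_le_one) hρ1 (fun k => by
      obtain ⟨C, hC⟩ := (BddDerivs.of_hasCompactSupport (H := Unit) (K := Set.univ)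
        (w := fun _ => 1) (fun _ => le_rfl) hρ1 hρ2).2 k
      exact ⟨C, fun y => by simpa using hC () y trivial⟩) hw.1 (fun k _ => hw.2 k)
  let b := stdOrthonormalBasis ℝ E
  induction N with
  | zero =>
    intro A hA hs
    obtain ⟨C, hC1, hC⟩ := hA.exists_bound
    refine ⟨C * (volume (Metric.closedBall (0 : E) M)).toReal, fun h => ?_⟩
    rw [pow_zero, mul_one]
    refine norm_integral_le_of_tsupport_subset_ball M (fun ξ => ?_) ?_
    · rw [norm_mul, hexp, one_mul]; exact hC h ξ trivial
    · exact (tsupport_mul_subset_right.trans (hs h)).trans (hK h)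
  | succ N ih =>
    intro A hA hs
    have hui : ∀ i, BddDerivs Set.univ (fun _ => 1)
        (fun h ξ => inner ℝ (b i) (ρ (w h ξ)) • A h ξ) := fun i =>
      (hu.clm_comp (innerSL ℝ (b i))).smul (fun _ => zero_le_one) hA
    -- The divergence of `u A`. One integration by parts gives `∫ e^{iΨ} div(uA) = -i r ∫ e^{iΨ} A`,
    -- so each round gains a factor `r⁻¹` and stays in the same class of amplitudes.
    set A' : H → E → ℂ := fun h ξ => ∑ i,
      fderiv ℝ (fun ξ => inner ℝ (b i) (ρ (w h ξ)) • A h ξ) ξ (b i) with hA'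
    have hBA' : BddDerivs Set.univ (fun _ => 1) A' :=
      BddDerivs.sum _ fun i _ => (hui i).fderiv.clm_comp (ContinuousLinearMap.apply ℝ ℂ (b i))
    have hsi : ∀ i h, tsupport (fun ξ => inner ℝ (b i) (ρ (w h ξ)) • A h ξ) ⊆ tsupport (A h) :=
      fun i h => tsupport_smul_subset_right _ _
    have hsA' : ∀ h, tsupport (A' h) ⊆ tsupport (A h) := fun h => by
      refine closure_minimal (fun ξ hξ => ?_) (isClosed_tsupport _)
      obtain ⟨i, _, hi⟩ := Finset.exists_ne_zero_of_sum_ne_zero hξ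
      refine hsi i h (support_fderiv_subset ℝ (Function.mem_support.2 fun h0 => hi ?_))
      rw [h0]; rfl
    obtain ⟨C, hC⟩ := ih A' hBA' fun h => (hsA' h).trans (hs h)
    refine ⟨C, fun h => ?_⟩
    have hcs : ∀ i, HasCompactSupport (fun ξ => inner ℝ (b i) (ρ (w h ξ)) • A h ξ) := fun i =>
      hasCompactSupport_of_tsupport_subset_ball (((hsi i h).trans (hs h)).trans (hK h))
    have hcd : ∀ i, ContDiff ℝ ∞ (fun ξ => inner ℝ (b i) (ρ (w h ξ)) • A h ξ) := fun i =>
      (hui i).1 h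
    have hcf : ∀ i, Continuous fun ξ =>
        fderiv ℝ (fun ξ => inner ℝ (b i) (ρ (w h ξ)) • A h ξ) ξ (b i) := fun i =>
      ((hcd i).continuous_fderiv (by simp)).clm_apply continuous_const
    have hcsf : ∀ i, HasCompactSupport fun ξ =>
        fderiv ℝ (fun ξ => inner ℝ (b i) (ρ (w h ξ)) • A h ξ) ξ (b i) := fun i =>
      (hcs i).fderiv_apply ℝ (b i)
    have hce := (hexpd h).continuous
    have hcfe : ∀ i, Continuous fun ξ =>
        fderiv ℝ (fun ξ => Complex.exp (Complex.I * (Ψ h ξ : ℝ))) ξ (b i) := fun i =>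
      ((hexpd h).continuous_fderiv (by simp)).clm_apply continuous_const
    have hfe : ∀ ξ v, fderiv ℝ (fun ξ => Complex.exp (Complex.I * (Ψ h ξ : ℝ))) ξ v =
        Complex.I * r h * (inner ℝ (w h ξ) v : ℝ) * Complex.exp (Complex.I * (Ψ h ξ : ℝ)) := by
      intro ξ v
      have h1 : HasFDerivAt (fun ξ => ((Ψ h ξ : ℝ) : ℂ))
          (Complex.ofRealCLM.comp (fderiv ℝ (Ψ h) ξ)) ξ :=
        Complex.ofRealCLM.hasFDerivAt.comp ξ (((hΨ h).differentiable (by simp)) ξ).hasFDerivAt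
      rw [((h1.const_mul Complex.I).cexp).fderiv]
      simp only [_root_.smul_apply, ContinuousLinearMap.comp_apply, hd,
        Complex.ofRealCLM_apply, smul_eq_mul]
      push_cast
      ring
    have hparts : ∀ i, ∫ ξ, Complex.exp (Complex.I * (Ψ h ξ : ℝ)) *
          fderiv ℝ (fun ξ => inner ℝ (b i) (ρ (w h ξ)) • A h ξ) ξ (b i) =
        -∫ ξ, fderiv ℝ (fun ξ => Complex.exp (Complex.I * (Ψ h ξ : ℝ))) ξ (b i) *
          (inner ℝ (b i) (ρ (w h ξ)) • A h ξ) := fun i =>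
      integral_mul_fderiv_eq_neg_fderiv_mul_of_integrable
        (((hcfe i).mul (hcd i).continuous).integrable_of_hasCompactSupport (hcs i).mul_left)
        ((hce.mul (hcf i)).integrable_of_hasCompactSupport (hcsf i).mul_left)
        ((hce.mul (hcd i).continuous).integrable_of_hasCompactSupport (hcs i).mul_left)
        (fun x _ => (hexpd h).differentiable (by simp) x)
        (fun x _ => (hcd i).differentiable (by simp) x)
    have hmain : ∫ ξ, Complex.exp (Complex.I * (Ψ h ξ : ℝ)) * A' h ξ =
        -(Complex.I * r h * ∫ ξ, Complex.exp (Complex.I * (Ψ h ξ : ℝ)) * A h ξ) := by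
      have e1 : ∀ ξ, Complex.exp (Complex.I * (Ψ h ξ : ℝ)) * A' h ξ = ∑ i,
          Complex.exp (Complex.I * (Ψ h ξ : ℝ)) *
          fderiv ℝ (fun ξ => inner ℝ (b i) (ρ (w h ξ)) • A h ξ) ξ (b i) := fun ξ => by
        rw [hA', Finset.mul_sum]
      simp_rw [e1]
      have hi1 : ∀ i, Integrable fun ξ => Complex.exp (Complex.I * (Ψ h ξ : ℝ)) *
          fderiv ℝ (fun ξ => inner ℝ (b i) (ρ (w h ξ)) • A h ξ) ξ (b i) := fun i =>
        (hce.mul (hcf i)).integrable_of_hasCompactSupport (hcsf i).mul_left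
      have hi2 : ∀ i, Integrable fun ξ =>
          fderiv ℝ (fun ξ => Complex.exp (Complex.I * (Ψ h ξ : ℝ))) ξ (b i) *
          (inner ℝ (b i) (ρ (w h ξ)) • A h ξ) := fun i =>
        ((hcfe i).mul (hcd i).continuous).integrable_of_hasCompactSupport (hcs i).mul_left
      rw [integral_finsetSum _ fun i _ => hi1 i]
      simp_rw [hparts]
      rw [Finset.sum_neg_distrib, ← integral_finsetSum _ fun i _ => hi2 i,
        ← integral_const_mul]
      congr 1
      refine integral_congr_ae (Filter.Eventually.of_forall fun ξ => ?_)
      simp only [hfe]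
      by_cases hξ : ξ ∈ tsupport (A h)
      · have hk := hlow h ξ (hs h hξ)
        have h2 := hρ3 (w h ξ) hk (hW h ξ trivial)
        have hne : ‖w h ξ‖ ^ 2 ≠ 0 := by
          have : 0 < ‖w h ξ‖ := hκ.trans_le hk
          positivity
        have h3 : ∑ i, inner ℝ (w h ξ) (b i) * inner ℝ (b i) (ρ (w h ξ)) = 1 := by
          rw [b.sum_inner_mul_inner, h2, inner_smul_right, real_inner_self_eq_norm_sq,
            inv_mul_cancel₀ hne]
        have h3' : ∑ i, ((inner ℝ (w h ξ) (b i) : ℝ) : ℂ) * ((inner ℝ (b i) (ρ (w h ξ)) : ℝ) : ℂ)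
            = 1 := by exact_mod_cast congrArg (fun t : ℝ => (t : ℂ)) h3
        calc _ = (∑ i, ((inner ℝ (w h ξ) (b i) : ℝ) : ℂ) * ((inner ℝ (b i) (ρ (w h ξ)) : ℝ) : ℂ))
              * (Complex.I * r h * (Complex.exp (Complex.I * (Ψ h ξ : ℝ)) * A h ξ)) := by
                rw [Finset.sum_mul]
                refine Finset.sum_congr rfl fun i _ => ?_
                rw [Complex.real_smul]
                ring
          _ = _ := by rw [h3', one_mul]
      · simp [image_eq_zero_of_notMem_tsupport hξ]
    have h5 := hC h
    rw [hmain, norm_neg, norm_mul, norm_mul, Complex.norm_I, one_mul, Complex.norm_real,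
      Real.norm_of_nonneg (hr h).le] at h5
    rw [pow_succ, ← mul_assoc, ← div_eq_mul_inv, le_div_iff₀ (hr h), mul_comm]
    exact h5

end NonStationary

/-! ### Decay of oscillatory integrals by autocorrelation. -/

section Dispersive

variable {E : Type*} [NormedAddCommGroup E] [InnerProductSpace ℝ E] [FiniteDimensional ℝ E]
  [MeasurableSpace E] [BorelSpace E]

theorem norm_iteratedFDeriv_sub_le {E : Type*} [NormedAddCommGroup E] [NormedSpace ℝ E]
    {F : Type*} [NormedAddCommGroup F] [NormedSpace ℝ F] {G : E → F}
    (hG : ContDiff ℝ ∞ G) (hs : HasCompactSupport G) (k : ℕ) :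
    ∃ C : ℝ, ∀ x y, ‖iteratedFDeriv ℝ k G x - iteratedFDeriv ℝ k G y‖ ≤ C * ‖x - y‖ := by
  obtain ⟨C, hC⟩ := (hs.iteratedFDeriv (𝕜 := ℝ) (k + 1)).exists_bound_of_continuous
    (hG.continuous_iteratedFDeriv (by exact_mod_cast le_top))
  refine ⟨C, fun x y => ?_⟩
  refine Convex.norm_image_sub_le_of_norm_fderiv_le (𝕜 := ℝ) (s := Set.univ)
    (fun z _ => (hG.differentiable_iteratedFDeriv (m := k) (by exact_mod_cast WithTop.coe_lt_top _)) z)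
    (fun z _ => ?_) convex_univ trivial trivial
  rw [norm_fderiv_iteratedFDeriv]
  exact hC z

/-- Uniformity down to `v → 0` is the point: after division by `‖v‖` these are the gradients of the
differences `φ(ξ+v) - φ(ξ)`. By the mean value inequality each derivative costs one more derivative
of `G`. -/
theorem BddDerivs.difference_quotient {E H F : Type*} [NormedAddCommGroup E] [NormedSpace ℝ E]
    [NormedAddCommGroup F] [NormedSpace ℝ F]
    {G : E → F} (hG : ContDiff ℝ ∞ G) (hs : HasCompactSupport G) (v : H → E) :
    BddDerivs Set.univ (fun _ : H => 1) (fun h ξ => ‖v h‖⁻¹ • (G (ξ + v h) - G ξ)) := by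
  have hc : ∀ h, ContDiff ℝ ∞ fun ξ => G (ξ + v h) := fun h =>
    hG.comp (contDiff_id.add contDiff_const)
  refine ⟨fun h => contDiff_const.smul ((hc h).sub hG), fun k => ?_⟩
  obtain ⟨C, hC⟩ := norm_iteratedFDeriv_sub_le hG hs k
  refine ⟨|C|, fun h ξ _ => ?_⟩
  have e : (fun ξ => ‖v h‖⁻¹ • (G (ξ + v h) - G ξ)) = ‖v h‖⁻¹ • ((fun ξ => G (ξ + v h)) - G) := rfl
  have hk : (k : WithTop ℕ∞) ≤ (∞ : WithTop ℕ∞) := by exact_mod_cast le_top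
  have hsub : ContDiff ℝ k ((fun ξ => G (ξ + v h)) - G) := ((hc h).sub hG).of_le hk
  rw [show (fun h ξ => ‖v h‖⁻¹ • (G (ξ + v h) - G ξ)) h = _ from e,
    iteratedFDeriv_const_smul_apply hsub.contDiffAt,
    iteratedFDeriv_sub_apply ((hc h).of_le hk).contDiffAt (hG.of_le hk).contDiffAt,
    iteratedFDeriv_comp_add_right, norm_smul, norm_inv, norm_norm, one_pow, mul_one]
  have h1 := hC (ξ + v h) ξ
  rw [add_sub_cancel_left] at h1
  by_cases h0 : ‖v h‖ = 0
  · simp [h0]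
  · rw [inv_mul_le_iff₀ (lt_of_le_of_ne (norm_nonneg _) (Ne.symm h0)), mul_comm]
    exact h1.trans (mul_le_mul_of_nonneg_right (le_abs_self _) (norm_nonneg _))

/-- Expand the square as a double integral and take the difference of the two variables as a new
variable. This needs no Hessian and makes linear terms of a phase disappear in absolute value. -/
theorem norm_integral_sq_le_autocorrelation {F : E → ℂ} (hF : Continuous F)
    (hs : HasCompactSupport F) :
    ‖∫ ξ, F ξ‖ ^ 2 ≤ ∫ h, ‖∫ ξ, F (ξ + h) * (starRingEnd ℂ) (F ξ)‖ := by
  have hint : Integrable (fun p : E × E => F (p.1 + p.2) * (starRingEnd ℂ) (F p.1)) := by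
    refine Continuous.integrable_of_hasCompactSupport (by fun_prop) ?_
    have hK := hs.isCompact
    refine HasCompactSupport.intro (hK.prod (hK.add (hK.neg))) fun p hp => ?_
    by_contra hne
    obtain ⟨h1, h2⟩ := mul_ne_zero_iff.1 hne
    have h2' : F p.1 ≠ 0 := fun h0 => h2 (by rw [h0, map_zero])
    have m1 := subset_tsupport _ (Function.mem_support.2 h1)
    have m2 := subset_tsupport _ (Function.mem_support.2 h2')
    refine hp ⟨m2, Set.mem_add.2 ⟨p.1 + p.2, m1, -p.1, Set.neg_mem_neg.2 m2, by abel⟩⟩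
  have e : ((‖∫ ξ, F ξ‖ ^ 2 : ℝ) : ℂ) = ∫ h, ∫ ξ, F (ξ + h) * (starRingEnd ℂ) (F ξ) := by
    rw [← integral_integral_swap hint]
    simp_rw [integral_mul_const]
    have : ∀ ξ, ∫ h, F (ξ + h) = ∫ h, F h := fun ξ => integral_add_left_eq_self F ξ
    simp_rw [this]
    rw [integral_const_mul, integral_conj, Complex.mul_conj, Complex.normSq_eq_norm_sq]
  calc ‖∫ ξ, F ξ‖ ^ 2 = ‖((‖∫ ξ, F ξ‖ ^ 2 : ℝ) : ℂ)‖ := by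
        rw [Complex.norm_real, Real.norm_of_nonneg (by positivity)]
    _ ≤ _ := by rw [e]; exact norm_integral_le_integral_norm _

/-- Merges a trivial bound for `t ≤ 1` with decay for `t ≥ 1`, using `1 + t ≤ 2 max(1, t)`. Decay is
assumed only for `t ≠ 0`, since nonstationary phase says nothing at zero shift. -/
theorem inv_pow_le_one_add_rpow {t C D J : ℝ} (N : ℕ) (ht : 0 ≤ t) (hC : 0 ≤ C) (hD : 0 ≤ D)
    (h1 : J ≤ C) (h2 : t ≠ 0 → J ≤ D * t⁻¹ ^ N) :
    J ≤ (C + D) * 2 ^ N * (1 + t) ^ (-(N : ℝ)) := by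
  rw [Real.rpow_neg (by positivity), Real.rpow_natCast, ← div_eq_mul_inv,
    le_div_iff₀ (by positivity)]
  rcases le_total t 1 with h | h
  · calc J * (1 + t) ^ N ≤ C * 2 ^ N := by
          refine mul_le_mul h1 ?_ (by positivity) hC
          exact pow_le_pow_left₀ (by positivity) (by linarith) N
      _ ≤ _ := by gcongr; linarith
  · have ht0 : 0 < t := by linarith
    calc J * (1 + t) ^ N ≤ (D * t⁻¹ ^ N) * (2 * t) ^ N := by
          refine mul_le_mul (h2 ht0.ne') ?_ (by positivity) (by positivity)
          exact pow_le_pow_left₀ (by positivity) (by linarith) N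
      _ = D * 2 ^ N := by
          rw [mul_pow, inv_pow]; field_simp
      _ ≤ _ := by gcongr; linarith

/-- Decay of oscillatory integrals whose phase has an expanding gradient on the support of the
amplitude. The bound does not depend on the linear term of the phase. -/
theorem dispersive_bound {φ : E → ℝ} {G : E → E} {K : Set E} {κ M : ℝ} (hφ : ContDiff ℝ ∞ φ)
    (hG : ContDiff ℝ ∞ G) (hGs : HasCompactSupport G)
    (hφG : ∀ ξ v, fderiv ℝ φ ξ v = inner ℝ (G ξ) v) (hκ : 0 < κ)
    (hlow : ∀ x ∈ K, ∀ y ∈ K, κ * ‖x - y‖ ≤ ‖G x - G y‖) (hKc : IsClosed K)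
    (hK : K ⊆ Metric.closedBall 0 M)
    {a : E → ℂ} (ha : ContDiff ℝ ∞ a) (has : tsupport a ⊆ K) :
    ∃ C : ℝ, ∀ l : ℝ, 0 < l → ∀ y : E,
      ‖∫ ξ, Complex.exp (Complex.I * ((l * φ ξ + inner ℝ y ξ : ℝ) : ℂ)) * a ξ‖ ≤
        C * l ^ (-((Module.finrank ℝ E : ℝ) / 2)) := by
  set d := Module.finrank ℝ E with hd
  have hacs : HasCompactSupport a := hasCompactSupport_of_tsupport_subset_ball (has.trans hK)
  let H := {p : ℝ × E // 0 < p.1 ∧ p.2 ≠ 0}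
  -- The phase of the autocorrelation. The linear term `⟨y, ξ⟩` is absent because it contributes
  -- only the unimodular constant `e^{i⟨y,h⟩}`; hence the uniformity in `y`.
  let Ψ : ℝ × E → E → ℝ := fun p ξ => p.1 * (φ (ξ + p.2) - φ ξ)
  let A : E → E → ℂ := fun h ξ => a (ξ + h) * (starRingEnd ℂ) (a ξ)
  have hshift : ∀ h : E, ContDiff ℝ ∞ fun ξ : E => ξ + h := fun h => contDiff_id.add contDiff_const
  have hconj : ContDiff ℝ ∞ fun ξ => (starRingEnd ℂ) (a ξ) := Complex.conjCLE.contDiff.comp ha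
  have hsA : ∀ h, tsupport (A h) ⊆ {ξ | ξ ∈ K ∧ ξ + h ∈ K} := by
    intro h
    refine closure_minimal (fun ξ hξ => ?_)
      (hKc.inter (hKc.preimage (continuous_id.add continuous_const)))
    obtain ⟨h1, h2⟩ := mul_ne_zero_iff.1 hξ
    have h2' : a ξ ≠ 0 := fun h0 => h2 (by rw [h0, map_zero])
    exact ⟨has (subset_tsupport _ h2'), has (subset_tsupport _ h1)⟩
  have hBA : BddDerivs Set.univ (fun _ : E => 1) A := by
    have b1 : BddDerivs Set.univ (fun _ : E => 1) (fun h ξ => a (ξ + h)) := by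
      refine ⟨fun h => ha.comp (hshift h), fun k => ?_⟩
      obtain ⟨C, hC⟩ := (BddDerivs.of_hasCompactSupport (H := Unit) (K := Set.univ)
        (w := fun _ => 1) (fun _ => le_rfl) ha hacs).2 k
      exact ⟨C, fun h ξ _ => by rw [iteratedFDeriv_comp_add_right]; exact hC () _ trivial⟩
    have b2 : BddDerivs Set.univ (fun _ : E => 1) (fun _ ξ => (starRingEnd ℂ) (a ξ)) :=
      (BddDerivs.of_hasCompactSupport (fun _ => le_rfl) ha hacs).clm_comp
        (Complex.conjCLE : ℂ →L[ℝ] ℂ)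
    exact b1.mul (fun _ => zero_le_one) b2
  obtain ⟨C₀, hC₀1, hC₀⟩ := hBA.exists_bound
  obtain ⟨D, hD⟩ := nonstationary_phase (H := H) (Ψ := fun p => Ψ p.1)
    (w := fun p ξ => ‖p.1.2‖⁻¹ • (G (ξ + p.1.2) - G ξ)) (r := fun p => p.1.1 * ‖p.1.2‖)
    (K := fun p => {ξ | ξ ∈ K ∧ ξ + p.1.2 ∈ K}) (κ := κ) (M := M)
    (fun p => mul_pos p.2.1 (norm_pos_iff.2 p.2.2)) hκ
    (fun p => contDiff_const.mul ((hφ.comp (hshift _)).sub hφ))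
    (fun p ξ v => by
      have h1 : HasFDerivAt (fun ξ => φ (ξ + p.1.2)) (fderiv ℝ φ (ξ + p.1.2)) ξ := by
        have := (hφ.differentiable (by simp) (ξ + p.1.2)).hasFDerivAt.comp ξ
          ((hasFDerivAt_id ξ).add_const p.1.2)
        rw [ContinuousLinearMap.comp_id] at this
        exact this
      have h2 : HasFDerivAt (Ψ p.1) (p.1.1 • (fderiv ℝ φ (ξ + p.1.2) - fderiv ℝ φ ξ)) ξ :=
        (h1.sub (hφ.differentiable (by simp) ξ).hasFDerivAt).const_mul _
      have h3 : ‖p.1.2‖ ≠ 0 := norm_ne_zero_iff.2 p.2.2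
      rw [h2.fderiv, inner_smul_left, inner_sub_left, ← hφG, ← hφG]
      simp only [_root_.smul_apply, _root_.sub_apply, smul_eq_mul, conj_trivial]
      field_simp)
    (BddDerivs.difference_quotient hG hGs fun p : H => p.1.2)
    (fun p ξ hξ => by
      have h1 := hlow _ hξ.2 _ hξ.1
      rw [add_sub_cancel_left] at h1
      rw [norm_smul, norm_inv, norm_norm, ← div_eq_inv_mul,
        le_div_iff₀ (norm_pos_iff.2 p.2.2)]
      exact h1)
    (fun p ξ hξ => hK hξ.1) (d + 1) (fun p => A p.1.2) (hBA.reindex fun p : H => p.1.2)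
    (fun p => hsA _)
  set V := (volume (Metric.closedBall (0 : E) M)).toReal with hV
  have hV0 : 0 ≤ V := ENNReal.toReal_nonneg
  set B := (C₀ * V + |D|) * 2 ^ (d + 1) with hB
  have hJ : ∀ l : ℝ, 0 < l → ∀ h : E,
      ‖∫ ξ, Complex.exp (Complex.I * (Ψ (l, h) ξ : ℝ)) * A h ξ‖ ≤
        B * (1 + ‖l • h‖) ^ (-((d + 1 : ℕ) : ℝ)) := by
    intro l hl h
    refine inv_pow_le_one_add_rpow (d + 1) (norm_nonneg _) (by positivity) (abs_nonneg _) ?_ ?_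
    · refine norm_integral_le_of_tsupport_subset_ball M (fun ξ => ?_) ?_
      · rw [norm_mul, mul_comm Complex.I, Complex.norm_exp_ofReal_mul_I, one_mul]
        exact hC₀ h ξ trivial
      · exact (tsupport_mul_subset_right.trans (hsA h)).trans fun ξ hξ => hK hξ.1
    · intro hne
      have h0 : h ≠ 0 := fun h0 => hne (by simp [h0])
      have := hD ⟨(l, h), hl, h0⟩
      rw [norm_smul, Real.norm_of_nonneg hl.le]
      exact this.trans (mul_le_mul_of_nonneg_right (le_abs_self _) (by positivity))
  -- The order `d + 1` of the decay makes this integral finite. Rescaling `h` by `l` produces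
  -- `l^{-d}`, the square of the claimed rate.
  set I₀ := ∫ h : E, (1 + ‖h‖) ^ (-((d + 1 : ℕ) : ℝ)) with hI₀
  have hint0 : Integrable fun h : E => (1 + ‖h‖) ^ (-((d + 1 : ℕ) : ℝ)) :=
    integrable_one_add_norm (by push_cast; linarith)
  refine ⟨Real.sqrt (B * I₀), fun l hl y => ?_⟩
  set F : E → ℂ := fun ξ => Complex.exp (Complex.I * ((l * φ ξ + inner ℝ y ξ : ℝ) : ℂ)) * a ξ
    with hF
  have hFc : Continuous F := by
    have := hφ.continuous
    have := ha.continuous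
    fun_prop
  have hFs : HasCompactSupport F := hacs.mul_left
  have h1 := norm_integral_sq_le_autocorrelation hFc hFs
  have h2 : ∀ h, ‖∫ ξ, F (ξ + h) * (starRingEnd ℂ) (F ξ)‖ ≤
      B * (1 + ‖l • h‖) ^ (-((d + 1 : ℕ) : ℝ)) := by
    intro h
    refine le_trans (le_of_eq ?_) (hJ l hl h)
    have e : ∀ ξ, F (ξ + h) * (starRingEnd ℂ) (F ξ) =
        Complex.exp ((inner ℝ y h : ℝ) * Complex.I) *
          (Complex.exp (Complex.I * (Ψ (l, h) ξ : ℝ)) * A h ξ) := by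
      intro ξ
      simp only [hF, map_mul, ← Complex.exp_conj, Complex.conj_I, Complex.conj_ofReal, Ψ, A]
      rw [inner_add_right]
      have : Complex.exp (Complex.I * ((l * φ (ξ + h) + (inner ℝ y ξ + inner ℝ y h) : ℝ) : ℂ)) *
          Complex.exp (-Complex.I * ((l * φ ξ + inner ℝ y ξ : ℝ) : ℂ)) =
          Complex.exp ((inner ℝ y h : ℝ) * Complex.I) *
          Complex.exp (Complex.I * ((l * (φ (ξ + h) - φ ξ) : ℝ) : ℂ)) := by
        rw [← Complex.exp_add, ← Complex.exp_add]
        congr 1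
        push_cast
        ring
      linear_combination (a (ξ + h) * (starRingEnd ℂ) (a ξ)) * this
    simp_rw [e]
    rw [integral_const_mul, norm_mul, Complex.norm_exp_ofReal_mul_I, one_mul]
  have h3 : ‖∫ ξ, F ξ‖ ^ 2 ≤ B * I₀ * (l ^ d)⁻¹ := by
    refine h1.trans ?_
    refine (integral_mono_of_nonneg (Filter.Eventually.of_forall fun _ => norm_nonneg _)
      ((hint0.comp_smul hl.ne').const_mul B) (Filter.Eventually.of_forall h2)).trans ?_
    rw [integral_const_mul, Measure.integral_comp_smul volume
      (fun h : E => (1 + ‖h‖) ^ (-((d + 1 : ℕ) : ℝ))) l, abs_of_pos (by positivity), smul_eq_mul]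
    refine le_of_eq ?_
    rw [← hI₀, ← hd]
    ring
  have hBI : 0 ≤ B * I₀ :=
    mul_nonneg (by positivity) (integral_nonneg fun h => by positivity)
  have h4 : (l ^ (-((d : ℝ) / 2))) ^ 2 = (l ^ d)⁻¹ := by
    rw [← Real.rpow_natCast, ← Real.rpow_mul hl.le, ← Real.rpow_natCast, ← Real.rpow_neg hl.le]
    congr 1
    push_cast
    ring
  refine abs_le_of_sq_le_sq' ?_ (by positivity) |>.2
  rw [mul_pow, Real.sq_sqrt hBI, h4]
  exact h3

end Dispersive

/-! ### Dyadic bumps, smooth model phases and spatial decay. -/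

section PhasePieces

variable {E : Type*} [NormedAddCommGroup E] [InnerProductSpace ℝ E]

theorem BddDerivs.comp_smul {H F : Type*} [NormedAddCommGroup F] [NormedSpace ℝ F] {w : H → ℝ}
    {A : H → E → F} (hA : BddDerivs Set.univ w A) {t : H → ℝ} (ht : ∀ h, 0 ≤ t h) :
    BddDerivs Set.univ (fun h => t h * w h) (fun h ξ => A h (t h • ξ)) := by
  refine ⟨fun h => (hA.1 h).comp (contDiff_const_smul _), fun k => ?_⟩
  obtain ⟨C, hC⟩ := hA.2 k
  refine ⟨C, fun h ξ _ => ?_⟩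
  rw [iteratedFDeriv_comp_const_smul (t h) ((hA.1 h).of_le (by exact_mod_cast le_top))]
  rw [norm_smul, norm_pow, Real.norm_of_nonneg (ht h), mul_pow, mul_left_comm]
  exact mul_le_mul_of_nonneg_left (hC h _ trivial) (pow_nonneg (ht h) k)

/-- The closed annulus carrying the dyadic bump. -/
def unitAnnulus (E : Type*) [NormedAddCommGroup E] : Set E := {ξ | 1 / 2 ≤ ‖ξ‖ ∧ ‖ξ‖ ≤ 2}

theorem isClosed_unitAnnulus {E : Type*} [NormedAddCommGroup E] : IsClosed (unitAnnulus E) :=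
  (isClosed_le continuous_const continuous_norm).inter (isClosed_le continuous_norm continuous_const)

theorem unitAnnulus_subset {E : Type*} [NormedAddCommGroup E] :
    unitAnnulus E ⊆ Metric.closedBall 0 2 := fun ξ hξ => by
  simpa using hξ.2

variable [FiniteDimensional ℝ E]

/-- A smooth cutoff equal to one on the unit ball and supported in the ball of radius two. -/
def lowBump (ξ : E) : ℝ := (⟨1, 2, one_pos, one_lt_two⟩ : ContDiffBump (0 : E)) ξ

/-- The dyadic bump `lowBump ξ - lowBump (2 ξ)`. -/
def annBump (ξ : E) : ℝ := lowBump ξ - lowBump ((2 : ℝ) • ξ)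

theorem contDiff_lowBump : ContDiff ℝ ∞ (lowBump : E → ℝ) := ContDiffBump.contDiff _

theorem lowBump_of_le {ξ : E} (h : ‖ξ‖ ≤ 1) : lowBump ξ = 1 :=
  ContDiffBump.one_of_mem_closedBall _ (by simpa using h)

theorem lowBump_of_ge {ξ : E} (h : 2 ≤ ‖ξ‖) : lowBump ξ = 0 :=
  ContDiffBump.zero_of_le_dist _ (by simpa using h)

theorem lowBump_nonneg (ξ : E) : 0 ≤ lowBump ξ := ContDiffBump.nonneg _

theorem lowBump_le_one (ξ : E) : lowBump ξ ≤ 1 := ContDiffBump.le_one _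

theorem hasCompactSupport_lowBump : HasCompactSupport (lowBump : E → ℝ) :=
  ContDiffBump.hasCompactSupport _

theorem contDiff_annBump : ContDiff ℝ ∞ (annBump : E → ℝ) :=
  contDiff_lowBump.sub (contDiff_lowBump.comp (contDiff_const_smul _))

theorem annBump_of_notMem {ξ : E} (h : ξ ∉ unitAnnulus E) : annBump ξ = 0 := by
  rw [unitAnnulus, Set.mem_ofPred_eq, not_and_or, not_le, not_le] at h
  have h2 : ‖(2 : ℝ) • ξ‖ = 2 * ‖ξ‖ := by rw [norm_smul]; simp
  rcases h with h | h
  · rw [annBump, lowBump_of_le (by linarith), lowBump_of_le (by linarith), sub_self]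
  · rw [annBump, lowBump_of_ge h.le, lowBump_of_ge (by linarith), sub_self]

theorem tsupport_annBump : tsupport (annBump : E → ℝ) ⊆ unitAnnulus E :=
  closure_minimal (fun _ hξ => by_contra fun h => hξ (annBump_of_notMem h)) isClosed_unitAnnulus

theorem hasCompactSupport_annBump : HasCompactSupport (annBump : E → ℝ) :=
  hasCompactSupport_of_tsupport_subset_ball (tsupport_annBump.trans unitAnnulus_subset)

theorem lowBump_telescope (t : ℝ) (ξ : E) (j : ℕ) :
    lowBump ((t * (2 ^ j)⁻¹) • ξ) =
      lowBump (t • ξ) + ∑ k ∈ Finset.range j, annBump ((t * (2 ^ (k + 1))⁻¹) • ξ) := by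
  induction j with
  | zero => simp
  | succ j ih =>
    rw [Finset.sum_range_succ, ← add_assoc, ← ih, annBump, smul_smul]
    have : (2 : ℝ) * (t * (2 ^ (j + 1))⁻¹) = t * (2 ^ j)⁻¹ := by
      rw [pow_succ]; field_simp
    rw [this]; ring

/-- A smooth compactly supported phase which agrees near the annulus with `c |ξ| ^ s`,
together with its gradient. -/
theorem exists_smooth_phase (c : ℝ) (s : ℝ) (hc : 0 < c) (hs0 : 0 < s) (hs1 : s ≠ 1) :
    ∃ (φ : E → ℝ) (G : E → E) (κ : ℝ), ContDiff ℝ ∞ φ ∧ HasCompactSupport φ ∧ ContDiff ℝ ∞ G ∧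
      HasCompactSupport G ∧ (∀ ξ v, fderiv ℝ φ ξ v = inner ℝ (G ξ) v) ∧ 0 < κ ∧
      (∀ x ∈ unitAnnulus E, ∀ y ∈ unitAnnulus E, κ * ‖x - y‖ ≤ ‖G x - G y‖) ∧
      ∀ ξ ∈ unitAnnulus E, φ ξ = c * ‖ξ‖ ^ s := by
  -- The annulus is taken larger than `unitAnnulus` so that equality holds on a neighbourhood and
  -- the gradients agree too.
  obtain ⟨φ, h1, h2, h3⟩ := exists_smooth_extension (E := E) (F := ℝ) (a := 1 / 4) (b := 4)
    (by norm_num) (by norm_num) (g := fun ξ => c * ‖ξ‖ ^ s)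
    fun x hx => contDiffAt_const.mul (contDiffAt_norm_rpow s hx)
  obtain ⟨κ, hκ, hlow⟩ := exists_gradient_lower (E := E) (a := 1 / 2) (b := 2) (s := s)
    (by norm_num) (by norm_num) hs1
  let T := (InnerProductSpace.toDual ℝ E).symm
  let G : E → E := fun ξ => T (fderiv ℝ φ ξ)
  have hG : ∀ ξ v, fderiv ℝ φ ξ v = inner ℝ (G ξ) v := fun ξ v => by
    simp [G, T]
  have hGe : ∀ ξ ∈ unitAnnulus E, G ξ = (c * s) • (‖ξ‖ ^ (s - 2) • ξ) := by
    intro ξ hξ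
    have hξ0 : ξ ≠ 0 := by
      rintro rfl
      have := hξ.1
      norm_num at this
    refine ext_inner_right ℝ fun v => ?_
    have he : φ =ᶠ[nhds ξ] fun ξ => c * ‖ξ‖ ^ s := by
      have hU : IsOpen {x : E | 1 / 4 < ‖x‖ ∧ ‖x‖ < 4} :=
        (isOpen_lt continuous_const continuous_norm).inter
          (isOpen_lt continuous_norm continuous_const)
      filter_upwards [hU.mem_nhds ⟨by linarith [hξ.1], by linarith [hξ.2]⟩] with x hx
      exact h3 x hx.1.le hx.2.le
    have hd : DifferentiableAt ℝ (fun ξ : E => ‖ξ‖ ^ s) ξ :=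
      (contDiffAt_norm_rpow s hξ0).differentiableAt (by simp)
    rw [← hG, he.fderiv_eq, fderiv_const_mul hd, _root_.smul_apply,
      fderiv_norm_rpow_apply s hξ0, inner_smul_left, inner_smul_left]
    simp only [smul_eq_mul, conj_trivial]
    ring
  refine ⟨φ, G, c * s * κ, h1, h2, ?_, ?_, hG, by positivity, fun x hx y hy => ?_, fun ξ hξ => ?_⟩
  · exact T.toContinuousLinearEquiv.contDiff.comp (h1.fderiv_right (by exact_mod_cast le_top))
  · exact (h2.fderiv ℝ).comp_left (map_zero T)
  · rw [hGe x hx, hGe y hy, ← smul_sub, norm_smul, Real.norm_of_nonneg (by positivity), mul_assoc]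
    exact mul_le_mul_of_nonneg_left (hlow x y hx.1 hx.2 hy.1 hy.2) (by positivity)
  · exact h3 ξ (by linarith [hξ.1]) (by linarith [hξ.2])

variable [MeasurableSpace E] [BorelSpace E]

/-- The dispersive bound with arbitrary polynomial decay in the linear term of the phase. -/
theorem weighted_dispersive_bound {φ : E → ℝ} {G : E → E} {K : Set E} {κ M : ℝ}
    (hφ : ContDiff ℝ ∞ φ)
    (hG : ContDiff ℝ ∞ G) (hGs : HasCompactSupport G)
    (hφG : ∀ ξ v, fderiv ℝ φ ξ v = inner ℝ (G ξ) v) (hκ : 0 < κ)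
    (hlow : ∀ x ∈ K, ∀ y ∈ K, κ * ‖x - y‖ ≤ ‖G x - G y‖) (hKc : IsClosed K)
    (hK : K ⊆ Metric.closedBall 0 M) (N : ℕ) :
    ∀ a : E → ℂ, ContDiff ℝ ∞ a → tsupport a ⊆ K →
    ∃ C : ℝ, ∀ l : ℝ, 1 ≤ l → ∀ y : E,
      (1 + ‖y‖) ^ N *
      ‖∫ ξ, Complex.exp (Complex.I * ((l * φ ξ + inner ℝ (l • y) ξ : ℝ) : ℂ)) * a ξ‖ ≤
        C * l ^ (-((Module.finrank ℝ E : ℝ) / 2)) := by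
  induction N with
  | zero =>
    intro a ha has
    obtain ⟨C, hC⟩ := dispersive_bound hφ hG hGs hφG hκ hlow hKc hK ha has
    exact ⟨C, fun l hl y => by simpa using hC l (by linarith) (l • y)⟩
  | succ N ih =>
    intro a ha has
    let b := stdOrthonormalBasis ℝ E
    have hacs : HasCompactSupport a := hasCompactSupport_of_tsupport_subset_ball (has.trans hK)
    set a1 : Fin (Module.finrank ℝ E) → E → ℂ := fun i ξ => ((fderiv ℝ φ ξ (b i) : ℝ) : ℂ) * a ξ
    set a2 : Fin (Module.finrank ℝ E) → E → ℂ := fun i ξ => fderiv ℝ a ξ (b i)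
    have h1 : ∀ i, ContDiff ℝ ∞ (a1 i) := fun i =>
      (Complex.ofRealCLM.contDiff.comp ((hφ.fderiv_right (m := ∞) (by exact_mod_cast le_top)).clm_apply
        contDiff_const)).mul ha
    have h2 : ∀ i, ContDiff ℝ ∞ (a2 i) := fun i =>
      (ha.fderiv_right (m := ∞) (by exact_mod_cast le_top)).clm_apply contDiff_const
    have h1s : ∀ i, tsupport (a1 i) ⊆ K := fun i => tsupport_mul_subset_right.trans has
    have h2s : ∀ i, tsupport (a2 i) ⊆ K := fun i => (tsupport_fderiv_apply_subset ℝ (b i)).trans has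
    obtain ⟨C0, hC0⟩ := ih a ha has
    choose C1 hC1 using fun i => ih (a1 i) (h1 i) (h1s i)
    choose C2 hC2 using fun i => ih (a2 i) (h2 i) (h2s i)
    refine ⟨C0 + ∑ i, (C1 i + C2 i), fun l hl y => ?_⟩
    have hl0 : 0 < l := by linarith
    set L := l ^ (-((Module.finrank ℝ E : ℝ) / 2))
    set e : E → ℂ := fun ξ => Complex.exp (Complex.I * ((l * φ ξ + inner ℝ (l • y) ξ : ℝ) : ℂ))
      with he
    have hre : ContDiff ℝ ∞ fun ξ => l * φ ξ + inner ℝ (l • y) ξ :=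
      (contDiff_const.mul hφ).add (contDiff_const.inner ℝ contDiff_id)
    have hec : ContDiff ℝ ∞ e := contDiff_cexp_I.comp hre
    have hfe : ∀ ξ v, fderiv ℝ e ξ v =
        Complex.I * l * ((fderiv ℝ φ ξ v : ℝ) + (inner ℝ y v : ℝ)) * e ξ := by
      intro ξ v
      have g1 : HasFDerivAt (fun ξ => l * φ ξ + inner ℝ (l • y) ξ)
          (l • fderiv ℝ φ ξ + innerSL ℝ (l • y)) ξ :=
        ((hφ.differentiable (by simp) ξ).hasFDerivAt.const_mul l).add
          (innerSL ℝ (l • y)).hasFDerivAt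
      have g2 := Complex.ofRealCLM.hasFDerivAt.comp ξ g1
      have g3 := (g2.const_mul Complex.I).cexp
      have g4 : fderiv ℝ e ξ = _ := g3.fderiv
      rw [g4]
      simp only [_root_.smul_apply, ContinuousLinearMap.comp_apply, _root_.add_apply,
        innerSL_apply_apply, Complex.ofRealCLM_apply, smul_eq_mul, inner_smul_left, conj_trivial,
        Function.comp_apply, he]
      push_cast
      ring
    have hcf : ∀ i, Continuous fun ξ => fderiv ℝ e ξ (b i) := fun i =>
      (hec.continuous_fderiv (by simp)).clm_apply continuous_const
    have hie : ∀ g : E → ℂ, Continuous g → tsupport g ⊆ K → Integrable fun ξ => e ξ * g ξ :=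
      fun g hg hgs => (hec.continuous.mul hg).integrable_of_hasCompactSupport
        (hasCompactSupport_of_tsupport_subset_ball (hgs.trans hK)).mul_left
    -- Since `∂ᵢe = i l (∂ᵢφ + yᵢ) e`, a factor `yᵢ` can be traded for the amplitudes `∂ᵢφ · a` and
    -- `l⁻¹ ∂ᵢa`. Both are supported in `K`, so the induction hypothesis applies to them, and `l ≥
    -- 1` discards `l⁻¹`.
    have hparts : ∀ i, (inner ℝ y (b i) : ℝ) * ∫ ξ, e ξ * a ξ =
        -(∫ ξ, e ξ * a1 i ξ) + Complex.I * (l : ℂ)⁻¹ * ∫ ξ, e ξ * a2 i ξ := by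
      intro i
      have p := integral_mul_fderiv_eq_neg_fderiv_mul_of_integrable (μ := volume) (f := e) (g := a)
        (v := b i) (((hcf i).mul ha.continuous).integrable_of_hasCompactSupport hacs.mul_left)
        (hie _ (h2 i).continuous (h2s i)) (hie _ ha.continuous has)
        (fun x _ => hec.differentiable (by simp) x) (fun x _ => ha.differentiable (by simp) x)
      have q : ∀ ξ, fderiv ℝ e ξ (b i) * a ξ = Complex.I * l * (e ξ * a1 i ξ) +
          Complex.I * l * (inner ℝ y (b i) : ℝ) * (e ξ * a ξ) := fun ξ => by
        rw [hfe]; simp only [a1]; ring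
      simp_rw [q] at p
      rw [integral_add ((hie _ (h1 i).continuous (h1s i)).const_mul _)
        ((hie _ ha.continuous has).const_mul _), integral_const_mul, integral_const_mul] at p
      have hl' : (l : ℂ) ≠ 0 := by exact_mod_cast hl0.ne'
      have p2 : ∫ ξ, e ξ * a2 i ξ = -(Complex.I * l * (∫ ξ, e ξ * a1 i ξ) +
        Complex.I * l * (inner ℝ y (b i) : ℝ) * ∫ ξ, e ξ * a ξ) := p
      rw [p2]
      field_simp
      linear_combination ((∫ ξ, e ξ * a1 i ξ) + (inner ℝ y (b i) : ℝ) * ∫ ξ, e ξ * a ξ) *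
        Complex.I_sq
    have hyi : ∀ i, |inner ℝ y (b i)| * ‖∫ ξ, e ξ * a ξ‖ ≤
        ‖∫ ξ, e ξ * a1 i ξ‖ + ‖∫ ξ, e ξ * a2 i ξ‖ := by
      intro i
      have := congrArg norm (hparts i)
      rw [norm_mul, Complex.norm_real, Real.norm_eq_abs] at this
      rw [this]
      refine (norm_add_le _ _).trans ?_
      rw [norm_neg, norm_mul, norm_mul, Complex.norm_I, one_mul, norm_inv, Complex.norm_real,
        Real.norm_of_nonneg hl0.le]
      gcongr
      exact mul_le_of_le_one_left (norm_nonneg _) (inv_le_one_of_one_le₀ hl)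
    have hy : ‖y‖ ≤ ∑ i, |inner ℝ y (b i)| := by
      conv_lhs => rw [← b.sum_repr' y]
      refine (norm_sum_le _ _).trans (Finset.sum_le_sum fun i _ => ?_)
      rw [norm_smul, b.norm_eq_one, mul_one, Real.norm_eq_abs, real_inner_comm]
    have hP : 0 ≤ (1 + ‖y‖) ^ N := by positivity
    calc (1 + ‖y‖) ^ (N + 1) * ‖∫ ξ, e ξ * a ξ‖
        = (1 + ‖y‖) ^ N * ‖∫ ξ, e ξ * a ξ‖ + (1 + ‖y‖) ^ N * (‖y‖ * ‖∫ ξ, e ξ * a ξ‖) := by ring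
      _ ≤ (1 + ‖y‖) ^ N * ‖∫ ξ, e ξ * a ξ‖ +
          (1 + ‖y‖) ^ N * ∑ i, (‖∫ ξ, e ξ * a1 i ξ‖ + ‖∫ ξ, e ξ * a2 i ξ‖) := by
        gcongr
        refine (mul_le_mul_of_nonneg_right hy (norm_nonneg _)).trans ?_
        rw [Finset.sum_mul]
        exact Finset.sum_le_sum fun i _ => hyi i
      _ = (1 + ‖y‖) ^ N * ‖∫ ξ, e ξ * a ξ‖ + ∑ i, ((1 + ‖y‖) ^ N * ‖∫ ξ, e ξ * a1 i ξ‖ +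
          (1 + ‖y‖) ^ N * ‖∫ ξ, e ξ * a2 i ξ‖) := by
        rw [Finset.mul_sum]; simp_rw [mul_add]
      _ ≤ C0 * L + ∑ i, (C1 i * L + C2 i * L) := by
        refine add_le_add (hC0 l hl y) (Finset.sum_le_sum fun i _ => ?_)
        exact add_le_add (hC1 i l hl y) (hC2 i l hl y)
      _ = _ := by
        rw [add_mul, Finset.sum_mul]; simp_rw [add_mul]

end PhasePieces

/-! ### Dyadic pieces of the exponential and their kernels. -/

section Pieces

variable {E : Type*} [NormedAddCommGroup E] [InnerProductSpace ℝ E] [FiniteDimensional ℝ E]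

/-- The part of `e^{i c |ξ|^s}` with frequencies of size about `2 ^ k`. -/
def dyadicPiece (c s : ℝ) (k : ℕ) (ξ : E) : ℂ :=
  Complex.exp (Complex.I * ((c * ‖ξ‖ ^ s : ℝ) : ℂ)) * (annBump (((2 : ℝ) ^ k)⁻¹ • ξ) : ℝ)

theorem norm_smul_two_pow_inv {E : Type*} [NormedAddCommGroup E] [NormedSpace ℝ E]
    (k : ℕ) (ξ : E) : ‖((2 : ℝ) ^ k)⁻¹ • ξ‖ = (2 ^ k)⁻¹ * ‖ξ‖ := by
  rw [norm_smul, norm_inv, norm_pow]; simp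

/-- Homogeneity of `|ξ|^s` turns every shell into one fixed phase on the unit annulus with large
parameter `2^{ks}`. -/
theorem dyadicPiece_eq {c s : ℝ} {φ : E → ℝ}
    (h : ∀ ξ ∈ unitAnnulus E, φ ξ = c * ‖ξ‖ ^ s) (k : ℕ) (ξ : E) :
    dyadicPiece c s k ξ =
      Complex.exp (Complex.I * (((2 : ℝ) ^ (k * s) * φ (((2 : ℝ) ^ k)⁻¹ • ξ) : ℝ) : ℂ)) *
        (annBump (((2 : ℝ) ^ k)⁻¹ • ξ) : ℝ) := by
  by_cases hξ : ((2 : ℝ) ^ k)⁻¹ • ξ ∈ unitAnnulus E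
  · rw [h _ hξ, dyadicPiece, norm_smul_two_pow_inv, Real.mul_rpow (by positivity) (norm_nonneg _),
      Real.inv_rpow (by positivity), ← Real.rpow_natCast_mul (by norm_num)]
    have : (2 : ℝ) ^ (k * s) ≠ 0 := (Real.rpow_pos_of_pos two_pos _).ne'
    congr 4
    field_simp
  · rw [dyadicPiece, annBump_of_notMem hξ]; simp

/-- In the rescaled variable a derivative costs the phase parameter `2^{ks}`, and undoing the
scaling returns `2^{-k}`; the net cost is `2^{k(s-1)}`. -/
theorem bddDerivs_dyadicPiece {c s : ℝ} (hc : 0 < c) (hs0 : 0 < s) (hs1 : s ≠ 1) :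
    BddDerivs (Set.univ : Set E) (fun k : ℕ => (2 : ℝ) ^ (k * (s - 1))) (dyadicPiece c s) := by
  obtain ⟨φ, G, κ, h1, h2, -, -, -, -, -, h8⟩ := exists_smooth_phase (E := E) c s hc hs0 hs1
  have hw : ∀ k : ℕ, (1 : ℝ) ≤ (2 : ℝ) ^ (k * s) := fun k =>
    Real.one_le_rpow one_le_two (by positivity)
  have b1 := BddDerivs.cexp_smul (K := Set.univ) hw h1 h2 (l := fun k : ℕ => (2 : ℝ) ^ (k * s))
    fun k => (abs_of_nonneg (zero_le_one.trans (hw k))).le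
  have b2 : BddDerivs (Set.univ : Set E) (fun k : ℕ => (2 : ℝ) ^ (k * s))
      (fun _ ξ => ((annBump ξ : ℝ) : ℂ)) :=
    (BddDerivs.of_hasCompactSupport hw contDiff_annBump hasCompactSupport_annBump).clm_comp
      Complex.ofRealCLM
  have b3 := (b1.mul (fun k => zero_le_one.trans (hw k)) b2).comp_smul
    (t := fun k : ℕ => ((2 : ℝ) ^ k)⁻¹) (fun k => by positivity)
  have e1 : (fun k : ℕ => ((2 : ℝ) ^ k)⁻¹ * (2 : ℝ) ^ (k * s)) =
      fun k : ℕ => (2 : ℝ) ^ (k * (s - 1)) := by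
    funext k
    rw [← Real.rpow_natCast, ← Real.rpow_neg two_pos.le, ← Real.rpow_add two_pos]
    congr 1; ring
  have e2 : (dyadicPiece c s : ℕ → E → ℂ) = fun (k : ℕ) ξ =>
      Complex.exp (Complex.I * (((2 : ℝ) ^ (k * s) * φ (((2 : ℝ) ^ k)⁻¹ • ξ) : ℝ) : ℂ)) *
        (annBump (((2 : ℝ) ^ k)⁻¹ • ξ) : ℝ) := by
    funext k ξ; exact dyadicPiece_eq h8 k ξ
  rw [e2, ← e1]
  exact b3

theorem contDiff_dyadicPiece {c s : ℝ} (hc : 0 < c) (hs0 : 0 < s) (hs1 : s ≠ 1) (k : ℕ) :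
    ContDiff ℝ ∞ (dyadicPiece c s k : E → ℂ) :=
  (bddDerivs_dyadicPiece hc hs0 hs1).1 k

theorem hasCompactSupport_dyadicPiece (c s : ℝ) (k : ℕ) :
    HasCompactSupport (dyadicPiece c s k : E → ℂ) := by
  have h : HasCompactSupport fun ξ : E => annBump (((2 : ℝ) ^ k)⁻¹ • ξ) :=
    hasCompactSupport_annBump.comp_smul (by positivity)
  exact (h.comp_left (g := fun t : ℝ => (t : ℂ)) Complex.ofReal_zero).mul_left

theorem dyadicPiece_eq_zero {c s : ℝ} {k : ℕ} {ξ : E} (h : ‖ξ‖ < 2 ^ k / 2 ∨ 2 * 2 ^ k < ‖ξ‖) :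
    dyadicPiece c s k ξ = 0 := by
  rw [dyadicPiece, annBump_of_notMem, Complex.ofReal_zero, mul_zero]
  intro hm
  have := hm.1
  have h2 := hm.2
  have hk : (0 : ℝ) < 2 ^ k := by positivity
  rw [norm_smul_two_pow_inv, inv_mul_eq_div] at this h2
  rw [div_le_iff₀ hk] at h2
  rw [le_div_iff₀ hk] at this
  rcases h with h | h <;> linarith

variable [MeasurableSpace E] [BorelSpace E]

/-- Size and localization of the kernel of a dyadic piece. -/
theorem exists_fourier_dyadicPiece_bound {c s : ℝ} (hc : 0 < c) (hs0 : 0 < s) (hs1 : s ≠ 1)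
    (N : ℕ) : ∃ C : ℝ, 0 ≤ C ∧ ∀ (k : ℕ) (x : E),
      (1 + ‖x‖ / (2 : ℝ) ^ (k * (s - 1))) ^ N * ‖𝓕 (dyadicPiece c s k : E → ℂ) x‖ ≤
        C * (2 : ℝ) ^ (k * (Module.finrank ℝ E) * (1 - s / 2)) := by
  obtain ⟨φ, G, κ, h1, h2, h3, h4, h5, h6, h7, h8⟩ :=
    exists_smooth_phase (E := E) c s hc hs0 hs1
  obtain ⟨C, hC⟩ := weighted_dispersive_bound h1 h3 h4 h5 h6 h7 isClosed_unitAnnulus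
    unitAnnulus_subset N (fun ξ => ((annBump ξ : ℝ) : ℂ))
    (Complex.ofRealCLM.contDiff.comp contDiff_annBump)
    ((closure_mono fun ξ hξ => by
      simpa using hξ : tsupport (fun ξ : E => ((annBump ξ : ℝ) : ℂ)) ⊆ tsupport annBump).trans
      tsupport_annBump)
  refine ⟨|C|, abs_nonneg _, fun k x => ?_⟩
  set d := Module.finrank ℝ E
  set l : ℝ := (2 : ℝ) ^ (k * s) with hl
  have hl1 : 1 ≤ l := Real.one_le_rpow one_le_two (by positivity)
  have hl0 : 0 < l := by linarith
  set R : ℝ := (2 : ℝ) ^ (k * (s - 1)) with hR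
  have hR0 : 0 < R := Real.rpow_pos_of_pos two_pos _
  have hRl : l = R * 2 ^ k := by
    rw [hl, hR, ← Real.rpow_natCast, ← Real.rpow_add two_pos]; congr 1; ring
  -- Chosen so that, with `l = R 2^k`, the linear term `⟨l y, 2^{-k} ξ⟩` is the Fourier phase
  -- `-2π⟨ξ, x⟩`. Decay in `y` is therefore decay at spatial scale `R`.
  set y : E := (-(2 * Real.pi) / R) • x with hy
  have hF : 𝓕 (dyadicPiece c s k : E → ℂ) x = ((2 : ℝ) ^ k) ^ d •
      ∫ ξ, Complex.exp (Complex.I * ((l * φ ξ + inner ℝ (l • y) ξ : ℝ) : ℂ)) * (annBump ξ : ℝ) := by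
    rw [Real.fourier_eq']
    have key := Measure.integral_comp_smul (volume : Measure E)
      (fun ξ => Complex.exp (Complex.I * ((l * φ ξ + inner ℝ (l • y) ξ : ℝ) : ℂ)) *
        (annBump ξ : ℝ)) (((2 : ℝ) ^ k)⁻¹)
    rw [inv_pow, inv_inv, abs_of_pos (by positivity)] at key
    rw [← key]
    refine integral_congr_ae (Filter.Eventually.of_forall fun ξ => ?_)
    simp only [smul_eq_mul]
    rw [dyadicPiece_eq h8, ← mul_assoc, ← Complex.exp_add]
    congr 2
    have e : inner ℝ (l • y) (((2 : ℝ) ^ k)⁻¹ • ξ) = -2 * Real.pi * inner ℝ ξ x := by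
      rw [hy, smul_smul, inner_smul_left, inner_smul_right, real_inner_comm, hRl, conj_trivial]
      have : (2 : ℝ) ^ k ≠ 0 := by positivity
      field_simp
    rw [e]
    push_cast
    ring
  rw [hF, norm_smul, norm_pow, norm_pow, Real.norm_ofNat]
  have h9 := hC l hl1 y
  have h10 : ‖x‖ / R ≤ ‖y‖ := by
    rw [hy, norm_smul, Real.norm_eq_abs, abs_div, abs_neg, abs_of_pos (by positivity),
      abs_of_pos hR0, div_mul_eq_mul_div]
    gcongr
    exact le_mul_of_one_le_left (norm_nonneg _) (by linarith [Real.pi_gt_three])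
  -- The Jacobian `2^{kd}` against the dispersive gain `l^{-d/2} = 2^{-kds/2}`.
  have h11 : ((2 : ℝ) ^ k) ^ d * l ^ (-((d : ℝ) / 2)) = (2 : ℝ) ^ (k * d * (1 - s / 2)) := by
    rw [hl, ← Real.rpow_mul two_pos.le, ← pow_mul, ← Real.rpow_natCast, ← Real.rpow_add two_pos]
    congr 1; push_cast; ring
  set I := ‖∫ ξ, Complex.exp (Complex.I * ((l * φ ξ + inner ℝ (l • y) ξ : ℝ) : ℂ)) *
    (annBump ξ : ℝ)‖ with hI
  calc (1 + ‖x‖ / R) ^ N * ((2 ^ k) ^ d * I) ≤ (1 + ‖y‖) ^ N * ((2 ^ k) ^ d * I) := by gcongr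
    _ = (2 ^ k) ^ d * ((1 + ‖y‖) ^ N * I) := by ring
    _ ≤ (2 ^ k) ^ d * (|C| * l ^ (-((d : ℝ) / 2))) :=
      mul_le_mul_of_nonneg_left
        (h9.trans (mul_le_mul_of_nonneg_right (le_abs_self _) (by positivity))) (by positivity)
    _ = _ := by rw [← h11]; ring

end Pieces

/-! ### Fourier multipliers on weighted `L²`. -/

section WeightedMultiplier

variable {n : ℕ}

/-- The `i`-th factor of the polynomial weight at scale `R`. -/
def weightFactor (R : ℝ) (i : Fin n) (x : Rn n) : ℂ :=
  1 - 2 * Real.pi * Complex.I * ((R⁻¹ * inner ℝ x (EuclideanSpace.single i (1 : ℝ)) : ℝ) : ℂ)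

/-- The product of the weight factors over a list of coordinates. -/
def weightList (R : ℝ) (l : List (Fin n)) (x : Rn n) : ℂ := (l.map fun i => weightFactor R i x).prod

theorem normSq_weightFactor (R : ℝ) (i : Fin n) (x : Rn n) :
    ‖weightFactor R i x‖ ^ 2 = 1 + (2 * Real.pi / R * x i) ^ 2 := by
  have e : weightFactor R i x = ((1 : ℝ) : ℂ) + ((-(2 * Real.pi / R * x i) : ℝ) : ℂ) * Complex.I := by
    rw [weightFactor, EuclideanSpace.inner_single_right]
    simp only [conj_trivial, one_mul]
    push_cast
    ring
  rw [e, ← Complex.normSq_eq_norm_sq, Complex.normSq_add_mul_I]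
  ring

theorem one_le_norm_weightFactor (R : ℝ) (i : Fin n) (x : Rn n) : 1 ≤ ‖weightFactor R i x‖ := by
  have h := normSq_weightFactor R i x
  nlinarith [sq_nonneg (2 * Real.pi / R * x i), norm_nonneg (weightFactor R i x)]

theorem weightFactor_ne_zero (R : ℝ) (i : Fin n) (x : Rn n) : weightFactor R i x ≠ 0 :=
  norm_ne_zero_iff.1 (by linarith [one_le_norm_weightFactor R i x])

theorem weightList_ne_zero (R : ℝ) (l : List (Fin n)) (x : Rn n) : weightList R l x ≠ 0 := by
  induction l with
  | nil => simp [weightList]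
  | cons i l ih =>
    have : weightList R (i :: l) x = weightFactor R i x * weightList R l x := by
      simp [weightList]
    rw [this]
    exact mul_ne_zero (weightFactor_ne_zero R i x) ih

theorem hasTemperateGrowth_weightFactor (R : ℝ) (i : Fin n) :
    Function.HasTemperateGrowth (weightFactor R i) := by
  refine (Function.HasTemperateGrowth.const 1).sub
    ((Function.HasTemperateGrowth.const _).mul (Complex.ofRealCLM.hasTemperateGrowth.comp ?_))
  exact (Function.HasTemperateGrowth.const _).mul (Function.hasTemperateGrowth_inner_left _)

/-- For real `t`, `(1 - it)⁻¹ = (1 + it)(1 + t²)⁻¹`, a product of functions already known to be of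
temperate growth. -/
theorem hasTemperateGrowth_weightFactor_inv (R : ℝ) (i : Fin n) :
    Function.HasTemperateGrowth (fun x => (weightFactor R i x)⁻¹) := by
  have h1 : Function.HasTemperateGrowth fun x : Rn n =>
      2 * Real.pi * (R⁻¹ * inner ℝ x (EuclideanSpace.single i (1 : ℝ))) :=
    (Function.HasTemperateGrowth.const _).mul
      ((Function.HasTemperateGrowth.const _).mul (Function.hasTemperateGrowth_inner_left _))
  have h2 := (Function.hasTemperateGrowth_one_add_norm_sq_rpow ℝ (-1)).comp h1
  have h3 : Function.HasTemperateGrowth fun x : Rn n => (1 : ℂ) + Complex.I *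
      ((2 * Real.pi * (R⁻¹ * inner ℝ x (EuclideanSpace.single i (1 : ℝ))) : ℝ) : ℂ) :=
    (Function.HasTemperateGrowth.const 1).add
      ((Function.HasTemperateGrowth.const _).mul (Complex.ofRealCLM.hasTemperateGrowth.comp h1))
  refine (congrArg Function.HasTemperateGrowth (funext fun x => ?_)).mpr
    (h3.mul (Complex.ofRealCLM.hasTemperateGrowth.comp h2))
  simp only [Pi.mul_apply, Function.comp_apply, Complex.ofRealCLM_apply]
  set t : ℝ := R⁻¹ * inner ℝ x (EuclideanSpace.single i (1 : ℝ)) with ht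
  have hw : weightFactor R i x = 1 - Complex.I * ((2 * Real.pi * t : ℝ) : ℂ) := by
    rw [weightFactor, ← ht]; push_cast; ring
  have hpos : (0 : ℝ) < 1 + ‖2 * Real.pi * t‖ ^ 2 := by positivity
  rw [inv_eq_iff_eq_inv, eq_comm, inv_eq_iff_eq_inv, eq_comm, Real.rpow_neg_one]
  rw [inv_eq_of_mul_eq_one_right]
  rw [hw]
  have e : ((1 + ‖2 * Real.pi * t‖ ^ 2 : ℝ) : ℂ) = 1 + ((2 * Real.pi * t : ℝ) : ℂ) ^ 2 := by
    rw [Real.norm_eq_abs, sq_abs]; push_cast; ring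
  have hne : ((1 + ‖2 * Real.pi * t‖ ^ 2 : ℝ) : ℂ) ≠ 0 := by exact_mod_cast hpos.ne'
  rw [Complex.ofReal_inv, ← mul_assoc, ← div_eq_mul_inv, div_eq_one_iff_eq hne, e]
  linear_combination (-((2 * Real.pi * t : ℝ) : ℂ) ^ 2) * Complex.I_sq

theorem weightList_cons (R : ℝ) (i : Fin n) (l : List (Fin n)) (x : Rn n) :
    weightList R (i :: l) x = weightFactor R i x * weightList R l x := by
  simp [weightList]

theorem hasTemperateGrowth_weightList (R : ℝ) (l : List (Fin n)) :
    Function.HasTemperateGrowth (weightList R l) := by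
  induction l with
  | nil => exact Function.HasTemperateGrowth.const 1
  | cons i l ih =>
    have : weightList R (i :: l) = weightFactor R i * weightList R l := by
      funext x; simp [weightList]
    rw [this]
    exact (hasTemperateGrowth_weightFactor R i).mul ih

theorem hasTemperateGrowth_weightList_inv (R : ℝ) (l : List (Fin n)) :
    Function.HasTemperateGrowth (fun x => (weightList R l x)⁻¹) := by
  induction l with
  | nil => simp [weightList, Function.HasTemperateGrowth.const]
  | cons i l ih =>
    have : (fun x => (weightList R (i :: l) x)⁻¹) =
        (fun x => (weightFactor R i x)⁻¹) * fun x => (weightList R l x)⁻¹ := by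
      funext x; simp [weightList, mul_comm]
    rw [this]
    exact (hasTemperateGrowth_weightFactor_inv R i).mul ih

theorem eLpNorm_fourier_two (f : 𝓢(Rn n, ℂ)) :
    eLpNorm (𝓕 f : 𝓢(Rn n, ℂ)) 2 volume = eLpNorm f 2 volume := by
  have := norm_fourier_toL2_eq f
  rw [norm_toLp, norm_toLp] at this
  refine (ENNReal.toReal_eq_toReal_iff' ?_ ?_).1 this
  · exact (eLpNorm_lt_top (𝓕 f : 𝓢(Rn n, ℂ)) 2 volume).ne
  · exact (eLpNorm_lt_top f 2 volume).ne

theorem eLpNorm_fourierInv_two (f : 𝓢(Rn n, ℂ)) :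
    eLpNorm (𝓕⁻ f : 𝓢(Rn n, ℂ)) 2 volume = eLpNorm f 2 volume := by
  rw [← eLpNorm_fourier_two, FourierTransform.fourier_fourierInv_eq]

theorem eLpNorm_fourierMultiplier_le {m : Rn n → ℂ} (hm : m.HasTemperateGrowth) {b : ℝ}
    (hb : ∀ ξ, ‖m ξ‖ ≤ b) (F : 𝓢(Rn n, ℂ)) :
    eLpNorm (fourierMultiplierCLM ℂ m F) 2 volume ≤ ENNReal.ofReal b * eLpNorm F 2 volume := by
  rw [fourierMultiplierCLM_apply, eLpNorm_fourierInv_two, ← eLpNorm_fourier_two F]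
  refine eLpNorm_le_mul_eLpNorm_of_ae_le_mul (Filter.Eventually.of_forall fun ξ => ?_) 2
  rw [smulLeftCLM_apply_apply hm, smul_eq_mul, norm_mul]
  exact mul_le_mul_of_nonneg_right (hb ξ) (norm_nonneg _)

/-- Commutation of a Fourier multiplier with a weight factor. -/
theorem fourierMultiplier_weightFactor {m : Rn n → ℂ} (hm : m.HasTemperateGrowth) {R : ℝ}
    (i : Fin n)
    (hm' : Function.HasTemperateGrowth
      fun ξ => (R⁻¹ : ℝ) • fderiv ℝ m ξ (EuclideanSpace.single i (1 : ℝ)))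
    (F : 𝓢(Rn n, ℂ)) :
    fourierMultiplierCLM ℂ m (smulLeftCLM ℂ (weightFactor R i) F) =
      smulLeftCLM ℂ (weightFactor R i) (fourierMultiplierCLM ℂ m F) -
        fourierMultiplierCLM ℂ
          (fun ξ => (R⁻¹ : ℝ) • fderiv ℝ m ξ (EuclideanSpace.single i (1 : ℝ))) F := by
  set e : Rn n := EuclideanSpace.single i (1 : ℝ)
  have hin : Function.HasTemperateGrowth fun x : Rn n => inner ℝ x e :=
    Function.hasTemperateGrowth_inner_left e
  have hQ : ∀ F : 𝓢(Rn n, ℂ), smulLeftCLM ℂ (weightFactor R i) F =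
      F + (R⁻¹ : ℝ) • (-(2 * Real.pi * Complex.I) • smulLeftCLM ℂ (fun x => inner ℝ x e) F) := by
    intro F
    ext x
    simp only [_root_.add_apply, _root_.smul_apply]
    rw [smulLeftCLM_apply_apply (hasTemperateGrowth_weightFactor R i),
      smulLeftCLM_apply_apply hin, weightFactor]
    simp only [smul_eq_mul, Complex.real_smul, neg_mul, e]
    push_cast
    ring
  -- On the Fourier side the weight factor is the first-order operator `1 + R⁻¹∂ᵢ`, so commuting it
  -- past multiplication by `m` leaves exactly one term, with symbol `R⁻¹∂ᵢm`. This is why the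
  -- factors are complex and linear in `x`.
  have h1 : ∀ F : 𝓢(Rn n, ℂ), 𝓕 (smulLeftCLM ℂ (weightFactor R i) F) =
      𝓕 F + (R⁻¹ : ℝ) • ∂_{e} (𝓕 F) := fun F => by
    rw [hQ, FourierTransform.fourier_add, FourierTransform.fourier_smul, ← lineDerivOp_fourier_eq]
  have h2 : ∀ g : 𝓢(Rn n, ℂ), 𝓕⁻ (g + (R⁻¹ : ℝ) • ∂_{e} g) =
      smulLeftCLM ℂ (weightFactor R i) (𝓕⁻ g) := fun g => by
    rw [hQ, FourierTransform.fourierInv_add, FourierTransform.fourierInv_smul,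
      fourierInv_lineDerivOp_eq]
  rw [fourierMultiplierCLM_apply, fourierMultiplierCLM_apply, fourierMultiplierCLM_apply, h1, ← h2,
    eq_sub_iff_add_eq, ← FourierTransform.fourierInv_add]
  congr 1
  ext ξ
  simp only [_root_.add_apply, _root_.smul_apply, smulLeftCLM_apply_apply hm,
    smulLeftCLM_apply_apply hm', lineDerivOp_apply_eq_fderiv]
  have hd : fderiv ℝ (smulLeftCLM ℂ m (𝓕 F)) ξ e =
      m ξ * fderiv ℝ (𝓕 F : 𝓢(Rn n, ℂ)) ξ e + fderiv ℝ m ξ e * (𝓕 F : 𝓢(Rn n, ℂ)) ξ := by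
    have h3 : (smulLeftCLM ℂ m (𝓕 F) : Rn n → ℂ) = fun ξ => m ξ * (𝓕 F : 𝓢(Rn n, ℂ)) ξ := by
      rw [smulLeftCLM_apply hm]; rfl
    rw [h3, fderiv_fun_mul (hm.1.differentiable (by simp) ξ) ((𝓕 F).differentiableAt)]
    simp only [_root_.add_apply, _root_.smul_apply, smul_eq_mul]
    ring
  rw [hd]
  simp only [smul_eq_mul, Complex.real_smul]
  ring

theorem hasTemperateGrowth_fderiv_apply {m : Rn n → ℂ} (hm : m.HasTemperateGrowth) (R : ℝ)
    (v : Rn n) : Function.HasTemperateGrowth fun ξ => R • fderiv ℝ m ξ v := by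
  have h1 : Function.HasTemperateGrowth fun ξ => fderiv ℝ m ξ := by
    refine ⟨hm.1.fderiv_right (by exact_mod_cast le_top), fun k => ?_⟩
    obtain ⟨p, C, hC⟩ := hm.2 (k + 1)
    exact ⟨p, C, fun x => by rw [norm_iteratedFDeriv_fderiv]; exact hC x⟩
  have h2 := (R • ContinuousLinearMap.apply ℝ ℂ v).hasTemperateGrowth.comp h1
  exact h2

theorem norm_iteratedFDeriv_fderiv_apply_le {m : Rn n → ℂ} (hm : ContDiff ℝ ∞ m) {R : ℝ}
    (hR : 0 ≤ R) (i : Fin n) (k : ℕ) (ξ : Rn n) :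
    ‖iteratedFDeriv ℝ k (fun ξ => R • fderiv ℝ m ξ (EuclideanSpace.single i (1 : ℝ))) ξ‖ ≤
      R * ‖iteratedFDeriv ℝ (k + 1) m ξ‖ := by
  set v : Rn n := EuclideanSpace.single i (1 : ℝ)
  have h1 := (R • ContinuousLinearMap.apply ℝ ℂ v).norm_iteratedFDeriv_comp_left (f := fderiv ℝ m)
    (x := ξ) (n := k) (N := ∞)
    (hm.fderiv_right (m := ∞) (by exact_mod_cast le_top)).contDiffAt (by exact_mod_cast le_top)
  rw [norm_iteratedFDeriv_fderiv] at h1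
  refine h1.trans (mul_le_mul_of_nonneg_right ?_ (norm_nonneg _))
  rw [norm_smul, Real.norm_of_nonneg hR]
  refine mul_le_of_le_one_right hR (ContinuousLinearMap.opNorm_le_bound _ zero_le_one fun L => ?_)
  have := L.le_opNorm v
  rw [show ‖v‖ = 1 by simp [v], mul_one] at this
  simpa using this

/-- Weighted `L²` bound for a multiplier whose derivatives of order `k` are `O(R ^ k)`. -/
theorem eLpNorm_fourierMultiplier_weightList {R : ℝ} (hR : 0 < R) {b : ℝ} (l : List (Fin n)) :
    ∀ m : Rn n → ℂ, m.HasTemperateGrowth →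
      (∀ k ≤ l.length, ∀ ξ, ‖iteratedFDeriv ℝ k m ξ‖ ≤ b * R ^ k) → ∀ F : 𝓢(Rn n, ℂ),
      eLpNorm (fun x => (weightList R l x)⁻¹ *
        fourierMultiplierCLM ℂ m (smulLeftCLM ℂ (weightList R l) F) x) 2 volume ≤
        ENNReal.ofReal (2 ^ l.length * b) * eLpNorm F 2 volume := by
  induction l with
  | nil =>
    intro m hm hb F
    have e : smulLeftCLM ℂ (weightList R ([] : List (Fin n))) F = F := by
      ext x
      rw [smulLeftCLM_apply_apply (hasTemperateGrowth_weightList R [])]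
      simp [weightList]
    rw [e]
    simp only [weightList, List.map_nil, List.prod_nil, inv_one, one_mul, List.length_nil, pow_zero]
    exact eLpNorm_fourierMultiplier_le hm (fun ξ => by simpa using hb 0 le_rfl ξ) F
  | cons i l ih =>
    intro m hm hb F
    set m' : Rn n → ℂ := fun ξ => (R⁻¹ : ℝ) • fderiv ℝ m ξ (EuclideanSpace.single i (1 : ℝ))
      with hm'
    have hm't : m'.HasTemperateGrowth := hasTemperateGrowth_fderiv_apply hm _ _
    have hw : smulLeftCLM ℂ (weightList R (i :: l)) F =
        smulLeftCLM ℂ (weightFactor R i) (smulLeftCLM ℂ (weightList R l) F) := by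
      rw [smulLeftCLM_smulLeftCLM_apply (hasTemperateGrowth_weightFactor R i)
        (hasTemperateGrowth_weightList R l)]
      congr 2
    rw [hw, fourierMultiplier_weightFactor hm i hm't]
    set G := smulLeftCLM ℂ (weightList R l) F
    have e : (fun x => (weightList R (i :: l) x)⁻¹ *
        (smulLeftCLM ℂ (weightFactor R i) (fourierMultiplierCLM ℂ m G) -
          fourierMultiplierCLM ℂ m' G) x) =
        (fun x => (weightList R l x)⁻¹ * fourierMultiplierCLM ℂ m G x) -
        fun x => (weightFactor R i x)⁻¹ *
          ((weightList R l x)⁻¹ * fourierMultiplierCLM ℂ m' G x) := by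
      funext x
      rw [Pi.sub_apply, _root_.sub_apply,
        smulLeftCLM_apply_apply (hasTemperateGrowth_weightFactor R i), weightList_cons, smul_eq_mul]
      have := weightFactor_ne_zero R i x
      have := weightList_ne_zero R l x
      field_simp
    have hcont : ∀ m : Rn n → ℂ,
        Continuous fun x => (weightList R l x)⁻¹ * fourierMultiplierCLM ℂ m G x := fun m =>
      (hasTemperateGrowth_weightList_inv R l).1.continuous.mul (SchwartzMap.continuous _)
    rw [e]
    refine (eLpNorm_sub_le (hcont m).aestronglyMeasurable
      ((hasTemperateGrowth_weightFactor_inv R i).1.continuous.mul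
        (hcont m')).aestronglyMeasurable (by norm_num)).trans ?_
    have b1 := ih m hm (fun k hk => hb k (hk.trans (by simp))) F
    -- `R⁻¹∂ᵢm` obeys the same bounds with the same `b`, one derivative fewer being available. Each
    -- weight factor thus doubles the number of terms, which gives the power of two.
    have b2 := ih m' hm't (fun k hk ξ => by
      refine (norm_iteratedFDeriv_fderiv_apply_le hm.1 (inv_nonneg.2 hR.le) i k ξ).trans ?_
      rw [inv_mul_le_iff₀ hR]
      refine (hb (k + 1) (by simpa using hk) ξ).trans (le_of_eq ?_)
      ring) F
    have b3 : eLpNorm (fun x => (weightFactor R i x)⁻¹ *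
          ((weightList R l x)⁻¹ * fourierMultiplierCLM ℂ m' G x)) 2 volume ≤
        eLpNorm (fun x => (weightList R l x)⁻¹ * fourierMultiplierCLM ℂ m' G x) 2 volume := by
      refine eLpNorm_mono fun x => ?_
      rw [norm_mul, norm_inv]
      exact mul_le_of_le_one_left (norm_nonneg _)
        (inv_le_one_of_one_le₀ (one_le_norm_weightFactor R i x))
    refine (add_le_add b1 (b3.trans b2)).trans (le_of_eq ?_)
    have h2 : ENNReal.ofReal (2 ^ (i :: l).length * b) =
        2 * ENNReal.ofReal (2 ^ l.length * b) := by
      rw [List.length_cons, pow_succ', mul_assoc, ENNReal.ofReal_mul (by norm_num),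
        ENNReal.ofReal_ofNat]
    rw [h2, ← two_mul, mul_assoc]

/-- The full product weight at scale `R`. -/
def weight (R : ℝ) (x : Rn n) : ℂ := weightList R (List.finRange n) x

theorem normSq_weight (R : ℝ) (x : Rn n) :
    ‖weight R x‖ ^ 2 = ∏ i, (1 + (2 * Real.pi / R * x i) ^ 2) := by
  rw [weight, weightList, ← List.ofFn_eq_map, List.prod_ofFn, norm_prod, ← Finset.prod_pow]
  exact Finset.prod_congr rfl fun i _ => normSq_weightFactor R i x

/-- The integrand is a product of one-dimensional Cauchy profiles; each integrates to `π · R/(2π)`.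
-/
theorem integral_weight_inv_sq {R : ℝ} (hR : 0 < R) :
    Integrable (fun x : Rn n => (‖weight R x‖ ^ 2)⁻¹) ∧
      ∫ x : Rn n, (‖weight R x‖ ^ 2)⁻¹ = (R / 2) ^ n := by
  have hR2 : 0 < 2 * Real.pi / R := by positivity
  have e : (fun x : Rn n => (‖weight R x‖ ^ 2)⁻¹) =
      (fun y : Fin n → ℝ => ∏ i, (1 + (2 * Real.pi / R * y i) ^ 2)⁻¹) ∘ WithLp.ofLp := by
    funext x
    rw [normSq_weight, Function.comp_apply, Finset.prod_inv_distrib]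
  have hi1 : Integrable fun t : ℝ => (1 + (2 * Real.pi / R * t) ^ 2)⁻¹ :=
    integrable_inv_one_add_sq.comp_mul_left' hR2.ne'
  have hi : Integrable fun y : Fin n → ℝ => ∏ i, (1 + (2 * Real.pi / R * y i) ^ 2)⁻¹ :=
    Integrable.fintype_prod (fun _ => hi1)
  have hmp := PiLp.volume_preserving_ofLp (Fin n)
  have hemb : MeasurableEmbedding (WithLp.ofLp : Rn n → Fin n → ℝ) :=
    (MeasurableEquiv.toLp 2 (Fin n → ℝ)).symm.measurableEmbedding
  rw [e]
  refine ⟨(hmp.integrable_comp_emb hemb).2 hi, ?_⟩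
  have h1 := hmp.integral_comp hemb fun y : Fin n → ℝ => ∏ i, (1 + (2 * Real.pi / R * y i) ^ 2)⁻¹
  refine h1.trans ?_
  rw [integral_fintype_prod_volume_eq_pow fun t : ℝ => (1 + (2 * Real.pi / R * t) ^ 2)⁻¹]
  rw [Measure.integral_comp_mul_left (fun t : ℝ => (1 + t ^ 2)⁻¹), integral_univ_inv_one_add_sq,
    Fintype.card_fin, abs_of_pos (inv_pos.2 hR2)]
  congr 1
  rw [smul_eq_mul]
  field_simp [Real.pi_ne_zero]

theorem eLpNorm_weight_inv {R : ℝ} (hR : 0 < R) :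
    eLpNorm (fun x : Rn n => (weight R x)⁻¹) 2 volume ≤ ENNReal.ofReal (R ^ ((n : ℝ) / 2)) := by
  obtain ⟨h1, h2⟩ := integral_weight_inv_sq (n := n) hR
  rw [eLpNorm_eq_lintegral_rpow_enorm_toReal (by norm_num) (by norm_num)]
  have e : ∀ x : Rn n, ‖(weight R x)⁻¹‖ₑ ^ ((2 : ℝ≥0∞).toReal) =
      ENNReal.ofReal ((‖weight R x‖ ^ 2)⁻¹) := by
    intro x
    rw [← ofReal_norm, norm_inv, ENNReal.toReal_ofNat,
      ENNReal.ofReal_rpow_of_nonneg (by positivity) (by norm_num)]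
    congr 1
    rw [Real.rpow_ofNat, inv_pow]
  simp_rw [e]
  rw [← ofReal_integral_eq_lintegral_ofReal h1
    (Filter.Eventually.of_forall fun x => by positivity), h2, ENNReal.toReal_ofNat,
    ENNReal.ofReal_rpow_of_nonneg (by positivity) (by norm_num)]
  refine ENNReal.ofReal_le_ofReal ?_
  have : R ^ ((n : ℝ) / 2) = (R ^ n) ^ (1 / (2 : ℝ)) := by
    rw [← Real.rpow_natCast, ← Real.rpow_mul hR.le]; congr 1; ring
  rw [this]
  refine Real.rpow_le_rpow (by positivity) (pow_le_pow_left₀ (by positivity) ?_ n) (by norm_num)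
  linarith

/-- The multiplier operator maps bounded functions to a weighted `L²` space. -/
theorem eLpNorm_weight_inv_fourierMultiplier {R : ℝ} (hR : 0 < R) {b : ℝ} (hb0 : 0 ≤ b)
    {m : Rn n → ℂ} (hm : m.HasTemperateGrowth)
    (hb : ∀ k ≤ n, ∀ ξ, ‖iteratedFDeriv ℝ k m ξ‖ ≤ b * R ^ k) (f : 𝓢(Rn n, ℂ)) {a : ℝ}
    (ha : ∀ x, ‖f x‖ ≤ a) :
    eLpNorm (fun x => (weight R x)⁻¹ * fourierMultiplierCLM ℂ m f x) 2 volume ≤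
      ENNReal.ofReal (2 ^ n * b * a * R ^ ((n : ℝ) / 2)) := by
  have ha0 : 0 ≤ a := (norm_nonneg _).trans (ha 0)
  -- Writing `f` as the weight times `F`, boundedness of `f` puts `F` in `L²` with norm at most `a
  -- R^{n/2}`, and the conjugated multiplier acts on `F`.
  set F := smulLeftCLM ℂ (fun x => (weightList R (List.finRange n) x)⁻¹) f with hF
  have hf : smulLeftCLM ℂ (weightList R (List.finRange n)) F = f := by
    ext x
    rw [smulLeftCLM_apply_apply (hasTemperateGrowth_weightList R _), hF,
      smulLeftCLM_apply_apply (hasTemperateGrowth_weightList_inv R _), smul_eq_mul, smul_eq_mul,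
      mul_inv_cancel_left₀ (weightList_ne_zero R _ x)]
  have h1 := eLpNorm_fourierMultiplier_weightList hR (b := b) (List.finRange n) m hm
    (by simpa using hb) F
  rw [hf, List.length_finRange] at h1
  refine h1.trans ?_
  have h2 : eLpNorm F 2 volume ≤ ENNReal.ofReal a * ENNReal.ofReal (R ^ ((n : ℝ) / 2)) := by
    refine le_trans ?_ (mul_le_mul_right (eLpNorm_weight_inv hR) _)
    refine eLpNorm_le_mul_eLpNorm_of_ae_le_mul (Filter.Eventually.of_forall fun x => ?_) 2
    rw [hF, smulLeftCLM_apply_apply (hasTemperateGrowth_weightList_inv R _), smul_eq_mul, norm_mul,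
      mul_comm]
    exact mul_le_mul_of_nonneg_right (ha x) (norm_nonneg _)
  refine (mul_le_mul_right h2 _).trans (le_of_eq ?_)
  rw [← ENNReal.ofReal_mul ha0, ← ENNReal.ofReal_mul (by positivity)]
  congr 1
  ring

end WeightedMultiplier

/-! ### Bilinear forms bounded on `L^∞ × L^∞`. -/

section FormBound

variable {n : ℕ}

/-- `τ` is a bounded measurable symbol and the bilinear form
`(f, g) ↦ ∬ τ(ξ, η) 𝓕f(ξ) 𝓕g(η) dξ dη` is bounded by `A ‖f‖_∞ ‖g‖_∞`. -/
structure FormBound (τ : Rn n × Rn n → ℂ) (A : ℝ) : Prop where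
  measurable : Measurable τ
  bounded : ∃ B, ∀ p, ‖τ p‖ ≤ B
  nonneg : 0 ≤ A
  bound : ∀ (f g : 𝓢(Rn n, ℂ)) (a b : ℝ), (∀ x, ‖f x‖ ≤ a) → (∀ x, ‖g x‖ ≤ b) →
    ‖∫ p : Rn n × Rn n, τ p * ((𝓕 f : 𝓢(Rn n, ℂ)) p.1 * (𝓕 g : 𝓢(Rn n, ℂ)) p.2)‖ ≤ A * (a * b)

theorem integrable_symbol_mul {τ : Rn n × Rn n → ℂ} (hm : Measurable τ)
    (hb : ∃ B, ∀ p, ‖τ p‖ ≤ B) (f g : 𝓢(Rn n, ℂ)) :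
    Integrable fun p : Rn n × Rn n => τ p * (f p.1 * g p.2) := by
  obtain ⟨B, hB⟩ := hb
  exact (f.integrable.mul_prod g.integrable).bdd_mul hm.aestronglyMeasurable
    (Filter.Eventually.of_forall hB)

theorem FormBound.mono {τ : Rn n × Rn n → ℂ} {A A' : ℝ} (h : FormBound τ A) (hA : A ≤ A') :
    FormBound τ A' :=
  ⟨h.measurable, h.bounded, h.nonneg.trans hA, fun f g a b ha hb => (h.bound f g a b ha hb).trans
    (mul_le_mul_of_nonneg_right hA (mul_nonneg ((norm_nonneg _).trans (ha 0))
      ((norm_nonneg _).trans (hb 0))))⟩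

theorem FormBound.zero : FormBound (fun _ : Rn n × Rn n => (0 : ℂ)) 0 :=
  ⟨measurable_const, ⟨0, by simp⟩, le_rfl, by simp⟩

theorem FormBound.add {τ σ : Rn n × Rn n → ℂ} {A B : ℝ} (h : FormBound τ A) (h' : FormBound σ B) :
    FormBound (fun p => τ p + σ p) (A + B) := by
  refine ⟨h.measurable.add h'.measurable, ?_, add_nonneg h.nonneg h'.nonneg,
    fun f g a b ha hb => ?_⟩
  · obtain ⟨C, hC⟩ := h.bounded
    obtain ⟨D, hD⟩ := h'.bounded
    exact ⟨C + D, fun p => (norm_add_le _ _).trans (add_le_add (hC p) (hD p))⟩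
  · simp_rw [add_mul]
    rw [integral_add (integrable_symbol_mul h.measurable h.bounded _ _)
      (integrable_symbol_mul h'.measurable h'.bounded _ _)]
    exact (norm_add_le _ _).trans (add_le_add (h.bound f g a b ha hb) (h'.bound f g a b ha hb))

theorem FormBound.sum {ι : Type*} {s : Finset ι} {τ : ι → Rn n × Rn n → ℂ} {A : ι → ℝ}
    (h : ∀ i ∈ s, FormBound (τ i) (A i)) :
    FormBound (fun p => ∑ i ∈ s, τ i p) (∑ i ∈ s, A i) := by
  classical
  induction s using Finset.induction_on with
  | empty => simpa using FormBound.zero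
  | insert i s hi ih =>
    simp_rw [Finset.sum_insert hi]
    exact (h i (Finset.mem_insert_self _ _)).add
      (ih fun j hj => h j (Finset.mem_insert_of_mem hj))

theorem FormBound.const_mul {τ : Rn n × Rn n → ℂ} {A : ℝ} (h : FormBound τ A) (c : ℂ) :
    FormBound (fun p => c * τ p) (‖c‖ * A) := by
  refine ⟨h.measurable.const_mul c, ?_, mul_nonneg (norm_nonneg _) h.nonneg,
    fun f g a b ha hb => ?_⟩
  · obtain ⟨C, hC⟩ := h.bounded
    exact ⟨‖c‖ * C, fun p => by
      rw [norm_mul]; exact mul_le_mul_of_nonneg_left (hC p) (norm_nonneg _)⟩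
  · simp_rw [mul_assoc]
    rw [integral_const_mul, norm_mul, ← mul_assoc, mul_assoc]
    exact mul_le_mul_of_nonneg_left (h.bound f g a b ha hb) (norm_nonneg _)

theorem FormBound.swap {τ : Rn n × Rn n → ℂ} {A : ℝ} (h : FormBound τ A) :
    FormBound (fun p => τ p.swap) A := by
  refine ⟨h.measurable.comp measurable_swap, h.bounded.imp fun B hB p => hB _, h.nonneg,
    fun f g a b ha hb => ?_⟩
  have e := integral_prod_swap (μ := (volume : Measure (Rn n))) (ν := (volume : Measure (Rn n)))
    fun p : Rn n × Rn n => τ p * ((𝓕 g : 𝓢(Rn n, ℂ)) p.1 * (𝓕 f : 𝓢(Rn n, ℂ)) p.2)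
  have e2 : ∫ p : Rn n × Rn n, τ p.swap * ((𝓕 f : 𝓢(Rn n, ℂ)) p.1 * (𝓕 g : 𝓢(Rn n, ℂ)) p.2) =
      ∫ p : Rn n × Rn n, τ p * ((𝓕 g : 𝓢(Rn n, ℂ)) p.1 * (𝓕 f : 𝓢(Rn n, ℂ)) p.2) := by
    refine Eq.trans (integral_congr_ae (Filter.Eventually.of_forall fun p => ?_)) e
    simp only [Prod.fst_swap, Prod.snd_swap]
    ring
  rw [e2, mul_comm a b]
  exact h.bound g f b a hb ha

theorem FormBound.of_tendsto {τ : ℕ → Rn n × Rn n → ℂ} {σ : Rn n × Rn n → ℂ} {A B : ℝ}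
    (h : ∀ j, FormBound (τ j) A) (hB : ∀ j p, ‖τ j p‖ ≤ B)
    (hlim : ∀ p, Filter.Tendsto (fun j => τ j p) Filter.atTop (nhds (σ p))) : FormBound σ A := by
  have hσB : ∀ p, ‖σ p‖ ≤ B := fun p =>
    le_of_tendsto (hlim p).norm (Filter.Eventually.of_forall fun j => hB j p)
  refine ⟨measurable_of_tendsto_metrizable (fun j => (h j).measurable) (tendsto_pi_nhds.2 hlim),
    ⟨B, hσB⟩, (h 0).nonneg, fun f g a b ha hb => ?_⟩
  have ht := tendsto_integral_of_dominated_convergence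
    (F := fun j (p : Rn n × Rn n) => τ j p * ((𝓕 f : 𝓢(Rn n, ℂ)) p.1 * (𝓕 g : 𝓢(Rn n, ℂ)) p.2))
    (f := fun p => σ p * ((𝓕 f : 𝓢(Rn n, ℂ)) p.1 * (𝓕 g : 𝓢(Rn n, ℂ)) p.2)) (μ := volume)
    (fun p => B * ‖(𝓕 f : 𝓢(Rn n, ℂ)) p.1 * (𝓕 g : 𝓢(Rn n, ℂ)) p.2‖)
    (fun j => (integrable_symbol_mul (h j).measurable (h j).bounded _ _).aestronglyMeasurable)
    (((𝓕 f).integrable.mul_prod (𝓕 g).integrable).norm.const_mul B)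
    (fun j => Filter.Eventually.of_forall fun p => by
      rw [norm_mul]; exact mul_le_mul_of_nonneg_right (hB j p) (norm_nonneg _))
    (Filter.Eventually.of_forall fun p => (hlim p).mul_const _)
  exact le_of_tendsto ht.norm (Filter.Eventually.of_forall fun j => (h j).bound f g a b ha hb)

theorem fourier_compSubConst (f : 𝓢(Rn n, ℂ)) (v ξ : Rn n) :
    (𝓕 (compSubConstCLM ℂ v f) : 𝓢(Rn n, ℂ)) ξ =
      Complex.exp ((-2 * Real.pi * inner ℝ v ξ : ℝ) * Complex.I) * (𝓕 f : 𝓢(Rn n, ℂ)) ξ := by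
  rw [fourier_coe, fourier_coe, Real.fourier_eq', Real.fourier_eq', ← integral_const_mul]
  rw [← integral_add_right_eq_self _ v]
  refine integral_congr_ae (Filter.Eventually.of_forall fun x => ?_)
  simp only [compSubConstCLM_apply, add_sub_cancel_right, smul_eq_mul]
  rw [← mul_assoc, ← Complex.exp_add]
  congr 2
  rw [inner_add_left]
  push_cast
  ring

/-- The character `(ξ, η) ↦ e^{2π i (x·ξ + y·η)}`. -/
def pairChar (x y : Rn n) (p : Rn n × Rn n) : ℂ :=
  Complex.exp ((2 * Real.pi * (inner ℝ x p.1 + inner ℝ y p.2) : ℝ) * Complex.I)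

theorem norm_pairChar (x y : Rn n) (p : Rn n × Rn n) : ‖pairChar x y p‖ = 1 :=
  Complex.norm_exp_ofReal_mul_I _

theorem continuous_pairChar :
    Continuous fun q : (Rn n × Rn n) × (Rn n × Rn n) => pairChar q.1.1 q.1.2 q.2 := by
  unfold pairChar
  fun_prop

/-- Multiplying the symbol by a character translates `f` and `g`, which preserves sup norms. Hence a
bound at the origin is a bound at every point, and characters cost nothing. -/
theorem FormBound.pairChar_bound {τ : Rn n × Rn n → ℂ} {A : ℝ} (h : FormBound τ A) (x y : Rn n)
    (f g : 𝓢(Rn n, ℂ)) (a b : ℝ) (ha : ∀ x, ‖f x‖ ≤ a) (hb : ∀ x, ‖g x‖ ≤ b) :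
    ‖∫ p : Rn n × Rn n, pairChar x y p *
      (τ p * ((𝓕 f : 𝓢(Rn n, ℂ)) p.1 * (𝓕 g : 𝓢(Rn n, ℂ)) p.2))‖ ≤ A * (a * b) := by
  have := h.bound (compSubConstCLM ℂ (-x) f) (compSubConstCLM ℂ (-y) g) a b
    (fun z => by rw [compSubConstCLM_apply]; exact ha _)
    (fun z => by rw [compSubConstCLM_apply]; exact hb _)
  refine le_trans (le_of_eq ?_) this
  congr 1
  refine integral_congr_ae (Filter.Eventually.of_forall fun p => ?_)
  simp only [fourier_compSubConst, pairChar]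
  have e : Complex.exp ((2 * Real.pi * (inner ℝ x p.1 + inner ℝ y p.2) : ℝ) * Complex.I) =
      Complex.exp ((-2 * Real.pi * inner ℝ (-x) p.1 : ℝ) * Complex.I) *
      Complex.exp ((-2 * Real.pi * inner ℝ (-y) p.2 : ℝ) * Complex.I) := by
    rw [← Complex.exp_add, inner_neg_left, inner_neg_left]
    congr 1
    push_cast
    ring
  rw [e]
  ring

/-- Multiplication of the symbol by an absolutely convergent superposition of characters. -/
theorem FormBound.superposition {Ω : Type*} [MeasurableSpace Ω] {μ : Measure Ω} [SFinite μ]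
    {u : Ω → ℂ} (hu : Integrable u μ) {X Y : Ω → Rn n} (hX : Measurable X) (hY : Measurable Y)
    {h : Rn n × Rn n → ℂ} (hm : Measurable h)
    (hh : ∀ p, h p = ∫ t, u t * pairChar (X t) (Y t) p ∂μ) {τ : Rn n × Rn n → ℂ} {A c : ℝ}
    (hc : ∫ t, ‖u t‖ ∂μ ≤ c) (hτ : FormBound τ A) : FormBound (fun p => h p * τ p) (c * A) := by
  have hc0 : 0 ≤ c := (integral_nonneg fun t => norm_nonneg _).trans hc
  have hle : ∀ p, ‖h p‖ ≤ c := fun p => by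
    rw [hh]
    refine (norm_integral_le_integral_norm _).trans (le_trans (le_of_eq ?_) hc)
    simp_rw [norm_mul, norm_pairChar, mul_one]
  refine ⟨hm.mul hτ.measurable, ?_, mul_nonneg hc0 hτ.nonneg, fun f g a b ha hb => ?_⟩
  · obtain ⟨B, hB⟩ := hτ.bounded
    exact ⟨c * B, fun p => by
      rw [norm_mul]; exact mul_le_mul (hle p) (hB p) (norm_nonneg _) hc0⟩
  · set T : Rn n × Rn n → ℂ := fun p => τ p * ((𝓕 f : 𝓢(Rn n, ℂ)) p.1 * (𝓕 g : 𝓢(Rn n, ℂ)) p.2)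
      with hT
    have hTi : Integrable T := integrable_symbol_mul hτ.measurable hτ.bounded _ _
    have hmc : Measurable fun q : (Rn n × Rn n) × Ω => pairChar (X q.2) (Y q.2) q.1 := by
      unfold pairChar
      fun_prop
    have hint : Integrable (Function.uncurry fun (p : Rn n × Rn n) (t : Ω) =>
        pairChar (X t) (Y t) p * (T p * u t)) (volume.prod μ) :=
      Integrable.bdd_mul (c := 1) (hTi.mul_prod hu) hmc.aestronglyMeasurable
        (Filter.Eventually.of_forall fun q => (norm_pairChar _ _ _).le)
    have e : ∫ p, h p * τ p * ((𝓕 f : 𝓢(Rn n, ℂ)) p.1 * (𝓕 g : 𝓢(Rn n, ℂ)) p.2) =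
        ∫ t, u t * (∫ p, pairChar (X t) (Y t) p * T p) ∂μ := by
      have e1 : ∀ p, h p * τ p * ((𝓕 f : 𝓢(Rn n, ℂ)) p.1 * (𝓕 g : 𝓢(Rn n, ℂ)) p.2) =
          ∫ t, pairChar (X t) (Y t) p * (T p * u t) ∂μ := fun p => by
        rw [hh, mul_assoc, ← integral_mul_const]
        refine integral_congr_ae (Filter.Eventually.of_forall fun t => ?_)
        simp only [hT]
        ring
      simp_rw [e1]
      rw [integral_integral_swap hint]
      refine integral_congr_ae (Filter.Eventually.of_forall fun t => ?_)
      simp only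
      rw [← integral_const_mul]
      refine integral_congr_ae (Filter.Eventually.of_forall fun p => ?_)
      simp only
      ring
    rw [e]
    have hab : 0 ≤ a * b := mul_nonneg ((norm_nonneg _).trans (ha 0)) ((norm_nonneg _).trans (hb 0))
    calc ‖∫ t, u t * (∫ p, pairChar (X t) (Y t) p * T p) ∂μ‖
        ≤ ∫ t, ‖u t‖ * (A * (a * b)) ∂μ := by
          refine norm_integral_le_of_norm_le (hu.norm.mul_const _)
            (Filter.Eventually.of_forall fun t => ?_)
          rw [norm_mul]
          exact mul_le_mul_of_nonneg_left (hτ.pairChar_bound _ _ f g a b ha hb) (norm_nonneg _)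
      _ = (∫ t, ‖u t‖ ∂μ) * (A * (a * b)) := integral_mul_const _ _
      _ ≤ c * (A * (a * b)) :=
          mul_le_mul_of_nonneg_right hc (mul_nonneg hτ.nonneg hab)
      _ = _ := by ring

theorem fourierInv_apply_eq_integral (f : 𝓢(Rn n, ℂ)) (x : Rn n) :
    (𝓕⁻ f : 𝓢(Rn n, ℂ)) x =
      ∫ ξ, Complex.exp ((2 * Real.pi * inner ℝ ξ x : ℝ) * Complex.I) * f ξ := by
  rw [fourierInv_coe, Real.fourierInv_eq']
  rfl

/-- Insert Fourier inversion for `m` at `ξ + η`: the character splits into factors in `ξ` and `η`,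
and Fubini leaves the product of two inverse transforms. -/
theorem integral_trilinear (A B m : 𝓢(Rn n, ℂ)) :
    ∫ p : Rn n × Rn n, m (p.1 + p.2) * (A p.1 * B p.2) =
      ∫ x, (𝓕 m : 𝓢(Rn n, ℂ)) x * ((𝓕⁻ A : 𝓢(Rn n, ℂ)) x * (𝓕⁻ B : 𝓢(Rn n, ℂ)) x) := by
  set k : 𝓢(Rn n, ℂ) := 𝓕 m with hk
  have hm : ∀ ζ, m ζ = ∫ x, Complex.exp ((2 * Real.pi * inner ℝ x ζ : ℝ) * Complex.I) * k x :=
    fun ζ => by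
      rw [← fourierInv_apply_eq_integral, hk, FourierTransform.fourierInv_fourier_eq]
  have hint : Integrable (Function.uncurry fun (p : Rn n × Rn n) (x : Rn n) =>
      pairChar x x p * (A p.1 * B p.2 * k x)) := by
    refine Integrable.bdd_mul (c := 1)
      (((A.integrable.mul_prod B.integrable)).mul_prod k.integrable) ?_
      (Filter.Eventually.of_forall fun q => (norm_pairChar _ _ _).le)
    exact (continuous_pairChar.measurable.comp
      ((measurable_snd.prodMk measurable_snd).prodMk measurable_fst)).aestronglyMeasurable
  have e1 : ∀ p : Rn n × Rn n, m (p.1 + p.2) * (A p.1 * B p.2) =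
      ∫ x, pairChar x x p * (A p.1 * B p.2 * k x) := fun p => by
    rw [hm, ← integral_mul_const]
    refine integral_congr_ae (Filter.Eventually.of_forall fun x => ?_)
    simp only [pairChar, inner_add_right]
    ring
  simp_rw [e1]
  rw [integral_integral_swap hint]
  refine integral_congr_ae (Filter.Eventually.of_forall fun x => ?_)
  simp only
  rw [fourierInv_apply_eq_integral, fourierInv_apply_eq_integral,
    ← integral_prod_mul (μ := volume) (ν := volume), ← integral_const_mul]
  refine integral_congr_ae (Filter.Eventually.of_forall fun p => ?_)
  have e : pairChar x x p = Complex.exp ((2 * Real.pi * inner ℝ p.1 x : ℝ) * Complex.I) *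
      Complex.exp ((2 * Real.pi * inner ℝ p.2 x : ℝ) * Complex.I) := by
    rw [pairChar, ← Complex.exp_add, real_inner_comm p.1 x, real_inner_comm p.2 x]
    congr 1
    push_cast
    ring
  simp only [e]
  ring

/-- The main bilinear estimate: a pointwise weighted bound for the kernel of the output multiplier
against weighted `L²` bounds for the input multipliers. -/
theorem formBound_of_weighted_kernel {m₁ m₂ : Rn n → ℂ} {R₁ R₂ b₁ b₂ K : ℝ} (hR₁ : 0 < R₁)
    (hR₂ : 0 < R₂) (hb₁ : 0 ≤ b₁) (hb₂ : 0 ≤ b₂) (hK : 0 ≤ K) (hm₁ : m₁.HasTemperateGrowth)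
    (hm₂ : m₂.HasTemperateGrowth)
    (h₁ : ∀ k ≤ n, ∀ ξ, ‖iteratedFDeriv ℝ k m₁ ξ‖ ≤ b₁ * R₁ ^ k)
    (h₂ : ∀ k ≤ n, ∀ ξ, ‖iteratedFDeriv ℝ k m₂ ξ‖ ≤ b₂ * R₂ ^ k)
    (m₃ : 𝓢(Rn n, ℂ))
    (h₃ : ∀ x, ‖(𝓕 m₃ : 𝓢(Rn n, ℂ)) x‖ * (‖weight R₁ x‖ * ‖weight R₂ x‖) ≤ K) :
    FormBound (fun p => m₁ p.1 * m₂ p.2 * m₃ (p.1 + p.2))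
      (K * (2 ^ n * b₁ * R₁ ^ ((n : ℝ) / 2)) * (2 ^ n * b₂ * R₂ ^ ((n : ℝ) / 2))) := by
  have hc₁ := hm₁.1.continuous
  have hc₂ := hm₂.1.continuous
  have hc₃ := m₃.continuous
  refine ⟨Continuous.measurable (by fun_prop), ?_, by positivity, fun f g a b ha hb => ?_⟩
  · obtain ⟨C, hC⟩ : ∃ C, ∀ ξ, ‖m₃ ξ‖ ≤ C := ⟨_, m₃.norm_le_seminorm ℝ⟩
    refine ⟨b₁ * b₂ * C, fun p => ?_⟩
    rw [norm_mul, norm_mul]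
    have e1 : ‖m₁ p.1‖ ≤ b₁ := by simpa using h₁ 0 (Nat.zero_le _) p.1
    have e2 : ‖m₂ p.2‖ ≤ b₂ := by simpa using h₂ 0 (Nat.zero_le _) p.2
    gcongr
    exact hC _
  · have ha0 : 0 ≤ a := (norm_nonneg _).trans (ha 0)
    have hb0 : 0 ≤ b := (norm_nonneg _).trans (hb 0)
    have hW : ∀ (R : ℝ) (x : Rn n), weight R x ≠ 0 := fun R x => weightList_ne_zero R _ x
    have hcW : ∀ R : ℝ, Continuous fun x : Rn n => (weight R x)⁻¹ := fun R =>
      (hasTemperateGrowth_weightList_inv R _).1.continuous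
    set S₁ := fourierMultiplierCLM ℂ m₁ f with hS₁
    set S₂ := fourierMultiplierCLM ℂ m₂ g with hS₂
    set u₁ : Rn n → ℂ := fun x => (weight R₁ x)⁻¹ * S₁ x with hu₁
    set u₂ : Rn n → ℂ := fun x => (weight R₂ x)⁻¹ * S₂ x with hu₂
    have e : ∫ p : Rn n × Rn n, m₁ p.1 * m₂ p.2 * m₃ (p.1 + p.2) *
        ((𝓕 f : 𝓢(Rn n, ℂ)) p.1 * (𝓕 g : 𝓢(Rn n, ℂ)) p.2) =
        ∫ x, (𝓕 m₃ : 𝓢(Rn n, ℂ)) x * (S₁ x * S₂ x) := by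
      rw [hS₁, hS₂, fourierMultiplierCLM_apply, fourierMultiplierCLM_apply, ← integral_trilinear]
      refine integral_congr_ae (Filter.Eventually.of_forall fun p => ?_)
      simp only [smulLeftCLM_apply_apply hm₁, smulLeftCLM_apply_apply hm₂, smul_eq_mul]
      ring
    rw [e]
    -- Kernel decay pays for both weights, so the two inputs may be measured in the corresponding
    -- inversely weighted norms.
    have hpt : ∀ x, ‖(𝓕 m₃ : 𝓢(Rn n, ℂ)) x * (S₁ x * S₂ x)‖ ≤ K * ‖u₁ x * u₂ x‖ := by
      intro x
      have e2 : (𝓕 m₃ : 𝓢(Rn n, ℂ)) x * (S₁ x * S₂ x) =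
          ((𝓕 m₃ : 𝓢(Rn n, ℂ)) x * (weight R₁ x * weight R₂ x)) * (u₁ x * u₂ x) := by
        simp only [hu₁, hu₂]
        have := hW R₁ x
        have := hW R₂ x
        field_simp
      rw [e2, norm_mul]
      refine mul_le_mul_of_nonneg_right ?_ (norm_nonneg _)
      rw [norm_mul, norm_mul]
      exact h₃ x
    have hcu₁ : Continuous u₁ := (hcW R₁).mul S₁.continuous
    have hcu₂ : Continuous u₂ := (hcW R₂).mul S₂.continuous
    -- Cauchy-Schwarz, as Hölder with exponents `2, 2, 1`.
    have hL : eLpNorm (fun x => u₁ x * u₂ x) 1 volume ≤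
        ENNReal.ofReal (2 ^ n * b₁ * a * R₁ ^ ((n : ℝ) / 2)) *
          ENNReal.ofReal (2 ^ n * b₂ * b * R₂ ^ ((n : ℝ) / 2)) := by
      have := eLpNorm_smul_le_mul_eLpNorm (p := 2) (q := 2) (r := 1) (μ := volume)
        hcu₂.aestronglyMeasurable hcu₁.aestronglyMeasurable
      exact this.trans (mul_le_mul'
        (eLpNorm_weight_inv_fourierMultiplier hR₁ hb₁ hm₁ h₁ f ha)
        (eLpNorm_weight_inv_fourierMultiplier hR₂ hb₂ hm₂ h₂ g hb))
    have hfin : eLpNorm (fun x => u₁ x * u₂ x) 1 volume ≠ ⊤ :=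
      (hL.trans_lt (ENNReal.mul_lt_top ENNReal.ofReal_lt_top ENNReal.ofReal_lt_top)).ne
    have hiu : Integrable fun x => u₁ x * u₂ x :=
      memLp_one_iff_integrable.1 ⟨(hcu₁.mul hcu₂).aestronglyMeasurable, hfin.lt_top⟩
    have hI : ∫ x, ‖u₁ x * u₂ x‖ ≤ 2 ^ n * b₁ * a * R₁ ^ ((n : ℝ) / 2) *
        (2 ^ n * b₂ * b * R₂ ^ ((n : ℝ) / 2)) := by
      rw [integral_norm_eq_lintegral_enorm hiu.aestronglyMeasurable, ← eLpNorm_one_eq_lintegral_enorm]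
      refine ENNReal.toReal_le_of_le_ofReal (by positivity) (hL.trans (le_of_eq ?_))
      rw [← ENNReal.ofReal_mul (by positivity)]
    calc _ ≤ ∫ x, K * ‖u₁ x * u₂ x‖ :=
          norm_integral_le_of_norm_le (hiu.norm.const_mul K) (Filter.Eventually.of_forall hpt)
      _ = K * ∫ x, ‖u₁ x * u₂ x‖ := integral_const_mul _ _
      _ ≤ K * (2 ^ n * b₁ * a * R₁ ^ ((n : ℝ) / 2) *
        (2 ^ n * b₂ * b * R₂ ^ ((n : ℝ) / 2))) := mul_le_mul_of_nonneg_left hI hK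
      _ = _ := by ring

end FormBound

/-! ### Integrability of Fourier transforms. -/

section Wiener

variable {V : Type*} [NormedAddCommGroup V] [InnerProductSpace ℝ V] [FiniteDimensional ℝ V]
  [MeasurableSpace V] [BorelSpace V]

theorem integrable_of_tsupport_subset_ball {F : Type*} [NormedAddCommGroup F] {M : ℝ} {g : V → F}
    (hg : Continuous g) (hs : tsupport g ⊆ Metric.closedBall 0 M) : Integrable g :=
  hg.integrable_of_hasCompactSupport (hasCompactSupport_of_tsupport_subset_ball hs)

/-- Uniform decay of the Fourier transforms of a bounded family of test functions. -/
theorem exists_fourier_decay {H : Type*} {A : H → V → ℂ} {M : ℝ}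
    (hA : BddDerivs Set.univ (fun _ => 1) A) (hs : ∀ h, tsupport (A h) ⊆ Metric.closedBall 0 M)
    (N : ℕ) : ∃ C : ℝ, 0 ≤ C ∧ ∀ h x, (1 + ‖x‖) ^ N * ‖𝓕 (A h) x‖ ≤ C := by
  obtain ⟨C, hC1, hC⟩ := hA.exists_pos (fun _ => zero_le_one) N
  set v := (volume (Metric.closedBall (0 : V) M)).toReal with hv
  have hsup : ∀ h (k : ℕ), tsupport (iteratedFDeriv ℝ k (A h)) ⊆ Metric.closedBall 0 M :=
    fun h k => (tsupport_iteratedFDeriv_subset k).trans (hs h)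
  have hi : ∀ h (k : ℕ), Integrable (iteratedFDeriv ℝ k (A h)) := fun h k =>
    integrable_of_tsupport_subset_ball
      ((hA.1 h).continuous_iteratedFDeriv (by exact_mod_cast le_top)) (hsup h k)
  have hnorm : ∀ h, ∀ k ≤ N, ∫ x, ‖iteratedFDeriv ℝ k (A h) x‖ ≤ C * v := fun h k hk => by
    rw [← setIntegral_eq_integral_of_forall_compl_eq_zero (s := Metric.closedBall (0 : V) M)
      fun x hx => by rw [image_eq_zero_of_notMem_tsupport fun hx' => hx (hsup h k hx'), norm_zero]]
    refine (Real.le_norm_self _).trans (norm_setIntegral_le_of_norm_le_const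
      (isCompact_closedBall _ _).measure_lt_top fun x _ => ?_)
    have := hC k hk h x (Set.mem_univ _)
    simpa using this
  have key : ∀ h x, ∀ k ≤ N, ‖x‖ ^ k * ‖𝓕 (A h) x‖ ≤ 2 ^ k * ((k + 1) * (C * v)) := by
    intro h x k hk
    have := Real.pow_mul_norm_iteratedFDeriv_fourier_le (f := A h) (K := 0) (N := N)
      ((hA.1 h).of_le (by exact_mod_cast le_top)) (fun a b ha hb => by
        obtain rfl : a = 0 := by simpa using ha
        simpa using (hi h b).norm) (k := 0) (n := k) le_rfl (by exact_mod_cast hk) x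
    simp only [norm_iteratedFDeriv_zero, pow_zero, one_mul, Nat.cast_zero, mul_zero, zero_add,
      Finset.range_one, Finset.singleton_product, Finset.sum_map, Function.Embedding.coeFn_mk]
      at this
    refine this.trans (mul_le_mul_of_nonneg_left ?_ (by positivity))
    refine (Finset.sum_le_sum fun i hi' => hnorm h i ?_).trans (le_of_eq ?_)
    · have := Finset.mem_range.1 hi'; omega
    · rw [Finset.sum_const, Finset.card_range, nsmul_eq_mul]; push_cast; ring
  have hv0 : 0 ≤ v := ENNReal.toReal_nonneg
  refine ⟨∑ k ∈ Finset.range (N + 1), 2 ^ k * ((k + 1) * (C * v)) * N.choose k,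
    Finset.sum_nonneg fun k _ => by positivity, fun h x => ?_⟩
  rw [add_comm, add_pow, Finset.sum_mul]
  refine Finset.sum_le_sum fun k hk => ?_
  have := key h x k (by have := Finset.mem_range.1 hk; omega)
  calc _ = ‖x‖ ^ k * ‖𝓕 (A h) x‖ * N.choose k := by rw [one_pow]; ring
    _ ≤ _ := mul_le_mul_of_nonneg_right this (by positivity)

theorem continuous_fourier {g : V → ℂ} (hg : Integrable g) : Continuous (𝓕 g) :=
  VectorFourier.fourierIntegral_continuous Real.continuous_fourierChar continuous_inner hg

/-- An integrable function controlled by `B (1 + |x| / R)^{-(d + 1)}` has `L¹` norm `O(B R ^ d)`. -/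
theorem exists_integral_norm_le_of_decay (V : Type*) [NormedAddCommGroup V] [InnerProductSpace ℝ V]
    [FiniteDimensional ℝ V] [MeasurableSpace V] [BorelSpace V] :
    ∃ C : ℝ, 0 ≤ C ∧ ∀ (g : V → ℂ) (B R : ℝ), 0 < R → AEStronglyMeasurable g volume →
      (∀ x, (1 + ‖x‖ / R) ^ (Module.finrank ℝ V + 1) * ‖g x‖ ≤ B) →
      Integrable g ∧ ∫ x, ‖g x‖ ≤ C * (B * R ^ Module.finrank ℝ V) := by
  set d := Module.finrank ℝ V with hd
  have hI : Integrable fun x : V => (1 + ‖x‖) ^ (-((d + 1 : ℕ) : ℝ)) :=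
    integrable_one_add_norm (by push_cast; linarith)
  refine ⟨∫ x : V, (1 + ‖x‖) ^ (-((d + 1 : ℕ) : ℝ)), integral_nonneg fun x => by positivity,
    fun g B R hR hg h => ?_⟩
  have hle : ∀ x, ‖g x‖ ≤ B * (1 + ‖R⁻¹ • x‖) ^ (-((d + 1 : ℕ) : ℝ)) := fun x => by
    rw [norm_smul, norm_inv, Real.norm_of_nonneg hR.le, inv_mul_eq_div, Real.rpow_neg (by positivity),
      Real.rpow_natCast, ← div_eq_mul_inv, le_div_iff₀ (by positivity), mul_comm]
    exact h x
  have hI2 : Integrable fun x : V => B * (1 + ‖R⁻¹ • x‖) ^ (-((d + 1 : ℕ) : ℝ)) :=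
    (hI.comp_smul (inv_ne_zero hR.ne')).const_mul B
  refine ⟨hI2.mono' hg (Filter.Eventually.of_forall hle), ?_⟩
  refine (integral_mono_of_nonneg (Filter.Eventually.of_forall fun _ => norm_nonneg _) hI2
    (Filter.Eventually.of_forall hle)).trans (le_of_eq ?_)
  rw [integral_const_mul, Measure.integral_comp_smul volume
    (fun x : V => (1 + ‖x‖) ^ (-((d + 1 : ℕ) : ℝ))) R⁻¹, inv_pow, inv_inv,
    abs_of_pos (by positivity), smul_eq_mul]
  ring

theorem exists_integral_fourier_le {H : Type*} {A : H → V → ℂ} {M : ℝ}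
    (hA : BddDerivs Set.univ (fun _ => 1) A) (hs : ∀ h, tsupport (A h) ⊆ Metric.closedBall 0 M) :
    ∃ C : ℝ, 0 ≤ C ∧ ∀ h, Integrable (𝓕 (A h)) ∧ ∫ x, ‖𝓕 (A h) x‖ ≤ C := by
  obtain ⟨C, hC0, hC⟩ := exists_fourier_decay hA hs (Module.finrank ℝ V + 1)
  obtain ⟨D, hD0, hD⟩ := exists_integral_norm_le_of_decay V
  refine ⟨D * C, by positivity, fun h => ?_⟩
  have := hD (𝓕 (A h)) C 1 one_pos (continuous_fourier
    (integrable_of_tsupport_subset_ball (hA.1 h).continuous (hs h))).aestronglyMeasurable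
    (by simpa using hC h)
  simpa using this

end Wiener

/-! ### Multipliers with integrable kernel, and the low frequency part. -/

section Multipliers

variable {n : ℕ}

/-- `h` can be inserted in any frequency variable `a ξ + b η` at the cost of a factor `c`. -/
structure IsMult (h : Rn n → ℂ) (c : ℝ) : Prop where
  nonneg : 0 ≤ c
  measurable : Measurable h
  norm_le : ∀ ξ, ‖h ξ‖ ≤ c
  mul : ∀ (a b : ℝ) {τ : Rn n × Rn n → ℂ} {A : ℝ}, FormBound τ A →
    FormBound (fun p => h (a • p.1 + b • p.2) * τ p) (c * A)

theorem IsMult.mono {h : Rn n → ℂ} {c c' : ℝ} (hh : IsMult h c) (hc : c ≤ c') : IsMult h c' :=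
  ⟨hh.nonneg.trans hc, hh.measurable, fun ξ => (hh.norm_le ξ).trans hc, fun a b _ _ hτ =>
    (hh.mul a b hτ).mono (mul_le_mul_of_nonneg_right hc hτ.nonneg)⟩

theorem IsMult.fst {h : Rn n → ℂ} {c : ℝ} (hh : IsMult h c) {τ : Rn n × Rn n → ℂ} {A : ℝ}
    (hτ : FormBound τ A) : FormBound (fun p => h p.1 * τ p) (c * A) := by
  simpa using hh.mul 1 0 hτ

theorem IsMult.snd {h : Rn n → ℂ} {c : ℝ} (hh : IsMult h c) {τ : Rn n × Rn n → ℂ} {A : ℝ}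
    (hτ : FormBound τ A) : FormBound (fun p => h p.2 * τ p) (c * A) := by
  simpa using hh.mul 0 1 hτ

theorem IsMult.output {h : Rn n → ℂ} {c : ℝ} (hh : IsMult h c) {τ : Rn n × Rn n → ℂ} {A : ℝ}
    (hτ : FormBound τ A) : FormBound (fun p => h (p.1 + p.2) * τ p) (c * A) := by
  simpa using hh.mul 1 1 hτ

/-- A dilation is absorbed by the quantified coefficients `a` and `b`, so all dilates have the same
cost. -/
theorem IsMult.comp_smul {h : Rn n → ℂ} {c : ℝ} (hh : IsMult h c) (r : ℝ) :
    IsMult (fun ξ => h (r • ξ)) c :=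
  ⟨hh.nonneg, hh.measurable.comp (measurable_const_smul r), fun ξ => hh.norm_le _,
    fun a b _ _ hτ => by simpa only [smul_add, smul_smul] using hh.mul (r * a) (r * b) hτ⟩

theorem IsMult.zero : IsMult (fun _ : Rn n => (0 : ℂ)) 0 :=
  ⟨le_rfl, measurable_const, by simp, fun _ _ _ _ _ => by simpa using FormBound.zero⟩

theorem IsMult.add {h k : Rn n → ℂ} {c d : ℝ} (hh : IsMult h c) (hk : IsMult k d) :
    IsMult (fun ξ => h ξ + k ξ) (c + d) :=
  ⟨add_nonneg hh.nonneg hk.nonneg, hh.measurable.add hk.measurable, fun ξ =>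
    (norm_add_le _ _).trans (add_le_add (hh.norm_le _) (hk.norm_le _)), fun a b _ _ hτ => by
    simpa only [add_mul] using (hh.mul a b hτ).add (hk.mul a b hτ)⟩

theorem IsMult.sum {ι : Type*} {s : Finset ι} {h : ι → Rn n → ℂ} {c : ι → ℝ}
    (hh : ∀ i ∈ s, IsMult (h i) (c i)) : IsMult (fun ξ => ∑ i ∈ s, h i ξ) (∑ i ∈ s, c i) := by
  classical
  induction s using Finset.induction_on with
  | empty => simpa using IsMult.zero
  | insert i s hi ih =>
    simp_rw [Finset.sum_insert hi]
    exact (hh i (Finset.mem_insert_self _ _)).add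
      (ih fun j hj => hh j (Finset.mem_insert_of_mem hj))

theorem IsMult.of_tendsto {h : ℕ → Rn n → ℂ} {k : Rn n → ℂ} {c : ℝ} (hh : ∀ j, IsMult (h j) c)
    (hlim : ∀ ξ, Filter.Tendsto (fun j => h j ξ) Filter.atTop (nhds (k ξ))) : IsMult k c := by
  refine ⟨(hh 0).nonneg, measurable_of_tendsto_metrizable (fun j => (hh j).measurable)
    (tendsto_pi_nhds.2 hlim), fun ξ => le_of_tendsto (hlim ξ).norm
    (Filter.Eventually.of_forall fun j => (hh j).norm_le ξ), fun a b τ A hτ => ?_⟩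
  obtain ⟨B, hB⟩ := hτ.bounded
  refine FormBound.of_tendsto (B := c * B) (fun j => (hh j).mul a b hτ) (fun j p => ?_)
    fun p => (hlim _).mul_const _
  rw [norm_mul]
  exact mul_le_mul ((hh j).norm_le _) (hB p) (norm_nonneg _) (hh 0).nonneg

/-- Inversion exhibits `h(aξ + bη)` as a superposition of the characters with parameters `(a x, b
x)`, weighted by the transform of `h`. The total mass does not depend on `a` and `b`. -/
theorem IsMult.of_fourier {h : Rn n → ℂ} {c : ℝ} (hc : Continuous h) (hi : Integrable h)
    (hF : Integrable (𝓕 h)) (hle : ∫ x, ‖𝓕 h x‖ ≤ c) : IsMult h c := by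
  have hinv : ∀ ξ, h ξ = ∫ x, 𝓕 h x * Complex.exp ((2 * Real.pi * inner ℝ x ξ : ℝ) * Complex.I) := by
    intro ξ
    conv_lhs => rw [← hc.fourierInv_fourier_eq hi hF, Real.fourierInv_eq']
    simp_rw [smul_eq_mul, mul_comm (𝓕 h _)]
  refine ⟨(integral_nonneg fun _ => norm_nonneg _).trans hle, hc.measurable, fun ξ => ?_,
    fun a b τ A hτ => ?_⟩
  · rw [hinv]
    refine (norm_integral_le_integral_norm _).trans (le_trans (le_of_eq ?_) hle)
    simp_rw [norm_mul, Complex.norm_exp_ofReal_mul_I, mul_one]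
  · refine FormBound.superposition hF (X := fun x => a • x) (Y := fun x => b • x) (by fun_prop)
      (by fun_prop) (by fun_prop) (fun p => ?_) hle hτ
    rw [hinv]
    refine integral_congr_ae (Filter.Eventually.of_forall fun x => ?_)
    simp only [pairChar, inner_add_right, inner_smul_left, inner_smul_right, conj_trivial]

theorem exists_isMult_of_bddDerivs {H : Type*} {A : H → Rn n → ℂ} {M : ℝ}
    (hA : BddDerivs Set.univ (fun _ => 1) A) (hs : ∀ h, tsupport (A h) ⊆ Metric.closedBall 0 M) :
    ∃ C : ℝ, ∀ h, IsMult (A h) C := by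
  obtain ⟨C, -, hC⟩ := exists_integral_fourier_le hA hs
  exact ⟨C, fun h => IsMult.of_fourier (hA.1 h).continuous
    (integrable_of_tsupport_subset_ball (hA.1 h).continuous (hs h)) (hC h).1 (hC h).2⟩

/-- The kernel has height `2^{kn(1-s/2)}` on a ball of radius `2^{k(s-1)}`, hence `L¹` norm
`O(2^{kns/2})`. -/
theorem exists_isMult_dyadicPiece {c s : ℝ} (hc : 0 < c) (hs0 : 0 < s) (hs1 : s ≠ 1) :
    ∃ C : ℝ, 0 ≤ C ∧ ∀ k : ℕ,
      IsMult (dyadicPiece c s k : Rn n → ℂ) (C * (2 : ℝ) ^ (k * n * s / 2)) := by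
  obtain ⟨C, hC0, hC⟩ := exists_fourier_dyadicPiece_bound (E := Rn n) hc hs0 hs1 (n + 1)
  obtain ⟨D, hD0, hD⟩ := exists_integral_norm_le_of_decay (Rn n)
  simp only [finrank_euclideanSpace, Fintype.card_fin] at hC hD
  refine ⟨D * C, by positivity, fun k => ?_⟩
  have hcont := (contDiff_dyadicPiece (E := Rn n) hc hs0 hs1 k).continuous
  have hint := hcont.integrable_of_hasCompactSupport (μ := volume)
    (hasCompactSupport_dyadicPiece c s k)
  have h2 := hD _ _ _ (Real.rpow_pos_of_pos two_pos (k * (s - 1)))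
    (continuous_fourier hint).aestronglyMeasurable (hC k)
  refine IsMult.of_fourier hcont hint h2.1 (h2.2.trans (le_of_eq ?_))
  have e : (2 : ℝ) ^ (k * n * s / 2) = 2 ^ (k * n * (1 - s / 2)) * (2 ^ (k * (s - 1))) ^ n := by
    rw [← Real.rpow_natCast (_ ^ _), ← Real.rpow_mul two_pos.le, ← Real.rpow_add two_pos]
    congr 1
    ring
  rw [e]
  ring

/-- A smooth function `g` with `e^{iy} - 1 = y g(y)`. -/
theorem exists_contDiff_cexp_sub_one : ∃ g : ℝ → ℂ, ContDiff ℝ ∞ g ∧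
    ∀ y : ℝ, Complex.exp (Complex.I * y) - 1 = y * g y := by
  set f : ℂ → ℂ := fun z => Complex.exp (Complex.I * z) with hf
  have hd : Differentiable ℂ f := by fun_prop
  have hg : Differentiable ℂ (dslope f 0) := by
    rw [← differentiableOn_univ, Complex.differentiableOn_dslope Filter.univ_mem]
    exact hd.differentiableOn
  refine ⟨fun y => dslope f 0 y, (hg.contDiff.restrict_scalars ℝ).comp Complex.ofRealCLM.contDiff,
    fun y => ?_⟩
  have := sub_smul_dslope f 0 y
  simp only [hf, sub_zero, mul_zero, Complex.exp_zero, smul_eq_mul] at this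
  rw [← this]

/-- The part of `e^{i c |ξ|^s}` with bounded frequencies. -/
def lowPiece (c s : ℝ) (ξ : Rn n) : ℂ :=
  Complex.exp (Complex.I * ((c * ‖ξ‖ ^ s : ℝ) : ℂ)) * (lowBump ξ : ℝ)

/-- The phase need not be smooth at the origin, so low frequencies are also cut into shells `|ξ| ~
2^{-l}`. There the phase is `2^{-sl}` times a fixed smooth function of `2^l ξ`; subtracting one
gains the factor `2^{-sl}`, which makes the shells summable. -/
theorem exists_isMult_lowShell {c s : ℝ} (hc : 0 < c) (hs0 : 0 < s) (hs1 : s ≠ 1) :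
    ∃ C : ℝ, 0 ≤ C ∧ ∀ l : ℕ, IsMult (fun ξ : Rn n =>
      (Complex.exp (Complex.I * ((c * ‖ξ‖ ^ s : ℝ) : ℂ)) - 1) * (annBump ((2 : ℝ) ^ l • ξ) : ℝ))
      (C * ((2 : ℝ) ^ (-s)) ^ l) := by
  obtain ⟨φ, G, κ, h1, h2, -, -, -, -, -, h8⟩ := exists_smooth_phase (E := Rn n) c s hc hs0 hs1
  obtain ⟨g, hg, hgy⟩ := exists_contDiff_cexp_sub_one
  obtain ⟨M, hM⟩ := h2.exists_bound_of_continuous h1.continuous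
  have hM0 : 0 ≤ M := (norm_nonneg _).trans (hM 0)
  -- The cutoff provides bounded derivatives and is invisible on the range in use: `|t φ| ≤ M` since
  -- `t ≤ 1`.
  set g' : ℝ → ℂ := fun y => (lowBump ((M + 1)⁻¹ • y) : ℝ) • g y with hg'
  have hg's : ContDiff ℝ ∞ g' := (contDiff_lowBump.comp (contDiff_const_smul _)).smul hg
  have hg'c : HasCompactSupport g' :=
    (hasCompactSupport_lowBump.comp_smul (inv_ne_zero (by positivity))).smul_right
  set t : ℕ → ℝ := fun l => ((2 : ℝ) ^ (-s)) ^ l with ht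
  have h2s : (2 : ℝ) ^ (-s) ≤ 1 := Real.rpow_le_one_of_one_le_of_nonpos one_le_two (by linarith)
  have ht0 : ∀ l, 0 < t l := fun l => pow_pos (Real.rpow_pos_of_pos two_pos _) l
  have ht1 : ∀ l, t l ≤ 1 := fun l => pow_le_one₀ (Real.rpow_nonneg two_pos.le _) h2s
  have hw : ∀ l : ℕ, (1 : ℝ) ≤ (fun _ : ℕ => (1 : ℝ)) l := fun _ => le_rfl
  have hw0 : ∀ l : ℕ, (0 : ℝ) ≤ (fun _ : ℕ => (1 : ℝ)) l := fun _ => zero_le_one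
  have b1 : BddDerivs Set.univ (fun _ : ℕ => 1) fun l (ξ : Rn n) => g' (t l * φ ξ) := by
    refine BddDerivs.comp_left hw0 hg's (fun k => ?_) (fun l => contDiff_const.mul h1)
      fun k _ => ?_
    · obtain ⟨C, hC⟩ := (hg'c.iteratedFDeriv (𝕜 := ℝ) k).exists_bound_of_continuous
        (hg's.continuous_iteratedFDeriv (by exact_mod_cast le_top))
      exact ⟨C, hC⟩
    · obtain ⟨C, hC⟩ := (h2.iteratedFDeriv (𝕜 := ℝ) k).exists_bound_of_continuous
        (h1.continuous_iteratedFDeriv (by exact_mod_cast le_top))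
      refine ⟨C, fun l ξ _ => ?_⟩
      have e := iteratedFDeriv_const_smul_apply (𝕜 := ℝ) (i := k) (a := t l) (f := φ) (x := ξ)
        (h1.contDiffAt.of_le (by exact_mod_cast le_top))
      change ‖iteratedFDeriv ℝ k (t l • φ) ξ‖ ≤ _
      rw [e, norm_smul, Real.norm_of_nonneg (ht0 l).le, one_pow, mul_one]
      exact (mul_le_of_le_one_left (norm_nonneg _) (ht1 l)).trans (hC ξ)
  have b2 : BddDerivs Set.univ (fun _ : ℕ => 1) fun _ (ξ : Rn n) => ((φ ξ : ℝ) : ℂ) :=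
    (BddDerivs.of_hasCompactSupport hw h1 h2).clm_comp Complex.ofRealCLM
  have b3 : BddDerivs Set.univ (fun _ : ℕ => 1) fun _ (ξ : Rn n) => ((annBump ξ : ℝ) : ℂ) :=
    (BddDerivs.of_hasCompactSupport hw contDiff_annBump hasCompactSupport_annBump).clm_comp
      Complex.ofRealCLM
  have b4 := (b2.mul hw0 b1).mul hw0 b3
  obtain ⟨C, hC⟩ := exists_isMult_of_bddDerivs (M := 2) b4 fun l =>
    ((closure_mono fun ξ hξ => by
      rw [Function.mem_support] at hξ ⊢
      exact fun h => hξ (by rw [h, Complex.ofReal_zero, mul_zero])).trans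
        tsupport_annBump).trans unitAnnulus_subset
  have hC0 : 0 ≤ C := (hC 0).nonneg
  refine ⟨C, hC0, fun l => ?_⟩
  have e : (fun ξ : Rn n => (Complex.exp (Complex.I * ((c * ‖ξ‖ ^ s : ℝ) : ℂ)) - 1) *
      (annBump ((2 : ℝ) ^ l • ξ) : ℝ)) = fun ξ => (t l : ℂ) * ((φ ((2 : ℝ) ^ l • ξ) : ℝ) *
        g' (t l * φ ((2 : ℝ) ^ l • ξ)) * (annBump ((2 : ℝ) ^ l • ξ) : ℝ)) := by
    funext ξ
    by_cases hξ : (2 : ℝ) ^ l • ξ ∈ unitAnnulus (Rn n)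
    · have e1 : c * ‖ξ‖ ^ s = t l * φ ((2 : ℝ) ^ l • ξ) := by
        rw [h8 _ hξ, norm_smul, norm_pow, Real.norm_ofNat, Real.mul_rpow (by positivity)
          (norm_nonneg _), ht]
        have : (((2 : ℝ) ^ (-s)) ^ l) * ((2 : ℝ) ^ l) ^ s = 1 := by
          rw [← Real.rpow_natCast, ← Real.rpow_natCast, ← Real.rpow_mul two_pos.le,
            ← Real.rpow_mul two_pos.le, ← Real.rpow_add two_pos]
          simp [mul_comm]
        linear_combination (-c * ‖ξ‖ ^ s) * this
      have e2 : g' (t l * φ ((2 : ℝ) ^ l • ξ)) = g (t l * φ ((2 : ℝ) ^ l • ξ)) := by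
        rw [hg']
        simp only
        rw [lowBump_of_le, one_smul]
        rw [norm_smul, norm_mul, Real.norm_of_nonneg (ht0 l).le, norm_inv,
          Real.norm_of_nonneg (by positivity), inv_mul_le_iff₀ (by positivity), mul_one]
        exact (mul_le_of_le_one_left (norm_nonneg _) (ht1 l)).trans ((hM _).trans (by linarith))
      rw [e1, hgy, e2]
      push_cast
      ring
    · rw [annBump_of_notMem hξ]; simp
  rw [e]
  refine ⟨by have := ht0 l; positivity, ((hC l).comp_smul _).measurable.const_mul _, fun ξ => ?_,
    fun a b τ A hτ => ?_⟩
  · rw [norm_mul, Complex.norm_real, Real.norm_of_nonneg (ht0 l).le, mul_comm C]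
    exact mul_le_mul_of_nonneg_left ((hC l).norm_le _) (ht0 l).le
  · have := (((hC l).comp_smul (2 ^ l)).mul a b hτ).const_mul (t l : ℂ)
    rw [Complex.norm_real, Real.norm_of_nonneg (ht0 l).le] at this
    convert this using 1
    · funext p; ring
    · ring

theorem exists_isMult_lowPiece {c s : ℝ} (hc : 0 < c) (hs0 : 0 < s) (hs1 : s ≠ 1) :
    ∃ C : ℝ, IsMult (lowPiece c s : Rn n → ℂ) C := by
  obtain ⟨C, hC0, hC⟩ := exists_isMult_lowShell (n := n) hc hs0 hs1
  obtain ⟨D, hD⟩ := exists_isMult_of_bddDerivs (H := Unit) (M := 2)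
    (A := fun _ (ξ : Rn n) => ((lowBump ξ : ℝ) : ℂ))
    ((BddDerivs.of_hasCompactSupport (fun _ => le_rfl) contDiff_lowBump
      hasCompactSupport_lowBump).clm_comp Complex.ofRealCLM)
    fun _ => closure_minimal (fun ξ hξ => by
      by_contra h
      simp only [Metric.mem_closedBall, dist_zero_right, not_le] at h
      exact hξ (by simp [lowBump_of_ge h.le])) Metric.isClosed_closedBall
  set q : ℝ := (2 : ℝ) ^ (-s) with hq
  have hq0 : 0 ≤ q := Real.rpow_nonneg two_pos.le _
  have hq1 : q < 1 := Real.rpow_lt_one_of_one_lt_of_neg one_lt_two (by linarith)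
  refine ⟨D + C * (1 - q)⁻¹, IsMult.of_tendsto (h := fun N ξ => ((lowBump ξ : ℝ) : ℂ) +
    ∑ l ∈ Finset.range N, (Complex.exp (Complex.I * ((c * ‖ξ‖ ^ s : ℝ) : ℂ)) - 1) *
      (annBump ((2 : ℝ) ^ l • ξ) : ℝ)) (fun N => ?_) fun ξ => ?_⟩
  · refine (hD ()).add ((IsMult.sum fun l _ => hC l).mono ?_)
    rw [← Finset.mul_sum]
    refine mul_le_mul_of_nonneg_left ?_ hC0
    rw [← tsum_geometric_of_lt_one hq0 hq1]
    exact (summable_geometric_of_lt_one hq0 hq1).sum_le_tsum _ fun l _ => pow_nonneg hq0 l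
  · have e : ∀ N : ℕ, ∑ l ∈ Finset.range N, annBump ((2 : ℝ) ^ l • ξ) =
        lowBump ξ - lowBump ((2 : ℝ) ^ N • ξ) := fun N => by
      have := Finset.sum_range_sub' (fun l => lowBump ((2 : ℝ) ^ l • ξ)) N
      simp only [pow_zero, one_smul] at this
      rw [← this]
      refine Finset.sum_congr rfl fun l _ => ?_
      rw [annBump, smul_smul, pow_succ']
    -- At the origin the phase vanishes, so every shell term is zero. Elsewhere `lowBump (2^N ξ)` is
    -- eventually zero and the telescoped sum is eventually constant.
    by_cases hξ : ξ = 0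
    · subst hξ
      have h0 : (0 : ℝ) ^ s = 0 := Real.zero_rpow hs0.ne'
      simp [lowPiece, h0]
    · refine tendsto_const_nhds.congr' ?_
      have hlim : Filter.Tendsto (fun N : ℕ => (2 : ℝ) ^ N * ‖ξ‖) Filter.atTop Filter.atTop :=
        (tendsto_pow_atTop_atTop_of_one_lt one_lt_two).atTop_mul_const (norm_pos_iff.2 hξ)
      filter_upwards [hlim.eventually_ge_atTop 2] with N hN
      rw [← Finset.mul_sum, ← Complex.ofReal_sum, e, lowBump_of_ge (ξ := (2 : ℝ) ^ N • ξ), lowPiece]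
      · push_cast; ring
      · rw [norm_smul, norm_pow, Real.norm_ofNat]; exact hN

end Multipliers

/-! ### Estimates for triples of frequency shells. -/

section Triples

variable {n : ℕ}

theorem IsMult.one : IsMult (fun _ : Rn n => (1 : ℂ)) 1 :=
  ⟨zero_le_one, measurable_const, by simp, fun _ _ _ _ hτ => by simpa using hτ⟩

/-- Coordinatewise with `u = |x|/ρ`: `2π < 6.5` and `1 + 6.5² u² ≤ 7² (1 + u)²`. -/
theorem norm_weight_le {R ρ : ℝ} (hρ : 0 < ρ) (hR : ρ ≤ R) (x : Rn n) :
    ‖weight R x‖ ≤ 7 ^ n * (1 + ‖x‖ / ρ) ^ n := by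
  have hR0 : 0 < R := hρ.trans_le hR
  have hpos : 0 ≤ 7 ^ n * (1 + ‖x‖ / ρ) ^ n := by positivity
  refine (sq_le_sq₀ (norm_nonneg _) hpos).1 ?_
  rw [normSq_weight, ← mul_pow, ← pow_mul, mul_comm n 2, pow_mul]
  refine (Finset.prod_le_prod (g := fun _ => (7 * (1 + ‖x‖ / ρ)) ^ 2) (fun i _ => by positivity)
    fun i _ => ?_).trans (le_of_eq (by simp))
  have h1 : |x i| ≤ ‖x‖ := PiLp.norm_apply_le x i
  have h2 : |2 * Real.pi / R * x i| ≤ 6.5 * (‖x‖ / ρ) := by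
    rw [abs_mul, abs_of_pos (by positivity), div_mul_eq_mul_div, mul_div_assoc]
    have := Real.pi_lt_d2
    gcongr
    linarith
  have h3 : (2 * Real.pi / R * x i) ^ 2 ≤ (6.5 * (‖x‖ / ρ)) ^ 2 := by
    rw [← sq_abs]; exact pow_le_pow_left₀ (abs_nonneg _) h2 2
  have h4 : 0 ≤ ‖x‖ / ρ := by positivity
  nlinarith

/-- Derivative bounds at scale `R` of an input multiplier. -/
structure InputBound (m : Rn n → ℂ) (R b : ℝ) : Prop where
  temperate : m.HasTemperateGrowth
  bound : ∀ k ≤ n, ∀ ξ, ‖iteratedFDeriv ℝ k m ξ‖ ≤ b * R ^ k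

theorem InputBound.const_one {R b : ℝ} (hR : 0 ≤ R) (hb : 1 ≤ b) :
    InputBound (fun _ : Rn n => (1 : ℂ)) R b := by
  refine ⟨Function.HasTemperateGrowth.const _, fun k _ ξ => ?_⟩
  rcases Nat.eq_zero_or_pos k with rfl | hk
  · simpa using hb
  · rw [iteratedFDeriv_const_of_ne hk.ne']
    simp only [Pi.zero_apply, norm_zero]
    positivity

/-- Decay at scale `ρ` of the kernel of an output multiplier. -/
def OutputBound (m : 𝓢(Rn n, ℂ)) (ρ K : ℝ) : Prop :=
  ∀ x, (1 + ‖x‖ / ρ) ^ (2 * n) * ‖(𝓕 m : 𝓢(Rn n, ℂ)) x‖ ≤ K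

/-- Kernel decay of order `2n` at scale `ρ` absorbs both weights, `n` powers for each, because a
weight of scale `Rᵢ ≥ ρ` grows no faster. -/
theorem formBound_of_inputBound {m₁ m₂ : Rn n → ℂ} {m₃ : 𝓢(Rn n, ℂ)} {R₁ R₂ ρ b K : ℝ}
    (hρ : 0 < ρ) (hR₁ : ρ ≤ R₁) (hR₂ : ρ ≤ R₂) (hb : 0 ≤ b) (h₁ : InputBound m₁ R₁ b)
    (h₂ : InputBound m₂ R₂ b) (h₃ : OutputBound m₃ ρ K) :
    FormBound (fun p => m₁ p.1 * m₂ p.2 * m₃ (p.1 + p.2))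
      ((7 ^ n * 7 ^ n * 2 ^ n * 2 ^ n * b * b) * (K * (R₁ ^ ((n : ℝ) / 2) * R₂ ^ ((n : ℝ) / 2)))) := by
  have hK : 0 ≤ K := le_trans (by positivity) (h₃ 0)
  have := formBound_of_weighted_kernel (hρ.trans_le hR₁) (hρ.trans_le hR₂) hb hb
    (K := 7 ^ n * 7 ^ n * K) (by positivity) h₁.temperate h₂.temperate h₁.bound h₂.bound m₃
    fun x => by
      calc ‖(𝓕 m₃ : 𝓢(Rn n, ℂ)) x‖ * (‖weight R₁ x‖ * ‖weight R₂ x‖)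
          ≤ ‖(𝓕 m₃ : 𝓢(Rn n, ℂ)) x‖ * ((7 ^ n * (1 + ‖x‖ / ρ) ^ n) * (7 ^ n * (1 + ‖x‖ / ρ) ^ n)) := by
            gcongr
            · exact norm_weight_le hρ hR₁ x
            · exact norm_weight_le hρ hR₂ x
        _ = 7 ^ n * 7 ^ n * ((1 + ‖x‖ / ρ) ^ (2 * n) * ‖(𝓕 m₃ : 𝓢(Rn n, ℂ)) x‖) := by ring
        _ ≤ _ := mul_le_mul_of_nonneg_left (h₃ x) (by positivity)
  convert this using 1
  ring

/-- The pieces of the decomposition of `e^{i c |ξ|^s}` into a low frequency part and dyadic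
shells. -/
def phasePiece (c s : ℝ) : ℕ → Rn n → ℂ
  | 0 => lowPiece c s
  | k + 1 => dyadicPiece c s (k + 1)

/-- The multiplier replacing `phasePiece c s k` in the input variables. -/
def inputPiece (c s : ℝ) : ℕ → Rn n → ℂ
  | 0 => fun _ => 1
  | k + 1 => dyadicPiece c s (k + 1)

theorem phasePiece_eq_zero {c s : ℝ} (k : ℕ) {ξ : Rn n} (h : 2 * 2 ^ k < ‖ξ‖) :
    phasePiece c s k ξ = 0 := by
  cases k with
  | zero => simp [phasePiece, lowPiece, lowBump_of_ge (ξ := ξ) (by linarith)]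
  | succ k => exact dyadicPiece_eq_zero (Or.inr h)

/-- Bounds at the natural scale persist at any larger `R`. This freedom lets input scales be raised
to the kernel scale. At index `0` the non-smooth low frequency part is replaced by the constant `1`
and treated as an `IsMult` factor instead. -/
theorem exists_inputBound {c s : ℝ} (hc : 0 < c) (hs0 : 0 < s) (hs1 : s ≠ 1) :
    ∃ B : ℝ, 1 ≤ B ∧ ∀ (k : ℕ) (R : ℝ), (2 : ℝ) ^ (k * (s - 1)) ≤ R →
      InputBound (inputPiece c s k : Rn n → ℂ) R B := by
  obtain ⟨B, hB1, hB⟩ := (bddDerivs_dyadicPiece (E := Rn n) hc hs0 hs1).exists_pos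
    (fun k => Real.rpow_nonneg two_pos.le _) n
  refine ⟨B, hB1, fun k R hR => ?_⟩
  have hR0 : 0 ≤ R := (Real.rpow_nonneg two_pos.le _).trans hR
  cases k with
  | zero => exact InputBound.const_one hR0 hB1
  | succ k =>
    refine ⟨((hasCompactSupport_dyadicPiece c s (k + 1)).toSchwartzMap
      (contDiff_dyadicPiece hc hs0 hs1 (k + 1))).hasTemperateGrowth, fun i hi ξ => ?_⟩
    refine (hB i hi (k + 1) ξ (Set.mem_univ _)).trans ?_
    gcongr

/-- Multipliers replacing the `phasePiece c s k` in the output variable. -/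
theorem exists_outputBound {c s : ℝ} (hc : 0 < c) (hs0 : 0 < s) (hs1 : s ≠ 1) :
    ∃ (C : ℝ) (m : ℕ → 𝓢(Rn n, ℂ)), 0 ≤ C ∧
      (∀ ξ, lowPiece c s ξ = lowPiece c s ξ * m 0 ξ) ∧
      (∀ k ξ, m (k + 1) ξ = dyadicPiece c s (k + 1) ξ) ∧
      ∀ k : ℕ, OutputBound (m k) ((2 : ℝ) ^ (k * (s - 1))) (C * (2 : ℝ) ^ (k * n * (1 - s / 2))) := by
  obtain ⟨C, hC0, hC⟩ := exists_fourier_dyadicPiece_bound (E := Rn n) hc hs0 hs1 (2 * n)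
  -- A wider bump, equal to one wherever `lowPiece` may be nonzero: a Schwartz stand-in for the low
  -- piece in the output variable.
  set Φ : Rn n → ℂ := fun ξ => ((lowBump ((2 : ℝ)⁻¹ • ξ) : ℝ) : ℂ) with hΦ
  have hΦs : ContDiff ℝ ∞ Φ :=
    Complex.ofRealCLM.contDiff.comp (contDiff_lowBump.comp (contDiff_const_smul _))
  have hΦ0 : ∀ ξ : Rn n, 4 < ‖ξ‖ → Φ ξ = 0 := fun ξ h => by
    rw [hΦ]
    simp only
    rw [lowBump_of_ge, Complex.ofReal_zero]
    rw [norm_smul, norm_inv, Real.norm_ofNat]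
    linarith
  have hΦt : tsupport Φ ⊆ Metric.closedBall 0 4 := closure_minimal (fun ξ hξ => by
    by_contra h
    simp only [Metric.mem_closedBall, dist_zero_right, not_le] at h
    exact hξ (hΦ0 ξ h)) Metric.isClosed_closedBall
  have hΦc : HasCompactSupport Φ := hasCompactSupport_of_tsupport_subset_ball hΦt
  obtain ⟨D, hD0, hD⟩ := exists_fourier_decay (H := Unit) (A := fun _ => Φ) (M := 4)
    (BddDerivs.of_hasCompactSupport (fun _ => le_rfl) hΦs hΦc) (fun _ => hΦt) (2 * n)
  refine ⟨max C D, fun k => Nat.casesOn k (hΦc.toSchwartzMap hΦs) fun k =>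
    (hasCompactSupport_dyadicPiece c s (k + 1)).toSchwartzMap
      (contDiff_dyadicPiece hc hs0 hs1 (k + 1)), le_max_of_le_left hC0, fun ξ => ?_,
    fun k ξ => rfl, fun k => ?_⟩
  · change _ = _ * Φ ξ
    by_cases h : ‖ξ‖ ≤ 2
    · rw [hΦ]
      simp only
      rw [lowBump_of_le, Complex.ofReal_one, mul_one]
      rw [norm_smul, norm_inv, Real.norm_ofNat]
      linarith
    · rw [lowPiece, lowBump_of_ge (le_of_not_ge h)]
      simp
  · cases k with
    | zero =>
      intro x
      rw [fourier_coe]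
      change _ * ‖𝓕 Φ x‖ ≤ _
      simpa only [Nat.cast_zero, zero_mul, Real.rpow_zero, div_one, mul_one] using
        (hD () x).trans (le_max_right C D)
    | succ k =>
      intro x
      rw [fourier_coe]
      have := hC (k + 1) x
      simp only [finrank_euclideanSpace, Fintype.card_fin] at this
      exact this.trans (mul_le_mul_of_nonneg_right (le_max_left _ _) (by positivity))

theorem exists_isMult_phasePiece {c s : ℝ} (hc : 0 < c) (hs0 : 0 < s) (hs1 : s ≠ 1) :
    ∃ C : ℝ, 0 ≤ C ∧ ∀ k : ℕ, IsMult (phasePiece c s k : Rn n → ℂ) (C * (2 : ℝ) ^ (k * n * s / 2)) := by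
  obtain ⟨C, hC0, hC⟩ := exists_isMult_dyadicPiece (n := n) hc hs0 hs1
  obtain ⟨D, hD⟩ := exists_isMult_lowPiece (n := n) hc hs0 hs1
  refine ⟨max C D, le_max_of_le_left hC0, fun k => ?_⟩
  cases k with
  | zero => exact hD.mono (by simp)
  | succ k => exact (hC (k + 1)).mono (mul_le_mul_of_nonneg_right (le_max_left _ _) (by positivity))

/-- Reduction of the estimate for three phase pieces to the estimate for the replacing
multipliers. -/
theorem exists_formBound_phasePiece_of {c s : ℝ} (hc : 0 < c) (hs0 : 0 < s) (hs1 : s ≠ 1)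
    {m : ℕ → 𝓢(Rn n, ℂ)} (hm0 : ∀ ξ, lowPiece c s ξ = lowPiece c s ξ * m 0 ξ)
    (hm : ∀ k ξ, m (k + 1) ξ = dyadicPiece c s (k + 1) ξ) :
    ∃ C : ℝ, 1 ≤ C ∧ (∀ (k₁ k₂ k₃ : ℕ) (A : ℝ),
      FormBound (fun p : Rn n × Rn n => inputPiece c s k₁ p.1 * inputPiece c s k₂ p.2 * m k₃ (p.1 + p.2)) A →
      FormBound (fun p : Rn n × Rn n => phasePiece c s k₁ p.1 * phasePiece c s k₂ p.2 *
        phasePiece c s k₃ (p.1 + p.2)) (C * A)) ∧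
      ∀ (k₁ k₂ k₃ : ℕ) (A : ℝ),
      FormBound (fun p : Rn n × Rn n => 1 * inputPiece c s k₂ p.2 * m k₃ (p.1 + p.2)) A →
      FormBound (fun p : Rn n × Rn n => phasePiece c s k₁ p.1 * phasePiece c s k₂ p.2 *
        phasePiece c s k₃ (p.1 + p.2)) (C * (2 : ℝ) ^ (k₁ * n * s / 2) * A) := by
  obtain ⟨D, hD⟩ := exists_isMult_lowPiece (n := n) hc hs0 hs1
  obtain ⟨C, hC0, hC⟩ := exists_isMult_phasePiece (n := n) hc hs0 hs1
  set L := max 1 D with hL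
  have hL1 : 1 ≤ L := le_max_left _ _
  have hu : ∀ k : ℕ, ∃ u : Rn n → ℂ, IsMult u L ∧
      (∀ ξ, phasePiece c s k ξ = u ξ * inputPiece c s k ξ) ∧
      ∀ ξ, phasePiece c s k ξ = u ξ * m k ξ := fun k => by
    cases k with
    | zero =>
      exact ⟨lowPiece c s, hD.mono (le_max_right _ _), fun ξ => (mul_one _).symm, hm0⟩
    | succ k =>
      exact ⟨fun _ => 1, IsMult.one.mono hL1, fun ξ => (one_mul _).symm, fun ξ => by
        rw [hm, one_mul]; rfl⟩
  choose u hu1 hu2 hu3 using hu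
  refine ⟨(L + C) * L * L, ?_, fun k₁ k₂ k₃ A hA => ?_, fun k₁ k₂ k₃ A hA => ?_⟩
  · have : (1 : ℝ) * 1 * 1 ≤ (L + C) * L * L := by gcongr; linarith
    simpa using this
  · refine FormBound.mono (A := L * (L * (L * A))) ?_ ?_
    · convert (hu1 k₁).fst ((hu1 k₂).snd ((hu1 k₃).output hA)) using 2 with p
      rw [hu2 k₁, hu2 k₂, hu3 k₃]
      ring
    · have := hA.nonneg
      calc L * (L * (L * A)) = L * L * L * A := by ring
        _ ≤ _ := by gcongr; linarith
  · refine FormBound.mono (A := (C * (2 : ℝ) ^ (k₁ * n * s / 2)) * (L * (L * A))) ?_ ?_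
    · convert (hC k₁).fst ((hu1 k₂).snd ((hu1 k₃).output hA)) using 2 with p
      rw [hu2 k₂, hu3 k₃]
      ring
    · have := hA.nonneg
      have h2 : (0 : ℝ) ≤ (2 : ℝ) ^ (k₁ * n * s / 2) := by positivity
      calc (C * (2 : ℝ) ^ (k₁ * n * s / 2)) * (L * (L * A))
          = C * (L * L * (2 : ℝ) ^ (k₁ * n * s / 2) * A) := by ring
        _ ≤ (L + C) * (L * L * (2 : ℝ) ^ (k₁ * n * s / 2) * A) := by gcongr; linarith
        _ = _ := by ring

theorem criticalOrder_nonpos (n : ℕ) {s : ℝ} (hs0 : 0 < s) : criticalOrder n s ≤ 0 := by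
  have h1 : 0 ≤ n * s := by positivity
  rw [criticalOrder]
  split_ifs with h2 h3
  · nlinarith
  · linarith
  · nlinarith [Nat.cast_nonneg (α := ℝ) n]

/-- The supports are incompatible with `|ξ + η| ≤ |ξ| + |η|`: the inputs have size at most
`2^{k₁+1}` and `2^{k₂+1}`, while the output has size at least `2^{k₃-1}`. -/
theorem formBound_phasePiece_of_triangle_fails {c s : ℝ} {k₁ k₂ k₃ : ℕ} (h₁ : k₁ + 3 < k₃)
    (h₂ : k₂ + 3 < k₃) : FormBound (fun p : Rn n × Rn n => phasePiece c s k₁ p.1 *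
      phasePiece c s k₂ p.2 * phasePiece c s k₃ (p.1 + p.2)) 0 := by
  convert FormBound.zero using 2 with p
  by_cases h : 2 * 2 ^ k₁ < ‖p.1‖
  · rw [phasePiece_eq_zero _ h]; ring
  by_cases h' : 2 * 2 ^ k₂ < ‖p.2‖
  · rw [phasePiece_eq_zero _ h']; ring
  obtain ⟨k, rfl⟩ : ∃ k, k₃ = k + 1 := ⟨k₃ - 1, by omega⟩
  have e : phasePiece c s (k + 1) (p.1 + p.2) = 0 := by
    refine dyadicPiece_eq_zero (Or.inl ?_)
    have e1 : (2 : ℝ) ^ (k₁ + 4) ≤ 2 ^ (k + 1) := pow_le_pow_right₀ one_le_two (by omega)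
    have e2 : (2 : ℝ) ^ (k₂ + 4) ≤ 2 ^ (k + 1) := pow_le_pow_right₀ one_le_two (by omega)
    have e3 : (0 : ℝ) < 2 ^ (k + 1) := by positivity
    rw [pow_add] at e1 e2
    have := norm_add_le p.1 p.2
    linarith
  rw [e, mul_zero]

/-- The estimate for a triple of frequency pieces at most `2 ^ j`. -/
theorem exists_formBound_phasePiece {c s : ℝ} (hc : 0 < c) (hs0 : 0 < s) (hs1 : s ≠ 1) :
    ∃ C : ℝ, 0 ≤ C ∧ ∀ j k₁ k₂ k₃ : ℕ, k₁ ≤ j → k₂ ≤ j → k₃ ≤ j →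
      FormBound (fun p : Rn n × Rn n => phasePiece c s k₁ p.1 * phasePiece c s k₂ p.2 *
        phasePiece c s k₃ (p.1 + p.2)) (C * (2 : ℝ) ^ (-(j * criticalOrder n s))) := by
  obtain ⟨K, m, hK0, hm0, hm, hout⟩ := exists_outputBound (n := n) hc hs0 hs1
  obtain ⟨C, hC1, hCa, hCb⟩ := exists_formBound_phasePiece_of hc hs0 hs1 hm0 hm
  obtain ⟨B, hB1, hB⟩ := exists_inputBound (n := n) hc hs0 hs1
  have hB0 : 0 ≤ B := zero_le_one.trans hB1
  have hC0 : 0 ≤ C := zero_le_one.trans hC1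
  set D : ℝ := 7 ^ n * 7 ^ n * 2 ^ n * 2 ^ n * B * B with hD
  have hD0 : 0 ≤ D := by positivity
  -- Absorbs the shift by `3` between output and input indices in the case `s < 1`.
  set Q : ℝ := (2 : ℝ) ^ (3 * |1 - s| * n) with hQ
  have hQ1 : 1 ≤ Q := Real.one_le_rpow one_le_two (by positivity)
  have hrp : ∀ (x : ℝ), ((2 : ℝ) ^ x) ^ ((n : ℝ) / 2) = 2 ^ (x * n / 2) := fun x => by
    rw [← Real.rpow_mul two_pos.le]; congr 1; ring
  have hmono : ∀ {x y : ℝ}, x ≤ y → (2 : ℝ) ^ x ≤ 2 ^ y := fun h =>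
    Real.rpow_le_rpow_of_exponent_le one_le_two h
  have hn0 : (0 : ℝ) ≤ n := Nat.cast_nonneg n
  have hfin : ∀ {x y : ℝ}, x ≤ y → C * (D * (K * (2 : ℝ) ^ x)) ≤ C * (D * (K * 2 ^ y)) := fun h =>
    mul_le_mul_of_nonneg_left (mul_le_mul_of_nonneg_left (mul_le_mul_of_nonneg_left (hmono h) hK0)
      hD0) hC0
  refine ⟨C * (D * (K * Q)), by positivity, ?_⟩
  rcases lt_or_gt_of_ne hs1 with hs | hs
  · -- the case `s < 1`
    have hcrit : criticalOrder n s = -(n * (s * (3 / 2 - s))) := by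
      rw [criticalOrder, if_pos hs]; ring
    have key : ∀ j k₁ k₂ k₃ : ℕ, k₁ ≤ j → k₂ ≤ j → k₃ ≤ j → k₃ ≤ k₂ + 3 →
        FormBound (fun p : Rn n × Rn n => phasePiece c s k₁ p.1 * phasePiece c s k₂ p.2 *
        phasePiece c s k₃ (p.1 + p.2)) (C * (D * (K * Q)) * (2 : ℝ) ^ (-(j * criticalOrder n s))) := by
      intro j k₁ k₂ k₃ h₁ h₂ h₃ h₂₃
      have hk1 : (k₁ : ℝ) ≤ j := by exact_mod_cast h₁
      have hk3 : (k₃ : ℝ) ≤ j := by exact_mod_cast h₃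
      have hk23 : (k₃ : ℝ) ≤ k₂ + 3 := by exact_mod_cast h₂₃
      have hk10 : (0 : ℝ) ≤ k₁ := Nat.cast_nonneg _
      have hk30 : (0 : ℝ) ≤ k₃ := Nat.cast_nonneg _
      set ρ : ℝ := (2 : ℝ) ^ (k₃ * (s - 1)) with hρ
      have hρ0 : 0 < ρ := by positivity
      -- For `s < 1` higher frequencies have smaller scales. From `k₂ ≥ k₃ - 3` this `R` dominates
      -- the scale of the second input, and it exceeds `ρ` only by the factor `2^{3(1-s)}`.
      set R : ℝ := (2 : ℝ) ^ ((k₃ - 3) * (s - 1)) with hR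
      have hR0 : 0 < R := by positivity
      have hρR : ρ ≤ R := hmono (by nlinarith)
      have hi2 := hB k₂ R (hmono (by nlinarith))
      have hRn : R ^ ((n : ℝ) / 2) = 2 ^ ((k₃ - 3) * (s - 1) * n / 2) := hrp _
      rw [hcrit]
      -- The first input may have much lower frequency, so its scale may be far above `ρ`. For `s ≥
      -- 1/2` it is given scale `1`, with exponent `k₃n/2`, which suffices as `s(3/2-s) - 1/2 =
      -- (s-1/2)(1-s) ≥ 0`. For `s ≤ 1/2` it is removed as an `IsMult` factor at cost `2^{k₁ns/2}`,
      -- with total exponent `(k₁+k₃)ns/2 ≤ jns`, which suffices as `1 ≤ 3/2 - s`.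
      rcases le_total (1 / 2) s with hs2 | hs2
      · have h := hCa k₁ k₂ k₃ _ (formBound_of_inputBound hρ0
          (Real.rpow_le_one_of_one_le_of_nonpos one_le_two (by nlinarith)) hρR hB0
          (hB k₁ 1 (Real.rpow_le_one_of_one_le_of_nonpos one_le_two (by nlinarith))) hi2 (hout k₃))
        refine h.mono ?_
        rw [Real.one_rpow, one_mul, hRn, mul_assoc K, ← Real.rpow_add two_pos, mul_assoc C,
          mul_assoc D, mul_assoc K, hQ, ← Real.rpow_add two_pos]
        refine hfin ?_
        · rw [abs_of_pos (by linarith)]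
          have e1 : 0 ≤ (1 - s) * n := by nlinarith
          have e2 : (k₃ : ℝ) * (n * (1 / 2)) ≤ j * (n * (s * (3 / 2 - s))) := by
            gcongr
            nlinarith
          linarith
      · have h := hCb k₁ k₂ k₃ _ (formBound_of_inputBound hρ0 hρR hρR hB0
          (InputBound.const_one hR0.le hB1) hi2 (hout k₃))
        refine h.mono ?_
        rw [hRn, ← Real.rpow_add two_pos, mul_assoc K, ← Real.rpow_add two_pos]
        rw [show C * (2 : ℝ) ^ (k₁ * n * s / 2) * (7 ^ n * 7 ^ n * 2 ^ n * 2 ^ n * B * B *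
          (K * (2 : ℝ) ^ (k₃ * n * (1 - s / 2) + ((k₃ - 3) * (s - 1) * n / 2 +
            (k₃ - 3) * (s - 1) * n / 2)))) = C * (D * (K * ((2 : ℝ) ^ (k₁ * n * s / 2) *
          (2 : ℝ) ^ (k₃ * n * (1 - s / 2) + ((k₃ - 3) * (s - 1) * n / 2 +
            (k₃ - 3) * (s - 1) * n / 2))))) by rw [hD]; ring,
          ← Real.rpow_add two_pos, mul_assoc C, mul_assoc D, mul_assoc K, hQ,
          ← Real.rpow_add two_pos]
        refine hfin ?_
        · rw [abs_of_pos (by linarith)]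
          have e1 : (k₁ : ℝ) * (n * s) ≤ j * (n * s) := by gcongr
          have e3 : (k₃ : ℝ) * (n * s) ≤ j * (n * s) := by gcongr
          have e2 : (j : ℝ) * (n * (s * 1)) ≤ j * (n * (s * (3 / 2 - s))) := by
            gcongr
            linarith
          linarith
    intro j k₁ k₂ k₃ h₁ h₂ h₃
    -- Some input index is within `3` of `k₃`, or the symbol vanishes; the two inputs play symmetric
    -- roles.
    by_cases h23 : k₃ ≤ k₂ + 3
    · exact key j k₁ k₂ k₃ h₁ h₂ h₃ h23
    by_cases h13 : k₃ ≤ k₁ + 3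
    · convert (key j k₂ k₁ k₃ h₂ h₁ h₃ h13).swap using 2 with p
      rw [Prod.fst_swap, Prod.snd_swap, add_comm p.2]
      ring
    · exact (formBound_phasePiece_of_triangle_fails (by omega) (by omega)).mono (by positivity)
  · -- the case `1 < s`
    intro j k₁ k₂ k₃ h₁ h₂ h₃
    have hk3 : (k₃ : ℝ) ≤ j := by exact_mod_cast h₃
    have hk30 : (0 : ℝ) ≤ k₃ := Nat.cast_nonneg _
    have hle : ∀ k : ℕ, k ≤ j → (2 : ℝ) ^ (k * (s - 1)) ≤ 2 ^ (j * (s - 1)) := fun k hk => by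
      have : (k : ℝ) ≤ j := by exact_mod_cast hk
      exact hmono (by nlinarith)
    -- For `s > 1` scales grow with frequency, so `2^{j(s-1)}` serves for both inputs.
    have h := hCa k₁ k₂ k₃ _ (formBound_of_inputBound (by positivity) (hle k₃ h₃) (hle k₃ h₃) hB0
      (hB k₁ _ (hle k₁ h₁)) (hB k₂ _ (hle k₂ h₂)) (hout k₃))
    refine h.mono ?_
    rw [hrp, ← Real.rpow_add two_pos, mul_assoc K, ← Real.rpow_add two_pos, mul_assoc C, mul_assoc D,
      mul_assoc K, hQ, ← Real.rpow_add two_pos]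
    refine hfin ?_
    · have e0 : 0 ≤ 3 * |1 - s| * n := by positivity
      -- The sign of `1 - s/2` decides the worst output: `k₃ = j` for `s ≤ 2`, giving `ns/2`, and
      -- `k₃ = 0` for `s > 2`, giving `n(s-1)`.
      have e1 : (k₃ : ℝ) * (n * (1 - s / 2)) + j * (n * (s - 1)) ≤ -(j * criticalOrder n s) := by
        rw [criticalOrder, if_neg (by linarith)]
        split_ifs with h2
        · have : (k₃ : ℝ) * (n * (1 - s / 2)) ≤ j * (n * (1 - s / 2)) := by
            have : 0 ≤ 1 - s / 2 := by linarith
            gcongr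
          linarith
        · have : (0 : ℝ) ≤ k₃ * (n * (s / 2 - 1)) := by
            have : 0 ≤ s / 2 - 1 := by linarith
            positivity
          linarith
      linarith

end Triples

/-! ### Dyadic decomposition of the symbol and summation. -/

section Symbols

theorem SymbolClass.exists_nonneg {V : Type*} [NormedAddCommGroup V] [NormedSpace ℝ V] {m : ℝ}
    {σ : V → ℂ} (hσ : SymbolClass m σ) (k : ℕ) : ∃ C : ℝ, 0 ≤ C ∧
      ∀ ζ : V, ‖iteratedFDeriv ℝ k σ ζ‖ ≤ C * (1 + ‖ζ‖) ^ (m - (k : ℝ)) := by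
  obtain ⟨C, hC⟩ := hσ.2 k
  exact ⟨|C|, abs_nonneg _, fun ζ => (hC ζ).trans
    (mul_le_mul_of_nonneg_right (le_abs_self _) (by positivity))⟩

theorem SymbolClass.exists_norm_le {V : Type*} [NormedAddCommGroup V] [NormedSpace ℝ V] {m : ℝ}
    {σ : V → ℂ} (hσ : SymbolClass m σ) (hm : m ≤ 0) : ∃ C : ℝ, 0 ≤ C ∧ ∀ ζ, ‖σ ζ‖ ≤ C := by
  obtain ⟨C, hC0, hC⟩ := hσ.exists_nonneg 0
  refine ⟨C, hC0, fun ζ => ?_⟩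
  have := hC ζ
  simp only [norm_iteratedFDeriv_zero, Nat.cast_zero, sub_zero] at this
  exact this.trans (mul_le_of_le_one_right hC0
    (Real.rpow_le_one_of_one_le_of_nonpos (by linarith [norm_nonneg ζ]) hm))

/-- Symbols of nonpositive order are stable under linear changes of variables. -/
theorem SymbolClass.comp_equiv {V : Type*} [NormedAddCommGroup V] [NormedSpace ℝ V] {m : ℝ}
    {σ : V → ℂ} (hσ : SymbolClass m σ) (hm : m ≤ 0) (L : V ≃L[ℝ] V) :
    SymbolClass m (fun ζ => σ (L ζ)) := by
  refine ⟨hσ.1.comp L.contDiff, fun k => ?_⟩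
  obtain ⟨C, hC0, hC⟩ := hσ.exists_nonneg k
  set N : ℝ := 1 + ‖(L.symm : V →L[ℝ] V)‖ with hN
  have hN0 : 0 < N := by positivity
  refine ⟨C * ‖(L : V →L[ℝ] V)‖ ^ k * N⁻¹ ^ (m - (k : ℝ)), fun ζ => ?_⟩
  have e : iteratedFDeriv ℝ k (fun ζ => σ (L ζ)) ζ =
      (iteratedFDeriv ℝ k σ (L ζ)).compContinuousLinearMap fun _ => (L : V →L[ℝ] V) :=
    (L : V →L[ℝ] V).iteratedFDeriv_comp_right hσ.1 ζ (by exact_mod_cast le_top)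
  rw [e]
  refine (ContinuousMultilinearMap.norm_compContinuousLinearMap_le _ _).trans ?_
  rw [Finset.prod_const, Finset.card_univ, Fintype.card_fin]
  have h1 : ‖ζ‖ ≤ ‖(L.symm : V →L[ℝ] V)‖ * ‖L ζ‖ := by
    simpa using (L.symm : V →L[ℝ] V).le_opNorm (L ζ)
  have h2 : N⁻¹ * (1 + ‖ζ‖) ≤ 1 + ‖L ζ‖ := by
    rw [inv_mul_le_iff₀ hN0]
    nlinarith [norm_nonneg (L ζ), norm_nonneg (L.symm : V →L[ℝ] V)]
  have h3 : (1 + ‖L ζ‖) ^ (m - (k : ℝ)) ≤ (N⁻¹ * (1 + ‖ζ‖)) ^ (m - (k : ℝ)) :=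
    Real.rpow_le_rpow_of_nonpos (by positivity) h2
      (by linarith [Nat.cast_nonneg (α := ℝ) k])
  rw [Real.mul_rpow (by positivity) (by positivity)] at h3
  calc _ ≤ C * (N⁻¹ ^ (m - (k : ℝ)) * (1 + ‖ζ‖) ^ (m - (k : ℝ))) * ‖(L : V →L[ℝ] V)‖ ^ k := by
        gcongr
        exact (hC _).trans (mul_le_mul_of_nonneg_left h3 hC0)
    _ = _ := by ring

variable {V : Type*} [NormedAddCommGroup V] [InnerProductSpace ℝ V] [FiniteDimensional ℝ V]

/-- The dyadic partition of unity. -/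
def dyadicCutoff : ℕ → V → ℝ
  | 0 => lowBump
  | _ + 1 => annBump

theorem contDiff_dyadicCutoff (j : ℕ) : ContDiff ℝ ∞ (dyadicCutoff j : V → ℝ) := by
  cases j with
  | zero => exact contDiff_lowBump
  | succ j => exact contDiff_annBump

theorem dyadicCutoff_eq_zero (j : ℕ) {ζ : V} (h : 2 < ‖ζ‖) : dyadicCutoff j ζ = 0 := by
  cases j with
  | zero => exact lowBump_of_ge h.le
  | succ j => exact annBump_of_notMem fun h' => absurd h'.2 (not_le.2 h)

theorem sum_dyadicCutoff (N : ℕ) (ζ : V) :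
    ∑ j ∈ Finset.range (N + 1), dyadicCutoff j (((2 : ℝ) ^ j)⁻¹ • ζ) =
      lowBump (((2 : ℝ) ^ N)⁻¹ • ζ) := by
  have := lowBump_telescope 1 ζ N
  simp only [one_mul, one_smul] at this
  rw [this, Finset.sum_range_succ', add_comm]
  simp [dyadicCutoff]

/-- The dyadic piece of a symbol, normalized in size and scale. -/
def symbolPiece (m : ℝ) (σ : V → ℂ) (j : ℕ) (ζ : V) : ℂ :=
  (dyadicCutoff j ζ : ℝ) * (((2 : ℝ) ^ (-(j * m)) : ℝ) * σ ((2 : ℝ) ^ j • ζ))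

theorem symbolPiece_smul (m : ℝ) (σ : V → ℂ) (j : ℕ) (ζ : V) :
    (dyadicCutoff j (((2 : ℝ) ^ j)⁻¹ • ζ) : ℝ) * σ ζ =
      ((2 : ℝ) ^ (j * m) : ℝ) * symbolPiece m σ j (((2 : ℝ) ^ j)⁻¹ • ζ) := by
  have h1 : (2 : ℝ) ^ j ≠ 0 := by positivity
  have h2 : ((2 : ℝ) ^ (j * m) : ℝ) * ((2 : ℝ) ^ (-(j * m)) : ℝ) = 1 := by
    rw [← Real.rpow_add two_pos, add_neg_cancel, Real.rpow_zero]
  have h3 : (((2 : ℝ) ^ (j * m) : ℝ) : ℂ) * ((2 : ℝ) ^ (-(j * m)) : ℝ) = 1 := by exact_mod_cast h2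
  rw [symbolPiece, smul_inv_smul₀ h1]
  linear_combination (-(dyadicCutoff j (((2 : ℝ) ^ j)⁻¹ • ζ) : ℂ) * σ ζ) * h3

theorem tsupport_symbolPiece (m : ℝ) (σ : V → ℂ) (j : ℕ) :
    tsupport (symbolPiece m σ j) ⊆ Metric.closedBall 0 2 :=
  closure_minimal (fun ζ hζ => by
    by_contra h
    simp only [Metric.mem_closedBall, dist_zero_right, not_le] at h
    exact hζ (by simp [symbolPiece, dyadicCutoff_eq_zero j h])) Metric.isClosed_closedBall

/-- On the annulus `1 + |2^jζ|` is at least `2^{j-1}` and `m - k ≤ 0`, so the `k`-th derivative of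
`σ` there is `O(2^{j(m-k)})`. The normalisation `2^{-jm}` and the scaling factor `2^{jk}` cancel
this. -/
theorem bddDerivs_symbolPiece {m : ℝ} {σ : V → ℂ} (hσ : SymbolClass m σ) (hm : m ≤ 0) :
    BddDerivs Set.univ (fun _ => 1) (symbolPiece m σ) := by
  have hs : ∀ j, ContDiff ℝ ∞ (symbolPiece m σ j) := fun j =>
    (Complex.ofRealCLM.contDiff.comp (contDiff_dyadicCutoff j)).mul
      (contDiff_const.mul (hσ.1.comp (contDiff_const_smul _)))
  have hw0 : ∀ l : ℕ, (0 : ℝ) ≤ (fun _ : ℕ => (1 : ℝ)) l := fun _ => zero_le_one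
  have b1 : BddDerivs (unitAnnulus V) (fun _ : ℕ => 1) fun j ζ =>
      (((2 : ℝ) ^ (-(((j + 1 : ℕ) : ℝ) * m)) : ℝ) : ℂ) * σ ((2 : ℝ) ^ (j + 1) • ζ) := by
    refine ⟨fun j => contDiff_const.mul (hσ.1.comp (contDiff_const_smul _)), fun k => ?_⟩
    obtain ⟨C, hC0, hC⟩ := hσ.exists_nonneg k
    refine ⟨C * (2 : ℝ) ^ (-(m - k)), fun j ζ hζ => ?_⟩
    have hsm : ContDiffAt ℝ k (fun ζ : V => σ ((2 : ℝ) ^ (j + 1) • ζ)) ζ :=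
      (hσ.1.comp (contDiff_const_smul _)).contDiffAt.of_le (by exact_mod_cast le_top)
    have e : iteratedFDeriv ℝ k (fun ζ : V => (((2 : ℝ) ^ (-(((j + 1 : ℕ) : ℝ) * m)) : ℝ) : ℂ) *
        σ ((2 : ℝ) ^ (j + 1) • ζ)) ζ = (2 : ℝ) ^ (-(((j + 1 : ℕ) : ℝ) * m)) •
          iteratedFDeriv ℝ k (fun ζ : V => σ ((2 : ℝ) ^ (j + 1) • ζ)) ζ := by
      rw [← iteratedFDeriv_const_smul_apply hsm]
      rfl
    rw [e, iteratedFDeriv_comp_const_smul _ (hσ.1.of_le (by exact_mod_cast le_top)), norm_smul,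
      norm_smul, Real.norm_of_nonneg (by positivity), norm_pow, Real.norm_of_nonneg (by positivity)]
    have h1 : (2 : ℝ) ^ (j + 1) * 2⁻¹ ≤ 1 + ‖(2 : ℝ) ^ (j + 1) • ζ‖ := by
      rw [norm_smul, Real.norm_of_nonneg (by positivity)]
      have : (2 : ℝ) ^ (j + 1) * 2⁻¹ ≤ 2 ^ (j + 1) * ‖ζ‖ := by
        have := hζ.1
        gcongr
        linarith
      linarith
    have h2 : (1 + ‖(2 : ℝ) ^ (j + 1) • ζ‖) ^ (m - k) ≤ ((2 : ℝ) ^ (j + 1) * 2⁻¹) ^ (m - k) :=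
      Real.rpow_le_rpow_of_nonpos (by positivity) h1 (by linarith [Nat.cast_nonneg (α := ℝ) k])
    have h3 : (2 : ℝ) ^ (-(((j + 1 : ℕ) : ℝ) * m)) * (((2 : ℝ) ^ (j + 1)) ^ k *
        ((2 : ℝ) ^ (j + 1) * 2⁻¹) ^ (m - k)) = (2 : ℝ) ^ (-(m - k)) := by
      rw [Real.mul_rpow (by positivity) (by positivity), ← Real.rpow_neg_one, ← Real.rpow_mul two_pos.le,
        ← Real.rpow_natCast, ← Real.rpow_natCast, ← Real.rpow_mul two_pos.le,
        ← Real.rpow_mul two_pos.le, ← Real.rpow_add two_pos, ← Real.rpow_add two_pos,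
        ← Real.rpow_add two_pos]
      congr 1
      ring
    rw [one_pow, mul_one, ← h3]
    calc _ ≤ (2 : ℝ) ^ (-(((j + 1 : ℕ) : ℝ) * m)) * (((2 : ℝ) ^ (j + 1)) ^ k *
        (C * ((2 : ℝ) ^ (j + 1) * 2⁻¹) ^ (m - k))) := by
          gcongr
          exact (hC _).trans (mul_le_mul_of_nonneg_left h2 hC0)
      _ = _ := by ring
  have b2 : BddDerivs (unitAnnulus V) (fun _ : ℕ => 1) fun j => symbolPiece m σ (j + 1) :=
    ((BddDerivs.of_hasCompactSupport (fun _ => le_rfl) contDiff_annBump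
      hasCompactSupport_annBump).clm_comp Complex.ofRealCLM).mul hw0 b1
  have b3 := b2.of_tsupport hw0 fun j => (closure_mono fun ζ hζ => by
      rw [Function.mem_support] at hζ ⊢
      exact fun h => hζ (by simp [symbolPiece, dyadicCutoff, h])).trans tsupport_annBump
  -- The piece at index `0` reaches the origin and is not covered by the annulus estimate, but it is
  -- a single test function.
  have b4 : BddDerivs Set.univ (fun _ : ℕ => 1) fun _ => symbolPiece m σ 0 :=
    BddDerivs.of_hasCompactSupport (fun _ => le_rfl) (hs 0)
      (hasCompactSupport_of_tsupport_subset_ball (tsupport_symbolPiece m σ 0))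
  refine ⟨hs, fun k => ?_⟩
  obtain ⟨C, hC⟩ := b3.2 k
  obtain ⟨D, hD⟩ := b4.2 k
  refine ⟨max C D, fun j ζ hζ => ?_⟩
  rw [one_pow, mul_one]
  cases j with
  | zero => exact (by simpa using hD 0 ζ hζ : _ ≤ D).trans (le_max_right _ _)
  | succ j => exact (by simpa using hC j ζ hζ : _ ≤ C).trans (le_max_left _ _)

variable {n : ℕ}

theorem FormBound.mul_of_fourier {F : R2n n → ℂ} {c : ℝ} (hc : Continuous F) (hi : Integrable F)
    (hF : Integrable (𝓕 F)) (hle : ∫ x, ‖𝓕 F x‖ ≤ c) (r : ℝ) {τ : Rn n × Rn n → ℂ} {A : ℝ}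
    (hτ : FormBound τ A) : FormBound (fun p => F (r • WithLp.toLp 2 p) * τ p) (c * A) := by
  have hm : Measurable fun p : Rn n × Rn n => F (r • WithLp.toLp 2 p) :=
    (hc.comp ((WithLp.prod_continuous_toLp 2 _ _).const_smul r)).measurable
  have hX : Measurable fun x : R2n n => r • x.fst := by
    refine Continuous.measurable ?_
    fun_prop
  have hY : Measurable fun x : R2n n => r • x.snd := by
    refine Continuous.measurable ?_
    fun_prop
  refine FormBound.superposition hF hX hY hm (fun p => ?_) hle hτ
  conv_lhs => rw [← hc.fourierInv_fourier_eq hi hF, Real.fourierInv_eq']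
  refine integral_congr_ae (Filter.Eventually.of_forall fun x => ?_)
  simp only [pairChar, inner_smul_left, inner_smul_right, WithLp.prod_inner_apply, smul_eq_mul,
    conj_trivial]
  rw [mul_comm, mul_add r]
  rfl

/-- `e^{i c |ξ|^s}` cut off to frequencies `|ξ| ≲ 2 ^ j`. -/
theorem sum_phasePiece (c s : ℝ) (j : ℕ) (ξ : Rn n) :
    ∑ k ∈ Finset.range (j + 1), phasePiece c s k ξ =
      Complex.exp (Complex.I * ((c * ‖ξ‖ ^ s : ℝ) : ℂ)) * (lowBump (((2 : ℝ) ^ j)⁻¹ • ξ) : ℝ) := by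
  rw [← sum_dyadicCutoff, Complex.ofReal_sum, Finset.mul_sum]
  refine Finset.sum_congr rfl fun k _ => ?_
  cases k with
  | zero => simp [phasePiece, lowPiece, dyadicCutoff]
  | succ k => rfl

/-- The triples are simply counted; the factor `(j+1)³` is harmless because the order of the symbol
is strictly below critical. -/
theorem exists_formBound_truncated_phase {c s : ℝ} (hc : 0 < c) (hs0 : 0 < s) (hs1 : s ≠ 1) :
    ∃ C : ℝ, 0 ≤ C ∧ ∀ j : ℕ, FormBound (fun p : Rn n × Rn n =>
      (∑ k ∈ Finset.range (j + 1), phasePiece c s k p.1) *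
      (∑ k ∈ Finset.range (j + 1), phasePiece c s k p.2) *
      ∑ k ∈ Finset.range (j + 1), phasePiece c s k (p.1 + p.2))
      (C * (((j + 1 : ℕ) : ℝ) ^ 3 * (2 : ℝ) ^ (-(j * criticalOrder n s)))) := by
  obtain ⟨C, hC0, hC⟩ := exists_formBound_phasePiece (n := n) hc hs0 hs1
  refine ⟨C, hC0, fun j => ?_⟩
  have := FormBound.sum (s := Finset.range (j + 1)) fun k₁ h₁ =>
    FormBound.sum (s := Finset.range (j + 1)) fun k₂ h₂ =>
    FormBound.sum (s := Finset.range (j + 1)) fun k₃ h₃ =>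
      hC j k₁ k₂ k₃ (Finset.mem_range_succ_iff.1 h₁) (Finset.mem_range_succ_iff.1 h₂)
        (Finset.mem_range_succ_iff.1 h₃)
  convert this using 1
  · funext p
    rw [Finset.sum_mul_sum, Finset.sum_mul]
    refine Finset.sum_congr rfl fun k₁ _ => ?_
    rw [Finset.sum_mul_sum]
  · simp only [Finset.sum_const, Finset.card_range, nsmul_eq_mul]
    ring

/-- The symbol with phase `c (|ξ|^s + |η|^s + |ξ + η|^s)`. -/
def phaseSymbol (c s : ℝ) (σ : R2n n → ℂ) (p : Rn n × Rn n) : ℂ :=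
  Complex.exp (Complex.I * ((c * (‖p.1‖ ^ s + ‖p.2‖ ^ s + ‖p.1 + p.2‖ ^ s) : ℝ) : ℂ)) *
    σ (WithLp.toLp 2 p)

theorem norm_phaseSymbol (c s : ℝ) (σ : R2n n → ℂ) (p : Rn n × Rn n) :
    ‖phaseSymbol c s σ p‖ = ‖σ (WithLp.toLp 2 p)‖ := by
  rw [phaseSymbol, norm_mul, mul_comm Complex.I, Complex.norm_exp_ofReal_mul_I, one_mul]

/-- Where the cutoff is nonzero, `|ξ|` and `|η|` are at most `2^{j+1}`, so `|ξ + η| ≤ 2^{j+2}`.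
Truncating the three exponentials at index `j + 2` therefore changes nothing. -/
theorem phaseSymbol_mul_dyadicCutoff (c s m : ℝ) (σ : R2n n → ℂ) (j : ℕ) (p : Rn n × Rn n) :
    phaseSymbol c s σ p * (dyadicCutoff j (((2 : ℝ) ^ j)⁻¹ • WithLp.toLp 2 p : R2n n) : ℝ) =
      ((2 : ℝ) ^ (j * m) : ℝ) * (symbolPiece m σ j (((2 : ℝ) ^ j)⁻¹ • WithLp.toLp 2 p) *
      ((∑ k ∈ Finset.range (j + 2 + 1), phasePiece c s k p.1) *
      (∑ k ∈ Finset.range (j + 2 + 1), phasePiece c s k p.2) *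
      ∑ k ∈ Finset.range (j + 2 + 1), phasePiece c s k (p.1 + p.2))) := by
  rw [← mul_assoc, ← symbolPiece_smul]
  by_cases h : 2 < ‖((2 : ℝ) ^ j)⁻¹ • (WithLp.toLp 2 p : R2n n)‖
  · rw [dyadicCutoff_eq_zero j h]
    simp
  have hj : (0 : ℝ) < 2 ^ j := by positivity
  rw [not_lt, norm_smul_two_pow_inv, inv_mul_le_iff₀ hj] at h
  have h1 : ‖p.1‖ ≤ 2 ^ j * 2 := (WithLp.norm_fst_le (p := 2) _ (WithLp.toLp 2 p)).trans h
  have h2 : ‖p.2‖ ≤ 2 ^ j * 2 := (WithLp.norm_snd_le (p := 2) _ (WithLp.toLp 2 p)).trans h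
  have h3 : ‖p.1 + p.2‖ ≤ 2 ^ j * 4 := (norm_add_le _ _).trans (by linarith)
  have hlow : ∀ ξ : Rn n, ‖ξ‖ ≤ 2 ^ j * 4 → lowBump (((2 : ℝ) ^ (j + 2))⁻¹ • ξ) = 1 := fun ξ hξ => by
    refine lowBump_of_le ?_
    rw [norm_smul_two_pow_inv, inv_mul_le_iff₀ (by positivity), pow_add]
    linarith
  rw [sum_phasePiece, sum_phasePiece, sum_phasePiece, hlow _ (h1.trans (by linarith)),
    hlow _ (h2.trans (by linarith)), hlow _ h3, phaseSymbol]
  rw [show Complex.I * ((c * (‖p.1‖ ^ s + ‖p.2‖ ^ s + ‖p.1 + p.2‖ ^ s) : ℝ) : ℂ) =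
    Complex.I * ((c * ‖p.1‖ ^ s : ℝ) : ℂ) + Complex.I * ((c * ‖p.2‖ ^ s : ℝ) : ℂ) +
    Complex.I * ((c * ‖p.1 + p.2‖ ^ s : ℝ) : ℂ) by push_cast; ring, Complex.exp_add,
    Complex.exp_add]
  push_cast
  ring

/-- The trilinear form of the oscillating symbol is bounded on `L^∞ × L^∞`, at the origin. -/
theorem exists_formBound_phaseSymbol {c s m : ℝ} (hc : 0 < c) (hs0 : 0 < s) (hs1 : s ≠ 1)
    (hm : m < criticalOrder n s) {σ : R2n n → ℂ} (hσ : SymbolClass m σ) :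
    ∃ A : ℝ, FormBound (phaseSymbol c s σ) A := by
  have hm0 : m ≤ 0 := hm.le.trans (criticalOrder_nonpos n hs0)
  obtain ⟨B, hB0, hB⟩ := hσ.exists_norm_le hm0
  obtain ⟨C, hC0, hC⟩ := exists_formBound_truncated_phase (n := n) hc hs0 hs1
  have hbd := bddDerivs_symbolPiece hσ hm0
  obtain ⟨D, hD0, hD⟩ := exists_integral_fourier_le hbd (tsupport_symbolPiece m σ)
  set q : ℝ := (2 : ℝ) ^ (m - criticalOrder n s) with hq
  have hq0 : 0 < q := Real.rpow_pos_of_pos two_pos _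
  have hq1 : q < 1 := Real.rpow_lt_one_of_one_lt_of_neg one_lt_two (by linarith)
  -- The factor `(q³)⁻¹` writes the bound with `j + 3` in both the polynomial and the power, so the
  -- series is a tail of `∑ j³ q^j`.
  set Q : ℝ := D * C * (2 : ℝ) ^ (-(2 * criticalOrder n s)) * (q ^ 3)⁻¹ with hQ
  have hpiece : ∀ j : ℕ, FormBound (fun p => phaseSymbol c s σ p *
      (dyadicCutoff j (((2 : ℝ) ^ j)⁻¹ • WithLp.toLp 2 p : R2n n) : ℝ))
      (Q * (((j + 3 : ℕ) : ℝ) ^ 3 * q ^ (j + 3))) := fun j => by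
    have h := (FormBound.mul_of_fourier (hbd.1 j).continuous
      (integrable_of_tsupport_subset_ball (hbd.1 j).continuous (tsupport_symbolPiece m σ j))
      (hD j).1 (hD j).2 ((2 : ℝ) ^ j)⁻¹ (hC (j + 2))).const_mul (((2 : ℝ) ^ (j * m) : ℝ) : ℂ)
    rw [Complex.norm_real, Real.norm_of_nonneg (by positivity)] at h
    convert h using 1
    · funext p
      exact phaseSymbol_mul_dyadicCutoff c s m σ j p
    · have e : (2 : ℝ) ^ (j * m) * (2 : ℝ) ^ (-(((j + 2 : ℕ) : ℝ) * criticalOrder n s)) =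
          (2 : ℝ) ^ (-(2 * criticalOrder n s)) * q ^ j := by
        rw [hq, ← Real.rpow_natCast (_ ^ _), ← Real.rpow_mul two_pos.le, ← Real.rpow_add two_pos,
          ← Real.rpow_add two_pos]
        congr 1
        push_cast
        ring
      have hq3 : (q ^ 3)⁻¹ * q ^ (j + 3) = q ^ j := by
        rw [pow_add]
        field_simp
      calc _ = D * C * ((j + 3 : ℕ) : ℝ) ^ 3 * ((2 : ℝ) ^ (-(2 * criticalOrder n s)) *
            ((q ^ 3)⁻¹ * q ^ (j + 3))) := by rw [hQ]; ring
        _ = _ := by rw [hq3, ← e]; ring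
  have hsum : Summable fun j : ℕ => Q * (((j + 3 : ℕ) : ℝ) ^ 3 * q ^ (j + 3)) := by
    refine Summable.mul_left _ ((summable_nat_add_iff 3 (f := fun j : ℕ => (j : ℝ) ^ 3 * q ^ j)).2 ?_)
    exact summable_pow_mul_geometric_of_norm_lt_one 3 (by rwa [Real.norm_of_nonneg hq0.le])
  -- The partial sums telescope to the symbol times a bump of radius about `2^N`; these are
  -- uniformly bounded and converge pointwise, so the form bound passes to the limit.
  refine ⟨∑' j : ℕ, Q * (((j + 3 : ℕ) : ℝ) ^ 3 * q ^ (j + 3)), FormBound.of_tendsto (B := B)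
    (τ := fun N p => phaseSymbol c s σ p *
      (lowBump (((2 : ℝ) ^ N)⁻¹ • WithLp.toLp 2 p : R2n n) : ℝ)) (fun N => ?_) (fun N p => ?_)
      fun p => ?_⟩
  · have h := FormBound.sum (s := Finset.range (N + 1)) fun j _ => hpiece j
    refine FormBound.mono ?_ (hsum.sum_le_tsum (Finset.range (N + 1)) fun j _ => by positivity)
    convert h using 2 with p
    rw [← Finset.mul_sum, ← Complex.ofReal_sum, sum_dyadicCutoff]
  · rw [norm_mul, norm_phaseSymbol, Complex.norm_real, Real.norm_of_nonneg (lowBump_nonneg _)]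
    exact (mul_le_of_le_one_right (norm_nonneg _) (lowBump_le_one _)).trans (hB _)
  · refine tendsto_const_nhds.congr' ?_
    filter_upwards [(tendsto_pow_atTop_atTop_of_one_lt one_lt_two).eventually_ge_atTop
      ‖(WithLp.toLp 2 p : R2n n)‖] with N hN
    rw [lowBump_of_le, Complex.ofReal_one, mul_one]
    rw [norm_smul_two_pow_inv, inv_mul_le_iff₀ (by positivity), mul_one]
    exact hN

end Symbols

/-! ### From the form at the origin to `L^∞` and `L¹` bounds. -/

section Duality

variable {n : ℕ}

/-- Continuity upgrades the almost everywhere bound to every point, as `FormBound` requires. -/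
theorem norm_le_eLpNorm_top (f : 𝓢(Rn n, ℂ)) (x : Rn n) : ‖f x‖ ≤ (eLpNorm f ∞ volume).toReal := by
  have hfin : eLpNorm f ∞ volume ≠ ⊤ := (f.memLp ∞ volume).2.ne
  have hcl : IsClosed {x | ‖f x‖ ≤ (eLpNorm f ∞ volume).toReal} :=
    isClosed_le f.continuous.norm continuous_const
  have hae : {x | ‖f x‖ ≤ (eLpNorm f ∞ volume).toReal} =ᵐ[volume] Set.univ := by
    rw [Filter.eventuallyEq_univ]
    filter_upwards [ae_le_eLpNormEssSup (f := f) (μ := volume)] with y hy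
    rw [← eLpNorm_exponent_top] at hy
    have := ENNReal.toReal_mono hfin hy
    rwa [toReal_enorm] at this
  exact Set.eq_univ_iff_forall.1 (hcl.ae_eq_univ_iff_eq.1 hae) x

/-- An `L¹` bound from testing against Schwartz functions bounded by `1`. -/
theorem eLpNorm_one_le_of_forall_schwartz {F : Rn n → ℂ} (hF : ContDiff ℝ ∞ F) {K : ℝ}
    (H : ∀ h : 𝓢(Rn n, ℂ), (∀ x, ‖h x‖ ≤ 1) → ‖∫ x, F x * h x‖ ≤ K) :
    eLpNorm F 1 volume ≤ ENNReal.ofReal K := by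
  set e : ℕ → ℝ := fun j => ((j : ℝ) + 1)⁻¹ with he
  have he0 : ∀ j, 0 < e j := fun j => by positivity
  have hpos : ∀ j x, 0 < ‖F x‖ ^ 2 + e j ^ 2 := fun j x =>
    add_pos_of_nonneg_of_pos (sq_nonneg _) (pow_pos (he0 j) 2)
  -- A smooth compactly supported substitute for `1/|F|`: multiplied by the conjugate of `F` it
  -- gives a test function bounded by one that tends to the conjugate sign of `F`.
  set w : ℕ → Rn n → ℝ := fun j x => lowBump (e j • x) * (√(‖F x‖ ^ 2 + e j ^ 2))⁻¹ with hw
  have hw0 : ∀ j x, 0 ≤ w j x := fun j x => mul_nonneg (lowBump_nonneg _) (by positivity)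
  have hlow : ∀ j, HasCompactSupport fun x : Rn n => lowBump (e j • x) := fun j =>
    hasCompactSupport_lowBump.comp_smul (he0 j).ne'
  have hws : ∀ j, ContDiff ℝ ∞ (w j) := fun j =>
    (contDiff_lowBump.comp (contDiff_const_smul _)).mul
      ((((hF.norm_sq ℝ).add contDiff_const).sqrt fun x => (hpos j x).ne').inv fun x =>
        (Real.sqrt_pos.2 (hpos j x)).ne')
  set h : ℕ → Rn n → ℂ := fun j x => w j x • (starRingEnd ℂ) (F x) with hh
  have hhs : ∀ j, ContDiff ℝ ∞ (h j) := fun j =>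
    (hws j).smul (Complex.conjCLE.contDiff.comp hF)
  have hhc : ∀ j, HasCompactSupport (h j) := fun j => (hlow j).mul_right.smul_right
  set G : ℕ → Rn n → ℝ := fun j x => w j x * ‖F x‖ ^ 2 with hG
  have hFh : ∀ j x, F x * h j x = (G j x : ℝ) := fun j x => by
    simp only [hh, hG, Complex.real_smul]
    rw [mul_left_comm, Complex.mul_conj, Complex.normSq_eq_norm_sq]
    push_cast
    ring
  have hle : ∀ j x, ‖h j x‖ ≤ 1 := fun j x => by
    simp only [hh]
    rw [norm_smul, Real.norm_of_nonneg (hw0 j x), RCLike.norm_conj]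
    simp only [hw]
    rw [mul_assoc, inv_mul_eq_div]
    refine mul_le_one₀ (lowBump_le_one _) (by positivity) ?_
    rw [div_le_one (Real.sqrt_pos.2 (hpos j x))]
    exact Real.le_sqrt_of_sq_le (by linarith [sq_nonneg (e j)])
  have hGc : ∀ j, Continuous (G j) := fun j =>
    (hws j).continuous.mul (hF.continuous.norm.pow 2)
  have hGi : ∀ j, Integrable (G j) := fun j =>
    (hGc j).integrable_of_hasCompactSupport (hlow j).mul_right.mul_right
  have hG0 : ∀ j x, 0 ≤ G j x := fun j x => mul_nonneg (hw0 j x) (sq_nonneg _)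
  have hGK : ∀ j, ∫⁻ x, ENNReal.ofReal (G j x) ≤ ENNReal.ofReal K := fun j => by
    rw [← ofReal_integral_eq_lintegral_ofReal (hGi j) (Filter.Eventually.of_forall (hG0 j))]
    refine ENNReal.ofReal_le_ofReal ?_
    have := H ((hhc j).toSchwartzMap (hhs j)) (hle j)
    have e1 : ∫ x, F x * (hhc j).toSchwartzMap (hhs j) x = ((∫ x, G j x : ℝ) : ℂ) := by
      rw [← integral_complex_ofReal]
      exact integral_congr_ae (Filter.Eventually.of_forall (hFh j))
    rw [e1, Complex.norm_real] at this
    exact (Real.le_norm_self _).trans this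
  have he_lim : Filter.Tendsto e Filter.atTop (nhds 0) :=
    tendsto_inv_atTop_zero.comp (Filter.tendsto_atTop_add_const_right _ _ tendsto_natCast_atTop_atTop)
  have hlim : ∀ x, Filter.Tendsto (fun j => G j x) Filter.atTop (nhds ‖F x‖) := fun x => by
    by_cases h0 : F x = 0
    · simp [hG, h0]
    · have hn : 0 < ‖F x‖ := norm_pos_iff.2 h0
      have t1 : Filter.Tendsto (fun j => lowBump (e j • x)) Filter.atTop (nhds 1) := by
        have := (contDiff_lowBump (E := Rn n)).continuous.tendsto (0 : Rn n)
        rw [lowBump_of_le (by simp)] at this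
        refine this.comp ?_
        simpa using he_lim.smul_const x
      have t2 : Filter.Tendsto (fun j => √(‖F x‖ ^ 2 + e j ^ 2)) Filter.atTop (nhds ‖F x‖) := by
        have := ((he_lim.pow 2).const_add (‖F x‖ ^ 2)).sqrt
        simpa [Real.sqrt_sq hn.le] using this
      have t3 := (t1.mul (t2.inv₀ hn.ne')).mul_const (‖F x‖ ^ 2)
      have e2 : 1 * ‖F x‖⁻¹ * ‖F x‖ ^ 2 = ‖F x‖ := by field_simp
      rwa [e2] at t3
  rw [eLpNorm_one_eq_lintegral_enorm]
  -- Fatou's lemma; integrability of `F` is not known beforehand.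
  calc ∫⁻ x, ‖F x‖ₑ = ∫⁻ x, Filter.liminf (fun j => ENNReal.ofReal (G j x)) Filter.atTop := by
        refine lintegral_congr fun x => ?_
        rw [← ofReal_norm]
        exact (ENNReal.tendsto_ofReal (hlim x)).liminf_eq.symm
    _ ≤ Filter.liminf (fun j => ∫⁻ x, ENNReal.ofReal (G j x)) Filter.atTop :=
        lintegral_liminf_le fun j => (hGc j).measurable.ennreal_ofReal
    _ ≤ ENNReal.ofReal K := Filter.liminf_le_of_frequently_le'
        (Filter.Frequently.of_forall hGK)

/-- The bilinear operator with symbol `τ`, with the frequency normalization of `𝓕`. -/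
def charForm (τ : Rn n × Rn n → ℂ) (f g : 𝓢(Rn n, ℂ)) (x : Rn n) : ℂ :=
  ∫ p : Rn n × Rn n, pairChar x x p *
    (τ p * ((𝓕 f : 𝓢(Rn n, ℂ)) p.1 * (𝓕 g : 𝓢(Rn n, ℂ)) p.2))

/-- Smoothness is needed since the dual test functions are built from the output itself. It holds
because the output is a Fourier integral of a function with all moments finite. -/
theorem contDiff_charForm {τ : Rn n × Rn n → ℂ} (hm : Measurable τ) (hb : ∃ B, ∀ p, ‖τ p‖ ≤ B)
    (f g : 𝓢(Rn n, ℂ)) : ContDiff ℝ ∞ (charForm τ f g) := by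
  set L : (Rn n × Rn n) →L[ℝ] Rn n →L[ℝ] ℝ :=
    -((innerSL ℝ).comp (ContinuousLinearMap.fst ℝ (Rn n) (Rn n) +
      ContinuousLinearMap.snd ℝ (Rn n) (Rn n))) with hL
  set u : Rn n × Rn n → ℂ := fun p => τ p * ((𝓕 f : 𝓢(Rn n, ℂ)) p.1 * (𝓕 g : 𝓢(Rn n, ℂ)) p.2)
    with hu
  have hui : Integrable u := integrable_symbol_mul hm hb _ _
  obtain ⟨B, hB⟩ := hb
  have key := VectorFourier.contDiff_fourierIntegral (E := ℂ) L (f := u) (μ := volume) (N := ⊤)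
    fun k _ => by
      have i1 : Integrable fun p : Rn n × Rn n => ‖p.1‖ ^ k * ‖(𝓕 f : 𝓢(Rn n, ℂ)) p.1‖ *
          ‖(𝓕 g : 𝓢(Rn n, ℂ)) p.2‖ :=
        ((𝓕 f).integrable_pow_mul volume k).mul_prod (𝓕 g).integrable.norm
      have i2 : Integrable fun p : Rn n × Rn n => ‖(𝓕 f : 𝓢(Rn n, ℂ)) p.1‖ *
          (‖p.2‖ ^ k * ‖(𝓕 g : 𝓢(Rn n, ℂ)) p.2‖) :=
        (𝓕 f).integrable.norm.mul_prod ((𝓕 g).integrable_pow_mul volume k)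
      refine ((i1.add i2).const_mul B).mono'
        ((continuous_norm.pow k).aestronglyMeasurable.mul hui.aestronglyMeasurable.norm)
        (Filter.Eventually.of_forall fun p => ?_)
      have hB0 : 0 ≤ B := (norm_nonneg _).trans (hB p)
      have h1 : ‖p‖ ^ k ≤ ‖p.1‖ ^ k + ‖p.2‖ ^ k := by
        rcases max_choice ‖p.1‖ ‖p.2‖ with h | h <;> rw [Prod.norm_def, h]
        · linarith [pow_nonneg (norm_nonneg p.2) k]
        · linarith [pow_nonneg (norm_nonneg p.1) k]
      rw [Real.norm_of_nonneg (by positivity)]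
      simp only [hu, norm_mul, Pi.add_apply]
      calc _ ≤ (‖p.1‖ ^ k + ‖p.2‖ ^ k) * (B * (‖(𝓕 f : 𝓢(Rn n, ℂ)) p.1‖ *
            ‖(𝓕 g : 𝓢(Rn n, ℂ)) p.2‖)) := by
            gcongr
            exact hB p
        _ = _ := by ring
  have e : charForm τ f g = VectorFourier.fourierIntegral Real.fourierChar volume
      L.toLinearMap₁₂ u := by
    funext x
    refine integral_congr_ae (Filter.Eventually.of_forall fun p => ?_)
    simp only [pairChar, Circle.smul_def, Real.fourierChar_apply, smul_eq_mul]
    congr 2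
    simp [hL, real_inner_comm, add_comm]
  rw [e]
  exact key

theorem integral_charForm_mul {τ : Rn n × Rn n → ℂ} (hm : Measurable τ) (hb : ∃ B, ∀ p, ‖τ p‖ ≤ B)
    (f g h : 𝓢(Rn n, ℂ)) : ∫ x, charForm τ f g x * h x =
      ∫ p : Rn n × Rn n, τ p * ((𝓕 f : 𝓢(Rn n, ℂ)) p.1 * (𝓕 g : 𝓢(Rn n, ℂ)) p.2) *
        (𝓕 h : 𝓢(Rn n, ℂ)) (-(p.1 + p.2)) := by
  set u : Rn n × Rn n → ℂ := fun p => τ p * ((𝓕 f : 𝓢(Rn n, ℂ)) p.1 * (𝓕 g : 𝓢(Rn n, ℂ)) p.2)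
    with hu
  have hui : Integrable u := integrable_symbol_mul hm hb _ _
  have hint : Integrable (Function.uncurry fun (x : Rn n) (p : Rn n × Rn n) =>
      pairChar x x p * (h x * u p)) := by
    refine Integrable.bdd_mul (c := 1) (h.integrable.mul_prod hui) ?_
      (Filter.Eventually.of_forall fun q => (norm_pairChar _ _ _).le)
    refine Continuous.aestronglyMeasurable ?_
    unfold pairChar
    fun_prop
  have e1 : ∀ x, charForm τ f g x * h x = ∫ p, pairChar x x p * (h x * u p) := fun x => by
    rw [charForm, ← integral_mul_const]
    refine integral_congr_ae (Filter.Eventually.of_forall fun p => ?_)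
    simp only [hu]
    ring
  simp_rw [e1]
  rw [integral_integral_swap hint]
  refine integral_congr_ae (Filter.Eventually.of_forall fun p => ?_)
  simp only
  rw [fourier_coe h, ← Real.fourierInv_eq_fourier_neg, ← fourierInv_coe, fourierInv_apply_eq_integral,
    ← integral_const_mul]
  refine integral_congr_ae (Filter.Eventually.of_forall fun x => ?_)
  simp only [pairChar, inner_add_right, hu]
  ring

/-- The change of frequency variables of the transposed operator. -/
def transposeFreq (p : Rn n × Rn n) : Rn n × Rn n := (-(p.1 + p.2), p.2)

theorem measurePreserving_transposeFreq :
    MeasurePreserving (transposeFreq : Rn n × Rn n → Rn n × Rn n) :=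
  ((Measure.measurePreserving_neg (volume : Measure (Rn n))).prod
    (MeasurePreserving.id (volume : Measure (Rn n)))).comp (measurePreserving_add_prod volume volume)

/-- Both sides integrate over the frequencies of `f`, `g`, `h` subject to their sum being zero. The
measure preserving substitution `(ξ, η) ↦ (-(ξ+η), η)` exchanges those of `f` and `h`. -/
theorem integral_charForm_mul_transpose {τ : Rn n × Rn n → ℂ} (hm : Measurable τ)
    (hb : ∃ B, ∀ p, ‖τ p‖ ≤ B) (f g h : 𝓢(Rn n, ℂ)) :
    ∫ x, charForm τ f g x * h x = ∫ x, charForm (fun p => τ (transposeFreq p)) h g x * f x := by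
  have hT := measurePreserving_transposeFreq (n := n)
  rw [integral_charForm_mul hm hb, integral_charForm_mul (τ := fun p => τ (transposeFreq p))
    (hm.comp hT.measurable) (hb.imp fun B hB p => hB _)]
  have hG : Measurable fun p : Rn n × Rn n => τ p *
      ((𝓕 f : 𝓢(Rn n, ℂ)) p.1 * (𝓕 g : 𝓢(Rn n, ℂ)) p.2) * (𝓕 h : 𝓢(Rn n, ℂ)) (-(p.1 + p.2)) := by
    have h1 := (𝓕 f : 𝓢(Rn n, ℂ)).continuous
    have h2 := (𝓕 g : 𝓢(Rn n, ℂ)).continuous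
    have h3 := (𝓕 h : 𝓢(Rn n, ℂ)).continuous
    refine (hm.mul (Continuous.measurable ?_)).mul (Continuous.measurable ?_) <;> fun_prop
  conv_lhs => rw [← hT.map_eq, integral_map hT.measurable.aemeasurable hG.aestronglyMeasurable]
  refine integral_congr_ae (Filter.Eventually.of_forall fun p => ?_)
  have e : -(-(p.1 + p.2) + p.2) = p.1 := by abel
  simp only [transposeFreq, e]
  ring

theorem charForm_swap (τ : Rn n × Rn n → ℂ) (f g : 𝓢(Rn n, ℂ)) (x : Rn n) :
    charForm τ f g x = charForm (fun p => τ p.swap) g f x := by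
  have e := integral_prod_swap (μ := (volume : Measure (Rn n))) (ν := (volume : Measure (Rn n)))
    fun p : Rn n × Rn n => pairChar x x p *
      (τ p * ((𝓕 f : 𝓢(Rn n, ℂ)) p.1 * (𝓕 g : 𝓢(Rn n, ℂ)) p.2))
  refine e.symm.trans (integral_congr_ae (Filter.Eventually.of_forall fun p => ?_))
  simp only [Prod.fst_swap, Prod.snd_swap, pairChar, add_comm (inner ℝ x p.2)]
  ring

theorem FormBound.eLpNorm_top_charForm_le {τ : Rn n × Rn n → ℂ} {A : ℝ} (hτ : FormBound τ A)
    (f g : 𝓢(Rn n, ℂ)) : eLpNorm (charForm τ f g) ∞ volume ≤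
      ENNReal.ofReal A * eLpNorm f ∞ volume * eLpNorm g ∞ volume := by
  have h : ∀ x, ‖charForm τ f g x‖ ≤
      A * ((eLpNorm f ∞ volume).toReal * (eLpNorm g ∞ volume).toReal) := fun x =>
    hτ.pairChar_bound x x f g _ _ (norm_le_eLpNorm_top f) (norm_le_eLpNorm_top g)
  refine (eLpNormEssSup_le_of_ae_bound (Filter.Eventually.of_forall h)).trans (le_of_eq ?_)
  rw [ENNReal.ofReal_mul hτ.nonneg, ENNReal.ofReal_mul ENNReal.toReal_nonneg,
    ENNReal.ofReal_toReal (f.memLp ∞ volume).2.ne, ENNReal.ofReal_toReal (g.memLp ∞ volume).2.ne,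
    mul_assoc]

/-- Test against `h` with `|h| ≤ 1` and move the operator onto `h`: the transposed output is bounded
pointwise by `A ‖g‖_∞` and is paired with `f` in `L¹`. -/
theorem FormBound.eLpNorm_one_charForm_le {τ : Rn n × Rn n → ℂ} (hm : Measurable τ)
    (hb : ∃ B, ∀ p, ‖τ p‖ ≤ B) {A : ℝ} (hτ : FormBound (fun p => τ (transposeFreq p)) A)
    (f g : 𝓢(Rn n, ℂ)) : eLpNorm (charForm τ f g) 1 volume ≤
      ENNReal.ofReal A * eLpNorm f 1 volume * eLpNorm g ∞ volume := by
  refine (eLpNorm_one_le_of_forall_schwartz (contDiff_charForm hm hb f g)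
    (K := A * (1 * (eLpNorm g ∞ volume).toReal) * ∫ x, ‖f x‖) fun h hh => ?_).trans (le_of_eq ?_)
  · rw [integral_charForm_mul_transpose hm hb, ← integral_const_mul]
    refine norm_integral_le_of_norm_le (f.integrable.norm.const_mul _)
      (Filter.Eventually.of_forall fun x => ?_)
    rw [norm_mul]
    exact mul_le_mul_of_nonneg_right
      (hτ.pairChar_bound x x h g _ _ hh (norm_le_eLpNorm_top g)) (norm_nonneg _)
  · rw [one_mul, ENNReal.ofReal_mul (mul_nonneg hτ.nonneg ENNReal.toReal_nonneg),
      ENNReal.ofReal_mul hτ.nonneg, ENNReal.ofReal_toReal (g.memLp ∞ volume).2.ne,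
      ofReal_integral_norm_eq_lintegral_enorm f.integrable, ← eLpNorm_one_eq_lintegral_enorm]
    ring

end Duality

/-! ### Normalisation, symmetries of the phase and conclusion. -/

section Main

variable {n : ℕ}

theorem fourierHat_smul (f : 𝓢(Rn n, ℂ)) (ξ : Rn n) :
    fourierHat f ((2 * Real.pi) • ξ) = (𝓕 f : 𝓢(Rn n, ℂ)) ξ := by
  rw [fourier_coe, Real.fourier_eq', fourierHat]
  refine integral_congr_ae (Filter.Eventually.of_forall fun x => ?_)
  simp only [inner_smul_right, smul_eq_mul]
  congr 2
  push_cast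
  ring

/-- Substituting `2πξ, 2πη` reconciles the two Fourier conventions: the Jacobian cancels
`(2π)^{-2n}`, and homogeneity of the phase yields the constant `c = (2π)^s`. -/
theorem bilinearOp_oscillatingSymbol {s : ℝ} (σ : R2n n → ℂ) (f g : 𝓢(Rn n, ℂ)) (x : Rn n) :
    bilinearOp (oscillatingSymbol s σ) f g x =
      charForm (phaseSymbol ((2 * Real.pi) ^ s) s fun ζ => σ ((2 * Real.pi) • ζ)) f g x := by
  have hH : (volume : Measure (Rn n × Rn n)).IsAddHaarMeasure :=
    Measure.prod.instIsAddHaarMeasure volume volume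
  have h2π : 0 < 2 * Real.pi := by positivity
  have key := Measure.integral_comp_smul (volume : Measure (Rn n × Rn n))
    (fun p => Complex.exp (Complex.I * (inner ℝ x (p.1 + p.2) : ℝ)) *
      oscillatingSymbol s σ p.1 p.2 * fourierHat f p.1 * fourierHat g p.2) (2 * Real.pi)
  have hd : Module.finrank ℝ (Rn n × Rn n) = 2 * n := by
    rw [Module.finrank_prod, finrank_euclideanSpace, Fintype.card_fin]; ring
  rw [hd, abs_of_pos (by positivity), Complex.real_smul, Complex.ofReal_inv] at key
  rw [bilinearOp, ← key]
  refine integral_congr_ae (Filter.Eventually.of_forall fun p => ?_)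
  have hn : ∀ ξ : Rn n, ‖(2 * Real.pi) • ξ‖ ^ s = (2 * Real.pi) ^ s * ‖ξ‖ ^ s := fun ξ => by
    rw [norm_smul, Real.norm_of_nonneg h2π.le, Real.mul_rpow h2π.le (norm_nonneg _)]
  simp only [Prod.smul_fst, Prod.smul_snd, fourierHat_smul, oscillatingSymbol, phaseSymbol, hn,
    ← smul_add, pairChar, inner_smul_right, ← inner_add_right, ← mul_add]
  have e : (WithLp.toLp 2 ((2 * Real.pi) • p.1, (2 * Real.pi) • p.2) : R2n n) =
      (2 * Real.pi) • WithLp.toLp 2 p := rfl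
  rw [e, mul_comm Complex.I ((_ * inner ℝ x (p.1 + p.2) : ℝ) : ℂ)]
  ring

/-- `(ξ, η) ↦ (η, ξ)` on `ℝ²ⁿ`. -/
def swapEquiv (n : ℕ) : R2n n ≃L[ℝ] R2n n :=
  (WithLp.prodContinuousLinearEquiv 2 ℝ (Rn n) (Rn n)).trans
    ((ContinuousLinearEquiv.prodComm ℝ (Rn n) (Rn n)).trans
      (WithLp.prodContinuousLinearEquiv 2 ℝ (Rn n) (Rn n)).symm)

theorem transposeFreq_transposeFreq (p : Rn n × Rn n) : transposeFreq (transposeFreq p) = p := by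
  simp [transposeFreq]

/-- `(ξ, η) ↦ (-(ξ + η), η)` on `ℝ²ⁿ`. -/
def transposeEquiv (n : ℕ) : R2n n ≃L[ℝ] R2n n :=
  (WithLp.prodContinuousLinearEquiv 2 ℝ (Rn n) (Rn n)).trans
    ((ContinuousLinearEquiv.equivOfInverse
      ((-(ContinuousLinearMap.fst ℝ (Rn n) (Rn n) + ContinuousLinearMap.snd ℝ (Rn n) (Rn n))).prod
        (ContinuousLinearMap.snd ℝ (Rn n) (Rn n)))
      ((-(ContinuousLinearMap.fst ℝ (Rn n) (Rn n) + ContinuousLinearMap.snd ℝ (Rn n) (Rn n))).prod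
        (ContinuousLinearMap.snd ℝ (Rn n) (Rn n)))
      transposeFreq_transposeFreq transposeFreq_transposeFreq).trans
      (WithLp.prodContinuousLinearEquiv 2 ℝ (Rn n) (Rn n)).symm)

/-- The map permutes `|ξ|`, `|η|` and `|ξ + η|`, so the phase is invariant and only `σ` changes,
within its class. -/
theorem phaseSymbol_transposeFreq (c s : ℝ) (σ : R2n n → ℂ) (p : Rn n × Rn n) :
    phaseSymbol c s σ (transposeFreq p) = phaseSymbol c s (fun ζ => σ (transposeEquiv n ζ)) p := by
  have e : transposeEquiv n (WithLp.toLp 2 p) = WithLp.toLp 2 (transposeFreq p) := rfl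
  rw [phaseSymbol, phaseSymbol, e]
  have e2 : (transposeFreq p).1 + (transposeFreq p).2 = -p.1 := by simp [transposeFreq]
  rw [e2, norm_neg]
  simp only [transposeFreq, norm_neg]
  congr 5
  ring

theorem phaseSymbol_swap (c s : ℝ) (σ : R2n n → ℂ) (p : Rn n × Rn n) :
    phaseSymbol c s σ p.swap = phaseSymbol c s (fun ζ => σ (swapEquiv n ζ)) p := by
  have e : swapEquiv n (WithLp.toLp 2 p) = WithLp.toLp 2 p.swap := rfl
  rw [phaseSymbol, phaseSymbol, e, Prod.fst_swap, Prod.snd_swap, add_comm p.2,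
    add_comm (‖p.2‖ ^ s)]

theorem SymbolClass.comp_smul {m : ℝ} {σ : R2n n → ℂ} (hσ : SymbolClass m σ) (hm : m ≤ 0) {t : ℝ}
    (ht : t ≠ 0) : SymbolClass m fun ζ => σ (t • ζ) :=
  hσ.comp_equiv hm (ContinuousLinearEquiv.smulLeft (Units.mk0 t ht))

theorem continuous_oscillatingSymbol {s : ℝ} (hs0 : 0 < s) {σ : R2n n → ℂ} (hσ : Continuous σ) :
    Continuous fun z : Rn n × Rn n => oscillatingSymbol s σ z.1 z.2 := by
  have h1 : Continuous fun ξ : Rn n => ‖ξ‖ ^ s :=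
    continuous_norm.rpow_const fun _ => Or.inr hs0.le
  have h2 : Continuous fun z : Rn n × Rn n => σ (WithLp.toLp 2 z) :=
    hσ.comp (WithLp.prod_continuous_toLp 2 _ _)
  have h3 : Continuous fun z : Rn n × Rn n => ‖z.1‖ ^ s + ‖z.2‖ ^ s + ‖z.1 + z.2‖ ^ s :=
    ((h1.comp continuous_fst).add (h1.comp continuous_snd)).add (h1.comp continuous_add)
  exact (continuous_const.mul (Complex.continuous_ofReal.comp h3)).cexp.mul h2

theorem isBilinearMultiplier_oscillatingSymbol {p q r : ℝ≥0∞} {s m A : ℝ} (hs0 : 0 < s)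
    (hm : m ≤ 0) {σ : R2n n → ℂ} (hσ : SymbolClass m σ) (hA : 0 ≤ A)
    (h : ∀ f g : 𝓢(Rn n, ℂ), eLpNorm (charForm (phaseSymbol ((2 * Real.pi) ^ s) s
      fun ζ => σ ((2 * Real.pi) • ζ)) f g) r volume ≤
        ENNReal.ofReal A * eLpNorm f p volume * eLpNorm g q volume) :
    IsBilinearMultiplier p q r (oscillatingSymbol s σ) := by
  obtain ⟨B, -, hB⟩ := hσ.exists_norm_le hm
  refine ⟨(continuous_oscillatingSymbol hs0 hσ.1.continuous).measurable, ⟨B, 0, fun ξ η => ?_⟩,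
    -- A strictly positive constant is demanded, while `A` may be zero.
    ⟨A + 1, by linarith, fun f g => ?_⟩⟩
  · rw [Real.rpow_zero, mul_one, oscillatingSymbol, norm_mul, mul_comm Complex.I,
      Complex.norm_exp_ofReal_mul_I, one_mul]
    exact hB _
  · rw [funext (bilinearOp_oscillatingSymbol σ f g)]
    refine (h f g).trans ?_
    gcongr
    linarith

end Main

end

theorem theorem1p1 (n : ℕ) (hn : 0 < n) (s : ℝ) (hs0 : 0 < s) (hs1 : s ≠ 1)
    (m : ℝ) (hm : m < criticalOrder n s) (σ : R2n n → ℂ) (hσ : SymbolClass m σ) :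
    IsBilinearMultiplier ∞ ∞ ∞ (oscillatingSymbol s σ) ∧
      IsBilinearMultiplier 1 ∞ 1 (oscillatingSymbol s σ) ∧
      IsBilinearMultiplier ∞ 1 1 (oscillatingSymbol s σ) := by
  have hm0 : m ≤ 0 := hm.le.trans (criticalOrder_nonpos n hs0)
  have h2π : 0 < 2 * Real.pi := by positivity
  have hc : 0 < (2 * Real.pi) ^ s := Real.rpow_pos_of_pos h2π _
  have hσ' : SymbolClass m fun ζ => σ ((2 * Real.pi) • ζ) := hσ.comp_smul hm0 h2π.ne'
  obtain ⟨A, hA⟩ := exists_formBound_phaseSymbol hc hs0 hs1 hm hσ'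
  obtain ⟨A₁, hA₁⟩ := exists_formBound_phaseSymbol hc hs0 hs1 hm
    (hσ'.comp_equiv hm0 (transposeEquiv n))
  -- For `L^∞ × L¹` the inputs are exchanged before transposing, so the symbol is composed with both
  -- maps.
  obtain ⟨A₂, hA₂⟩ := exists_formBound_phaseSymbol hc hs0 hs1 hm
    ((hσ'.comp_equiv hm0 (swapEquiv n)).comp_equiv hm0 (transposeEquiv n))
  refine ⟨isBilinearMultiplier_oscillatingSymbol hs0 hm0 hσ hA.nonneg hA.eLpNorm_top_charForm_le,
    isBilinearMultiplier_oscillatingSymbol hs0 hm0 hσ hA₁.nonneg fun f g => ?_,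
    isBilinearMultiplier_oscillatingSymbol hs0 hm0 hσ hA₂.nonneg fun f g => ?_⟩
  · refine FormBound.eLpNorm_one_charForm_le hA.measurable hA.bounded ?_ f g
    simpa only [phaseSymbol_transposeFreq] using hA₁
  · rw [funext (charForm_swap _ f g), mul_right_comm]
    refine FormBound.eLpNorm_one_charForm_le (hA.measurable.comp measurable_swap)
      (hA.bounded.imp fun B hB p => hB _) ?_ g f
    simpa only [Function.comp_apply, phaseSymbol_swap, phaseSymbol_transposeFreq] using hA₂
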